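/- Let $a\ge 0$, $T>0$ and $R>R_0:=e^{(3e)^{-1}}(1+a)^{1/3}$ (so that $R_0>1$). Write $Pf=f'''+af'$ for functions $f$ on $[-1,0]$ (with one-sided derivatives at the end points), $P^0=\mathrm{Id}$, $P^n=P\circ P^{n-1}$. Let $\mathcal R_R$ be the set of real-valued $f\in C^0([-1,0])$ that are the restriction to $[-1,0]$ of a holomorphic function on the disk $D(0,R)=\{z\in\mathbb C:\ |z|<R\}$ and satisfy $(P^nf)(0)=\partial_x(P^nf)(0)=0$ for all $n\ge 0$. For $s\ge 0$, let $G^s([0,T])$ be the set of $u\in C^\infty([0,T])$ for which there are $C,\rho>0$ with $|u^{(n)}(t)|\le C\,(n!)^s/\rho^n$ for all $n\in\mathbb N$ and $t\in[0,T]$; and for $s_1,s_2\ge 0$ let $G^{s_1,s_2}([-1,0]\times[0,T])$ be the set of $y\in C^\infty([-1,0]\times[0,T])$ for which there are $C,\rho_1,\rho_2>0$ with $|\partial_x^{n_1}\partial_t^{n_2}y(x,t)|\le C\,(n_1!)^{s_1}(n_2!)^{s_2}/(\rho_1^{n_1}\rho_2^{n_2})$ for all $n_1,n_2\in\mathbb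 N$ and $(x,t)\in[-1,0]\times[0,T]$. Then for every $y_1\in\mathcal R_R$ there exists a control $u\in G^3([0,T])$ such that the system $$\begin{aligned} &\partial_ty+\partial_x^3y+a\,\partial_xy=0, && x\in(-1,0),\ t\in(0,T),\\ &y(0,t)=\partial_xy(0,t)=0,\quad y(-1,t)=u(t), && t\in(0,T),\\ &y(x,0)=0, && x\in(-1,0), \end{aligned}$$ has a classical solution $y$ ($C^3$ in $x$ and $C^1$ in $t$, with the corresponding derivatives continuous on $[-1,0]\times[0,T]$), this solution is unique, and it satisfies $y(x,T)=y_1(x)$ for all $x\in[-1,0]$. Furthermore, $y\in G^{1,3}([-1,0]\times[0,T])$. -/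

import Mathlib

open Set
open scoped ContDiff

namespace LinearKdV

/-- `u ∈ G^s([t₁, t₂])`: Gevrey functions of order `s` on a compact interval.  Derivatives are
taken within the interval (one-sided at the end points). -/
def Gevrey (s t₁ t₂ : ℝ) (u : ℝ → ℝ) : Prop :=
  ContDiffOn ℝ ∞ u (Icc t₁ t₂) ∧
    ∃ C R : ℝ, 0 < C ∧ 0 < R ∧ ∀ n : ℕ, ∀ t ∈ Icc t₁ t₂,
      |iteratedDerivWithin n u (Icc t₁ t₂) t| ≤ C * (n.factorial : ℝ) ^ s / R ^ n

/-- The partial derivative `∂ₓ^m ∂ₜ^n y (x, t)` of a function on the rectangle `X × S`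
(one-sided at the boundary). -/
noncomputable def partialDeriv (X S : Set ℝ) (m n : ℕ) (y : ℝ → ℝ → ℝ) (x t : ℝ) : ℝ :=
  iteratedDerivWithin m (fun ξ => iteratedDerivWithin n (fun τ => y ξ τ) S t) X x

/-- `y ∈ G^{s₁,s₂}([x₁, x₂] × [t₁, t₂])`: functions `y(x, t)` that are Gevrey of order `s₁` in `x`
and `s₂` in `t`. -/
def GevreyRect (s₁ s₂ x₁ x₂ t₁ t₂ : ℝ) (y : ℝ → ℝ → ℝ) : Prop :=
  ContDiffOn ℝ ∞ (fun p : ℝ × ℝ => y p.1 p.2) (Icc x₁ x₂ ×ˢ Icc t₁ t₂) ∧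
    ∃ C R₁ R₂ : ℝ, 0 < C ∧ 0 < R₁ ∧ 0 < R₂ ∧
      ∀ n₁ n₂ : ℕ, ∀ x ∈ Icc x₁ x₂, ∀ t ∈ Icc t₁ t₂,
        |partialDeriv (Icc x₁ x₂) (Icc t₁ t₂) n₁ n₂ y x t| ≤
          C * ((n₁.factorial : ℝ) ^ s₁ * (n₂.factorial : ℝ) ^ s₂) / (R₁ ^ n₁ * R₂ ^ n₂)

/-- The operator `P = ∂ₓ³ + a ∂ₓ` on functions on `[-1, 0]`. -/
noncomputable def P (a : ℝ) (f : ℝ → ℝ) : ℝ → ℝ := fun x =>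
  iteratedDerivWithin 3 f (Icc (-1) 0) x + a * derivWithin f (Icc (-1) 0) x

/-- The class `𝓡_R` (for `R > 1`): continuous functions on `[-1, 0]` that are restrictions of
holomorphic functions on `D(0, R)`, with `(Pⁿ y)(0) = ∂ₓ(Pⁿ y)(0) = 0` for all `n ≥ 0`. -/
def reachClass (a R : ℝ) : Set (ℝ → ℝ) :=
  {y | ContinuousOn y (Icc (-1) 0) ∧
    (∃ z : ℂ → ℂ, DifferentiableOn ℂ z (Metric.ball 0 R) ∧
      ∀ x ∈ Icc (-1 : ℝ) 0, (y x : ℂ) = z (x : ℂ)) ∧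
    ∀ n : ℕ, ((P a)^[n] y) 0 = 0 ∧ derivWithin ((P a)^[n] y) (Icc (-1) 0) 0 = 0}

/-- `R₀ = e^{1/(3e)} (1 + a)^{1/3}`. -/
noncomputable def R₀ (a : ℝ) : ℝ :=
  Real.exp ((3 * Real.exp 1)⁻¹) * (1 + a) ^ ((1 : ℝ) / 3)

/-- The requirement `R > 1` in the definition of `𝓡_R` is implied by `R > R₀`. -/
theorem one_lt_R₀ {a : ℝ} (ha : 0 ≤ a) : 1 < R₀ a := by
  have h1 : 1 < Real.exp ((3 * Real.exp 1)⁻¹) := Real.one_lt_exp_iff.2 (by positivity)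
  have h2 : 1 ≤ (1 + a) ^ ((1 : ℝ) / 3) := Real.one_le_rpow (by linarith) (by norm_num)
  unfold R₀
  nlinarith

/-- `y = y(x, t)` is a classical solution, of class `C³` in `x` and `C¹` in `t` up to the boundary of
`[-1, 0] × [0, T]`, of
`∂ₜy + ∂ₓ³y + a ∂ₓy = 0`, `y(0, t) = ∂ₓy(0, t) = 0`, `y(-1, t) = u(t)`, `y(x, 0) = y₀(x)`
for `x ∈ (-1, 0)`, `t ∈ (0, T)`. -/
structure IsSolution (a T : ℝ) (u y₀ : ℝ → ℝ) (y : ℝ → ℝ → ℝ) : Prop where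
  contDiff_x : ∀ t ∈ Icc 0 T, ContDiffOn ℝ 3 (fun x => y x t) (Icc (-1) 0)
  contDiff_t : ∀ x ∈ Icc (-1 : ℝ) 0, ContDiffOn ℝ 1 (fun t => y x t) (Icc 0 T)
  continuous_x : ∀ m ≤ 3, ContinuousOn
    (fun p : ℝ × ℝ => partialDeriv (Icc (-1) 0) (Icc 0 T) m 0 y p.1 p.2) (Icc (-1) 0 ×ˢ Icc 0 T)
  continuous_t : ContinuousOn
    (fun p : ℝ × ℝ => partialDeriv (Icc (-1) 0) (Icc 0 T) 0 1 y p.1 p.2) (Icc (-1) 0 ×ˢ Icc 0 T)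
  equation : ∀ x ∈ Ioo (-1 : ℝ) 0, ∀ t ∈ Ioo 0 T,
    partialDeriv (Icc (-1) 0) (Icc 0 T) 0 1 y x t
      + partialDeriv (Icc (-1) 0) (Icc 0 T) 3 0 y x t
      + a * partialDeriv (Icc (-1) 0) (Icc 0 T) 1 0 y x t = 0
  boundary_right : ∀ t ∈ Ioo 0 T, y 0 t = 0
  boundary_right_deriv : ∀ t ∈ Ioo 0 T, partialDeriv (Icc (-1) 0) (Icc 0 T) 1 0 y 0 t = 0
  boundary_left : ∀ t ∈ Ioo 0 T, y (-1) t = u t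
  initial : ∀ x ∈ Ioo (-1 : ℝ) 0, y x 0 = y₀ x

end LinearKdV

namespace LinearKdV

open Filter Topology

/-! ### Factorials -/

/-! Reverse time: with `y(x,t) = Y(x,T-t)` the task is to find a solution of `∂ₜY = PY`, `Y = ∂ₓY =
0` at `x = 0`, that equals `y₁` at time `0` and vanishes at time `T` (`IsFlow`,
`exists_flow_connecting_zero`). The equation leaves the trace `∂ₓ²Y(0,·)` free, and this trace
determines all Taylor coefficients of `Y` at `x = 0`. The control is the value of `Y` at `x = -1`.

Connecting `y₁` to zero. Suppose `A` is a flow on `[0,∞)` with `A(·,0) = y₁` whose trace is analytic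
for `t > 0`. Multiply the trace by a Gevrey cutoff of order 2 that vanishes near `0` and is `1` near
`T`, and solve the Cauchy problem in `x` with this trace (`isFlow_cauchyFlow`). A trace of order 2
makes the power series in `x` entire, because three `x`-derivatives cost only one `t`-derivative.
The difference of `A` and this flow is `y₁` at time `0`. At time `T` the two traces have the same
derivatives, so both flows have the same Taylor series at `x = 0`, and analytic bounds make them
equal (`eqOn_of_analytic_bound`).

Constructing `A`. Its trace must have the derivatives `dₙ = ∂ₓ²Pⁿy₁(0)` at `t = 0`. Cauchy's
estimates on the circle of radius `R₀` bound them by `C qⁿ (3n+N)!` with `q = (1+a)/R₀³ = e^{-1/e}`.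
This is of Gevrey order 3, too large for the Cauchy problem in `x`, so `A` is built instead as a
superposition `∫ M e^{lt} G(x,l)` of exponential flows, where `PG = lG` and `G = ∂ₓG = 0`, `∂ₓ²G =
1` at `x = 0`. One needs `∫ M lⁿ = dₙ`. The integral `∫₀^∞ r^{3n+N+1} σ^{3n+N} e^{-rσ} dσ =
(3n+N)!`, valid for every ray direction with `Re r > 0`, produces the factorials, and a Fourier
integral over a circle produces the coefficients `bₙ = dₙ/(ρⁿ(3n+N)!)`, with exponents `l = ρ e^{iθ}
r³ σ³` (`integral_ray_moment`). The direction `r = r(θ)` has to meet two demands: `Re(e^{iθ}r³) <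
0`, so that `e^{lt}` decays, and `e^{-Re(r)σ}` must beat the growth of `G` on `[-1,0]`, which is
governed by the largest real part of a cube root of `-l` (`norm_eigenfun_le`). Two pairs of
conjugate directions suffice for `ρ = (25/28)³`, which exceeds `e^{-1/e}` (`ratio_lt`), so `bₙ` is
summable. Polynomial factors in `σ` against exponential decay give the orders 1 in `x` and 3 in `t`,
up to `t = 0`.

Uniqueness is the energy estimate for the difference of two solutions. -/

theorem factorial_add_le (m n : ℕ) :
    ((m + n).factorial : ℝ) ≤ 2 ^ (m + n) * (m.factorial * n.factorial) := by
  have h1 := Nat.add_choose_mul_factorial_mul_factorial m n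
  have h2 : (m + n).choose n ≤ 2 ^ (m + n) := Nat.choose_le_two_pow _ _
  rw [← h1, mul_assoc]
  push_cast
  gcongr
  exact_mod_cast h2

theorem factorial_three_mul_le (n : ℕ) : ((3 * n).factorial : ℝ) ≤ 32 ^ n * (n.factorial : ℝ) ^ 3 := by
  have h1 := factorial_add_le n (2 * n)
  have h2 := factorial_add_le n n
  rw [show n + 2 * n = 3 * n by ring] at h1
  rw [show n + n = 2 * n by ring] at h2
  calc ((3 * n).factorial : ℝ) ≤ 2 ^ (3 * n) * (n.factorial * (2 * n).factorial) := h1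
    _ ≤ 2 ^ (3 * n) * (n.factorial * (2 ^ (2 * n) * (n.factorial * n.factorial))) := by gcongr
    _ = 32 ^ n * (n.factorial : ℝ) ^ 3 := by
      rw [pow_mul, pow_mul, show (32 : ℝ) = 2 ^ 3 * 2 ^ 2 by norm_num, mul_pow]; ring

theorem factorial_pow_three_le (n : ℕ) : (n.factorial : ℝ) ^ 3 ≤ ((3 * n).factorial : ℝ) := by
  have h1 : n.factorial * n.factorial ≤ (n + n).factorial :=
    Nat.le_of_dvd (Nat.factorial_pos _) (Nat.factorial_mul_factorial_dvd_factorial_add n n)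
  have h2 : n.factorial * (n + n).factorial ≤ (n + (n + n)).factorial :=
    Nat.le_of_dvd (Nat.factorial_pos _) (Nat.factorial_mul_factorial_dvd_factorial_add _ _)
  have h3 : n.factorial ^ 3 ≤ (3 * n).factorial := by
    calc n.factorial ^ 3 = n.factorial * (n.factorial * n.factorial) := by ring
      _ ≤ n.factorial * (n + n).factorial := by gcongr
      _ ≤ _ := h2
      _ = _ := by congr 1; ring
  exact_mod_cast h3

/-! ### Families of derivatives -/

theorem iteratedDerivWithin_eq_of_family {F : ℕ → ℝ → ℝ} {s : Set ℝ} (hs : UniqueDiffOn ℝ s)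
    (h : ∀ m, ∀ x ∈ s, HasDerivWithinAt (F m) (F (m + 1) x) s x) (k m : ℕ) :
    ∀ x ∈ s, iteratedDerivWithin k (F m) s x = F (m + k) x := by
  induction k with
  | zero => intro x _; simp
  | succ k ih =>
    intro x hx
    rw [iteratedDerivWithin_succ, derivWithin_congr ih (ih x hx)]
    exact (h (m + k) x hx).derivWithin (hs x hx)

/-- The mean value inequality is applied twice, to `f'` and to `z ↦ f z - f' x * z`. The factor
`1/2` of Taylor's formula is lost, which is harmless for little-o purposes. -/
theorem abs_sub_sub_le_of_second_deriv {f f' f'' : ℝ → ℝ} {s : Set ℝ} (hs : Convex ℝ s) {K : ℝ}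
    (h : ∀ x ∈ s, HasDerivWithinAt f (f' x) s x) (h' : ∀ x ∈ s, HasDerivWithinAt f' (f'' x) s x)
    (hK : ∀ x ∈ s, |f'' x| ≤ K) {x y : ℝ} (hx : x ∈ s) (hy : y ∈ s) :
    |f y - f x - f' x * (y - x)| ≤ K * |y - x| * |y - x| := by
  have hsub : uIcc x y ⊆ s := hs.ordConnected.uIcc_subset hx hy
  have key := (convex_uIcc x y).norm_image_sub_le_of_norm_hasDerivWithin_le
    (f := fun z => f z - f' x * z) (f' := fun z => f' z - f' x * 1) (C := K * |y - x|)
    (fun z hz => ((h z (hsub hz)).mono hsub).sub ((hasDerivWithinAt_id z _).const_mul (f' x)))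
    (fun z hz => ?_) left_mem_uIcc right_mem_uIcc
  · simp only [Real.norm_eq_abs] at key
    convert key using 2
    ring
  · rw [mul_one]
    have h1 := hs.norm_image_sub_le_of_norm_hasDerivWithin_le h'
      (fun u hu => hK u hu) hx (hsub hz)
    rw [Real.norm_eq_abs, Real.norm_eq_abs] at h1
    have h2 : |z - x| ≤ |y - x| := abs_sub_left_of_mem_uIcc hz
    have hK0 : 0 ≤ K := (abs_nonneg _).trans (hK x hx)
    rw [Real.norm_eq_abs]
    exact h1.trans (by gcongr)

/-- A family of functions on `X × S` consisting of the partial derivatives `∂ₓ^m ∂ₜ^n F₀₀`, each of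
them bounded. -/
structure IsPartialFamily (X S : Set ℝ) (F : ℕ → ℕ → ℝ → ℝ → ℝ) : Prop where
  hasDeriv_x : ∀ m n, ∀ x ∈ X, ∀ t ∈ S,
    HasDerivWithinAt (fun ξ => F m n ξ t) (F (m + 1) n x t) X x
  hasDeriv_t : ∀ m n, ∀ x ∈ X, ∀ t ∈ S,
    HasDerivWithinAt (fun τ => F m n x τ) (F m (n + 1) x t) S t
  bounded : ∀ m n, ∃ K, ∀ x ∈ X, ∀ t ∈ S, |F m n x t| ≤ K

namespace IsPartialFamily

variable {X S : Set ℝ} {F : ℕ → ℕ → ℝ → ℝ → ℝ}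

/-- Moving first in `t` and then in `x`, the remainder is quadratic, since the three second partial
derivatives are bounded. No continuity in two variables is assumed; it comes out as a consequence.
-/
theorem hasFDerivWithinAt (hF : IsPartialFamily X S F) (hX : Convex ℝ X) (hS : Convex ℝ S)
    (m n : ℕ) {p : ℝ × ℝ} (hp : p ∈ X ×ˢ S) :
    HasFDerivWithinAt (fun p : ℝ × ℝ => F m n p.1 p.2)
      (F (m + 1) n p.1 p.2 • ContinuousLinearMap.fst ℝ ℝ ℝ
        + F m (n + 1) p.1 p.2 • ContinuousLinearMap.snd ℝ ℝ ℝ) (X ×ˢ S) p := by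
  obtain ⟨K₁, hK₁⟩ := hF.bounded (m + 2) n
  obtain ⟨K₂, hK₂⟩ := hF.bounded (m + 1) (n + 1)
  obtain ⟨K₃, hK₃⟩ := hF.bounded m (n + 2)
  obtain ⟨x, t⟩ := p
  obtain ⟨hx, ht⟩ := hp
  simp only at hx ht ⊢
  have hK₁0 : 0 ≤ K₁ := (abs_nonneg _).trans (hK₁ x hx t ht)
  have hK₂0 : 0 ≤ K₂ := (abs_nonneg _).trans (hK₂ x hx t ht)
  have hK₃0 : 0 ≤ K₃ := (abs_nonneg _).trans (hK₃ x hx t ht)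
  rw [hasFDerivWithinAt_iff_isLittleO]
  refine (Asymptotics.IsBigO.of_bound (K₁ + K₂ + K₃) ?_).trans_isLittleO
    ((Asymptotics.isLittleO_pow_sub_sub (x, t) one_lt_two).mono nhdsWithin_le_nhds)
  filter_upwards [self_mem_nhdsWithin] with q hq
  obtain ⟨y, s⟩ := q
  obtain ⟨hy, hs⟩ := hq
  simp only at hy hs ⊢
  have e1 := abs_sub_sub_le_of_second_deriv hX (fun z hz => hF.hasDeriv_x m n z hz s hs)
    (fun z hz => hF.hasDeriv_x (m + 1) n z hz s hs) (fun z hz => hK₁ z hz s hs) hx hy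
  have e3 := abs_sub_sub_le_of_second_deriv hS (fun z hz => hF.hasDeriv_t m n x hx z hz)
    (fun z hz => hF.hasDeriv_t m (n + 1) x hx z hz) (fun z hz => hK₃ x hx z hz) ht hs
  have e2 := hS.norm_image_sub_le_of_norm_hasDerivWithin_le
    (fun z hz => hF.hasDeriv_t (m + 1) n x hx z hz)
    (fun z hz => hK₂ x hx z hz) ht hs
  have d1 : |y - x| ≤ ‖((y, s) : ℝ × ℝ) - (x, t)‖ := 
    norm_fst_le (((y, s) : ℝ × ℝ) - (x, t))
  have d2 : |s - t| ≤ ‖((y, s) : ℝ × ℝ) - (x, t)‖ := 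
    norm_snd_le (((y, s) : ℝ × ℝ) - (x, t))
  set d := ‖((y, s) : ℝ × ℝ) - (x, t)‖
  rw [Real.norm_eq_abs, Real.norm_eq_abs] at e2
  rw [Real.norm_eq_abs, Real.norm_eq_abs, abs_of_nonneg (by positivity : 0 ≤ d ^ 2)]
  calc _ = |(F m n y s - F m n x s - F (m + 1) n x s * (y - x))
        + (F (m + 1) n x s - F (m + 1) n x t) * (y - x)
        + (F m n x s - F m n x t - F m (n + 1) x t * (s - t))| := by
        congr 1; simp; ring
    _ ≤ K₁ * |y - x| * |y - x| + K₂ * |s - t| * |y - x| + K₃ * |s - t| * |s - t| := by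
        refine (abs_add_le _ _).trans (add_le_add ((abs_add_le _ _).trans (add_le_add e1 ?_)) e3)
        rw [abs_mul]
        gcongr
    _ ≤ K₁ * d * d + K₂ * d * d + K₃ * d * d := by gcongr
    _ = _ := by ring

theorem continuousOn (hF : IsPartialFamily X S F) (hX : Convex ℝ X) (hS : Convex ℝ S) (m n : ℕ) :
    ContinuousOn (fun p : ℝ × ℝ => F m n p.1 p.2) (X ×ˢ S) :=
  fun _ hp => (hF.hasFDerivWithinAt hX hS m n hp).continuousWithinAt

/-- The components of the total derivative of a member are again members of the family, so
smoothness follows by induction for all members at once. -/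
theorem contDiffOn (hF : IsPartialFamily X S F) (hX : Convex ℝ X) (hS : Convex ℝ S)
    (hX' : UniqueDiffOn ℝ X) (hS' : UniqueDiffOn ℝ S) (m n : ℕ) :
    ContDiffOn ℝ ∞ (fun p : ℝ × ℝ => F m n p.1 p.2) (X ×ˢ S) := by
  rw [contDiffOn_infty]
  intro k
  induction k generalizing m n with
  | zero => simpa using! hF.continuousOn hX hS m n
  | succ k ih =>
    push_cast
    rw [contDiffOn_succ_iff_hasFDerivWithinAt_of_uniqueDiffOn (hX'.prod hS')]
    refine ⟨by simp, _, ?_, fun p hp => hF.hasFDerivWithinAt hX hS m n hp⟩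
    exact ((ih (m + 1) n).smul contDiffOn_const).add ((ih m (n + 1)).smul contDiffOn_const)

theorem partialDeriv_eq (hF : IsPartialFamily X S F) (hX' : UniqueDiffOn ℝ X)
    (hS' : UniqueDiffOn ℝ S) (m n : ℕ) {x t : ℝ} (hx : x ∈ X) (ht : t ∈ S) :
    partialDeriv X S m n (F 0 0) x t = F m n x t := by
  unfold partialDeriv
  have h1 : EqOn (fun ξ => iteratedDerivWithin n (fun τ => F 0 0 ξ τ) S t)
      (fun ξ => F 0 n ξ t) X := fun ξ hξ => by
    simpa using iteratedDerivWithin_eq_of_family hS' (F := fun n τ => F 0 n ξ τ)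
      (fun n τ hτ => hF.hasDeriv_t 0 n ξ hξ τ hτ) n 0 t ht
  rw [iteratedDerivWithin_congr h1 hx]
  simpa using iteratedDerivWithin_eq_of_family hX' (F := fun m ξ => F m n ξ t)
      (fun m ξ hξ => hF.hasDeriv_x m n ξ hξ t ht) m 0 x hx

end IsPartialFamily

/-- The partial derivatives of a solution of `∂ₜY = P Y` on `[-1, 0] × S` with `Y = ∂ₓY = 0` at
`x = 0`, with Gevrey bounds of orders `1` in `x` and `3` in `t`. -/
structure IsFlow (a : ℝ) (S : Set ℝ) (Y : ℕ → ℕ → ℝ → ℝ → ℝ) : Prop where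
  hasDeriv_x : ∀ m n, ∀ x ∈ Icc (-1 : ℝ) 0, ∀ t ∈ S,
    HasDerivWithinAt (fun ξ => Y m n ξ t) (Y (m + 1) n x t) (Icc (-1) 0) x
  hasDeriv_t : ∀ m n, ∀ x ∈ Icc (-1 : ℝ) 0, ∀ t ∈ S,
    HasDerivWithinAt (fun τ => Y m n x τ) (Y m (n + 1) x t) S t
  equation : ∀ m n, ∀ x ∈ Icc (-1 : ℝ) 0, ∀ t ∈ S,
    Y (m + 3) n x t + a * Y (m + 1) n x t = Y m (n + 1) x t
  zero_right : ∀ n, ∀ t ∈ S, Y 0 n 0 t = 0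
  zero_right_deriv : ∀ n, ∀ t ∈ S, Y 1 n 0 t = 0
  bound : ∃ C D : ℝ, 0 < C ∧ 0 < D ∧ ∀ m n, ∀ x ∈ Icc (-1 : ℝ) 0, ∀ t ∈ S,
    |Y m n x t| ≤ C * D ^ (m + n) * (m.factorial * (n.factorial : ℝ) ^ 3)

/-! ### Flows of `∂ₜY = PY` and the time-reversed solutions they give -/

namespace IsFlow

variable {a : ℝ} {S : Set ℝ} {Y : ℕ → ℕ → ℝ → ℝ → ℝ}

theorem mono (hY : IsFlow a S Y) {S' : Set ℝ} (h : S' ⊆ S) : IsFlow a S' Y where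
  hasDeriv_x m n x hx t ht := hY.hasDeriv_x m n x hx t (h ht)
  hasDeriv_t m n x hx t ht := (hY.hasDeriv_t m n x hx t (h ht)).mono h
  equation m n x hx t ht := hY.equation m n x hx t (h ht)
  zero_right n t ht := hY.zero_right n t (h ht)
  zero_right_deriv n t ht := hY.zero_right_deriv n t (h ht)
  bound := by
    obtain ⟨C, D, hC, hD, hb⟩ := hY.bound
    exact ⟨C, D, hC, hD, fun m n x hx t ht => hb m n x hx t (h ht)⟩

theorem sub {Z : ℕ → ℕ → ℝ → ℝ → ℝ} (hY : IsFlow a S Y) (hZ : IsFlow a S Z) :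
    IsFlow a S (fun m n x t => Y m n x t - Z m n x t) where
  hasDeriv_x m n x hx t ht := (hY.hasDeriv_x m n x hx t ht).sub (hZ.hasDeriv_x m n x hx t ht)
  hasDeriv_t m n x hx t ht := (hY.hasDeriv_t m n x hx t ht).sub (hZ.hasDeriv_t m n x hx t ht)
  equation m n x hx t ht := by rw [← hY.equation m n x hx t ht, ← hZ.equation m n x hx t ht]; ring
  zero_right n t ht := by rw [hY.zero_right n t ht, hZ.zero_right n t ht, sub_zero]
  zero_right_deriv n t ht := by
    rw [hY.zero_right_deriv n t ht, hZ.zero_right_deriv n t ht, sub_zero]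
  bound := by
    obtain ⟨C, D, hC, hD, hb⟩ := hY.bound
    obtain ⟨C', D', hC', hD', hb'⟩ := hZ.bound
    refine ⟨C + C', max D D', by positivity, by positivity, fun m n x hx t ht => ?_⟩
    calc |Y m n x t - Z m n x t| ≤ |Y m n x t| + |Z m n x t| := abs_sub _ _
      _ ≤ C * max D D' ^ (m + n) * (m.factorial * (n.factorial : ℝ) ^ 3)
          + C' * max D D' ^ (m + n) * (m.factorial * (n.factorial : ℝ) ^ 3) := by
        refine add_le_add ((hb m n x hx t ht).trans ?_) ((hb' m n x hx t ht).trans ?_)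
        · gcongr; exact le_max_left _ _
        · gcongr; exact le_max_right _ _
      _ = _ := by ring

/-- Reversing time turns a flow into the family of partial derivatives of a solution of the
linear KdV equation. -/
theorem isPartialFamily_reverse {T : ℝ} (hY : IsFlow a (Icc 0 T) Y) :
    IsPartialFamily (Icc (-1) 0) (Icc 0 T) (fun m n x t => (-1) ^ n * Y m n x (T - t)) where
  hasDeriv_x m n x hx t ht := (hY.hasDeriv_x m n x hx (T - t)
    ⟨by linarith [ht.2], by linarith [ht.1]⟩).const_mul _
  hasDeriv_t m n x hx t ht := by
    have h1 : HasDerivWithinAt (fun τ : ℝ => T - τ) (-1) (Icc 0 T) t := by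
      simpa using (hasDerivWithinAt_id t (Icc 0 T)).const_sub T
    have hmaps : MapsTo (fun τ : ℝ => T - τ) (Icc 0 T) (Icc 0 T) :=
      fun τ hτ => ⟨by linarith [hτ.2], by linarith [hτ.1]⟩
    have h2 := (hY.hasDeriv_t m n x hx (T - t) (hmaps ht)).scomp t h1 hmaps
    convert! h2.const_mul ((-1) ^ n) using 1
    simp [pow_succ]
  bounded m n := by
    obtain ⟨C, D, hC, hD, hb⟩ := hY.bound
    refine ⟨C * D ^ (m + n) * (m.factorial * (n.factorial : ℝ) ^ 3), fun x hx t ht => ?_⟩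
    rw [abs_mul, abs_pow, abs_neg, abs_one, one_pow, one_mul]
    exact hb m n x hx (T - t) ⟨by linarith [ht.2], by linarith [ht.1]⟩

variable {T : ℝ}

theorem partialDeriv_reverse (hT : 0 < T) (hY : IsFlow a (Icc 0 T) Y) (m n : ℕ) {x t : ℝ}
    (hx : x ∈ Icc (-1 : ℝ) 0) (ht : t ∈ Icc 0 T) :
    partialDeriv (Icc (-1) 0) (Icc 0 T) m n (fun x t => Y 0 0 x (T - t)) x t
      = (-1) ^ n * Y m n x (T - t) := by
  have h := hY.isPartialFamily_reverse.partialDeriv_eq (uniqueDiffOn_Icc (by norm_num))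
    (uniqueDiffOn_Icc hT) m n hx ht
  simpa using h

theorem gevreyRect (hT : 0 < T) (hY : IsFlow a (Icc 0 T) Y) :
    GevreyRect 1 3 (-1) 0 0 T (fun x t => Y 0 0 x (T - t)) := by
  constructor
  · have h := hY.isPartialFamily_reverse.contDiffOn (convex_Icc _ _) (convex_Icc _ _)
      (uniqueDiffOn_Icc (by norm_num)) (uniqueDiffOn_Icc hT) 0 0
    simpa using h
  · obtain ⟨C, D, hC, hD, hb⟩ := hY.bound
    refine ⟨C, D⁻¹, D⁻¹, hC, by positivity, by positivity, fun m n x hx t ht => ?_⟩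
    rw [hY.partialDeriv_reverse hT m n hx ht, abs_mul, abs_pow, abs_neg, abs_one, one_pow, one_mul]
    refine (hb m n x hx (T - t) ⟨by linarith [ht.2], by linarith [ht.1]⟩).trans (le_of_eq ?_)
    rw [Real.rpow_one, show (3 : ℝ) = ((3 : ℕ) : ℝ) by norm_num, Real.rpow_natCast, inv_pow, inv_pow,
      pow_add]
    field_simp

theorem gevrey_left (hT : 0 < T) (hY : IsFlow a (Icc 0 T) Y) :
    Gevrey 3 0 T (fun t => Y 0 0 (-1) (T - t)) := by
  obtain ⟨h1, C, R₁, R₂, hC, hR₁, hR₂, hb⟩ := hY.gevreyRect hT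
  have hm : (-1 : ℝ) ∈ Icc (-1 : ℝ) 0 := by norm_num
  refine ⟨?_, C, R₂, hC, hR₂, fun n t ht => ?_⟩
  · exact h1.comp (f := fun t : ℝ => ((-1 : ℝ), t)) (by fun_prop) (fun t ht => ⟨hm, ht⟩)
  · have := hb 0 n (-1) hm t ht
    simpa [partialDeriv] using this

/-- Time reversal changes the sign of `∂ₜ`, and the vanishing of the flow at time `T` becomes the
zero initial state. -/
theorem isSolution (hT : 0 < T) (hY : IsFlow a (Icc 0 T) Y)
    (h0 : ∀ x ∈ Icc (-1 : ℝ) 0, Y 0 0 x T = 0) :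
    IsSolution a T (fun t => Y 0 0 (-1) (T - t)) (fun _ => 0) (fun x t => Y 0 0 x (T - t)) := by
  have hG := (hY.gevreyRect hT).1
  have hF := hY.isPartialFamily_reverse
  have hmem : ∀ t ∈ Icc 0 T, T - t ∈ Icc 0 T := fun t ht => ⟨by linarith [ht.2], by linarith [ht.1]⟩
  have hcont : ∀ m n, ContinuousOn
      (fun p : ℝ × ℝ => partialDeriv (Icc (-1) 0) (Icc 0 T) m n
        (fun x t => Y 0 0 x (T - t)) p.1 p.2) (Icc (-1) 0 ×ˢ Icc 0 T) := fun m n =>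
    (hF.continuousOn (convex_Icc _ _) (convex_Icc _ _) m n).congr
      fun p hp => hY.partialDeriv_reverse hT m n hp.1 hp.2
  refine ⟨fun t ht => ?_, fun x hx => ?_, fun m _ => hcont m 0, hcont 0 1, fun x hx t ht => ?_,
    fun t ht => ?_, fun t ht => ?_, fun t ht => rfl, fun x hx => ?_⟩
  · exact contDiffOn_infty.1
      (hG.comp (f := fun x : ℝ => (x, t)) (by fun_prop) (fun x hx => ⟨hx, ht⟩)) 3
  · exact_mod_cast contDiffOn_infty.1
      (hG.comp (f := fun t : ℝ => (x, t)) (by fun_prop) (fun t ht => ⟨hx, ht⟩)) 1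
  · have hx' := Ioo_subset_Icc_self hx
    have ht' := Ioo_subset_Icc_self ht
    rw [hY.partialDeriv_reverse hT _ _ hx' ht', hY.partialDeriv_reverse hT _ _ hx' ht',
      hY.partialDeriv_reverse hT _ _ hx' ht']
    have := hY.equation 0 0 x hx' (T - t) (hmem t ht')
    simp only [zero_add] at this ⊢
    linarith
  · exact hY.zero_right 0 _ (hmem t (Ioo_subset_Icc_self ht))
  · rw [hY.partialDeriv_reverse hT _ _ (by norm_num) (Ioo_subset_Icc_self ht),
      hY.zero_right_deriv 0 _ (hmem t (Ioo_subset_Icc_self ht)), mul_zero]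
  · simpa using h0 x (Ioo_subset_Icc_self hx)

end IsFlow

/-! ### Uniqueness for families with analytic bounds -/

/-- All derivatives vanish at `0`, so integrating the bound for the derivative of order `m + N`
exactly `N` times gives a bound of size `(2Dx)^N` up to a constant, which tends to `0` when `2Dh <
1`. -/
theorem eq_zero_of_analytic_bound_Icc {F : ℕ → ℝ → ℝ} {C D h : ℝ} (hC : 0 ≤ C) (hD : 0 < D)
    (hh : D * h < 1 / 2)
    (hF : ∀ m, ∀ x ∈ Icc 0 h, HasDerivWithinAt (F m) (F (m + 1) x) (Icc 0 h) x)
    (hb : ∀ m, ∀ x ∈ Icc 0 h, |F m x| ≤ C * D ^ m * m.factorial) (h0 : ∀ m, F m 0 = 0) :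
    ∀ m, ∀ x ∈ Icc 0 h, F m x = 0 := by
  intro m x hx
  have key : ∀ N m, ∀ x ∈ Icc 0 h,
      |F m x| ≤ C * D ^ (m + N) * (m + N).factorial * (x ^ N / N.factorial) := by
    intro N
    induction N with
    | zero => intro m x hx; simpa using hb m x hx
    | succ N ih =>
      intro m x hx
      refine image_norm_le_of_norm_deriv_right_le_deriv_boundary (f := F m) (f' := F (m + 1))
        (a := 0) (b := h)
        (B := fun x => C * D ^ (m + (N + 1)) * (m + (N + 1)).factorial
          * (x ^ (N + 1) / (N + 1).factorial))
        (B' := fun x => C * D ^ (m + (N + 1)) * (m + (N + 1)).factorial * (x ^ N / N.factorial))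
        (fun y hy => (hF m y hy).continuousWithinAt) (fun y hy => ?_) (by simp [h0]) (fun y => ?_)
        (fun y hy => ?_) hx
      · exact (hF m y (Ico_subset_Icc_self hy)).mono_of_mem_nhdsWithin
          (mem_of_superset (Icc_mem_nhdsGE hy.2) (Icc_subset_Icc_left hy.1))
      · have h1 := ((hasDerivAt_pow (N + 1) y).div_const ((N + 1).factorial : ℝ)).const_mul
          (C * D ^ (m + (N + 1)) * (m + (N + 1)).factorial)
        refine h1.congr_deriv ?_
        rw [Nat.factorial_succ]
        push_cast
        field_simp
      · have := ih (m + 1) y (Ico_subset_Icc_self hy)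
        rwa [show m + 1 + N = m + (N + 1) by ring] at this
  have hx0 := hx.1
  have hlim : Tendsto (fun N : ℕ => C * (2 * D) ^ m * m.factorial * (2 * D * x) ^ N) atTop (𝓝 0) := by
    have : Tendsto (fun N : ℕ => (2 * D * x) ^ N) atTop (𝓝 0) := by
      apply tendsto_pow_atTop_nhds_zero_of_lt_one (by positivity)
      nlinarith [mul_le_mul_of_nonneg_left hx.2 hD.le]
    simpa using this.const_mul (C * (2 * D) ^ m * m.factorial)
  have hle : |F m x| ≤ 0 := by
    refine ge_of_tendsto' hlim fun N => (key N m x hx).trans ?_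
    calc C * D ^ (m + N) * (m + N).factorial * (x ^ N / N.factorial)
        ≤ C * D ^ (m + N) * (2 ^ (m + N) * (m.factorial * N.factorial)) * (x ^ N / N.factorial) := by
          gcongr; exact factorial_add_le m N
      _ = _ := by
        rw [pow_add, pow_add, mul_pow, mul_pow, mul_pow]
        field_simp
  exact abs_nonpos_iff.1 hle

/-- Analytic continuation in real variables: the local statement is iterated leftwards from `0`,
with a step length that depends only on `D`. -/
theorem eq_zero_of_analytic_bound {F : ℕ → ℝ → ℝ} {C D : ℝ} (hC : 0 ≤ C) (hD : 0 < D)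
    (hF : ∀ m, ∀ x ∈ Icc (-1 : ℝ) 0, HasDerivWithinAt (F m) (F (m + 1) x) (Icc (-1) 0) x)
    (hb : ∀ m, ∀ x ∈ Icc (-1 : ℝ) 0, |F m x| ≤ C * D ^ m * m.factorial)
    (h0 : ∀ m, F m 0 = 0) : ∀ x ∈ Icc (-1 : ℝ) 0, F 0 x = 0 := by
  -- Steps of length `1/K < 1/(2D)` are short enough for the local statement, and `K` of them cover
  -- `[-1, 0]`.
  obtain ⟨K, hK⟩ := exists_nat_gt (2 * D)
  have hK0 : (0 : ℝ) < K := by linarith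
  set h : ℝ := 1 / K with hh
  have hhpos : 0 < h := by positivity
  have hDh : D * h < 1 / 2 := by rw [hh, mul_one_div, div_lt_iff₀ hK0]; linarith
  have step : ∀ j : ℕ, ∀ m, ∀ x ∈ Icc (-1 : ℝ) 0, -(j * h) ≤ x → F m x = 0 := by
    intro j
    induction j with
    | zero =>
      intro m x hx hj
      have : x = 0 := le_antisymm hx.2 (by simpa using hj)
      rw [this, h0]
    | succ j ih =>
      intro m x hx hj
      by_cases hxj : -(j * h) ≤ x
      · exact ih m x hx hxj
      push Not at hxj
      have hj0 : -(j * h) ≤ 0 := by have : (0 : ℝ) ≤ j * h := by positivity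
                                    linarith
      set c : ℝ := -(j * h) with hc
      have hcm : c ∈ Icc (-1 : ℝ) 0 := ⟨by linarith [hx.1], hj0⟩
      have hmaps : MapsTo (fun s : ℝ => c - s) (Icc 0 (c - x)) (Icc (-1 : ℝ) 0) :=
        fun s hs => ⟨by linarith [hx.1, hs.2], by linarith [hs.1]⟩
      have hcx : c - x ≤ h := by
        have : ((j + 1 : ℕ) : ℝ) * h = j * h + h := by push_cast; ring
        rw [this] at hj
        linarith
      -- The local statement runs to the right; the reflection `s ↦ c - s` turns it around and puts
      -- the sign `(-1)^m` on the derivative of order `m`.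
      have := eq_zero_of_analytic_bound_Icc (F := fun m s => (-1) ^ m * F m (c - s)) (h := c - x)
        hC hD ((mul_le_mul_of_nonneg_left hcx hD.le).trans_lt hDh)
        (fun m s hs => ?_) (fun m s hs => ?_) (fun m => ?_) m (c - x) ⟨by linarith, le_rfl⟩
      · simpa using this
      · have h1 : HasDerivWithinAt (fun s : ℝ => c - s) (-1) (Icc 0 (c - x)) s := by
          simpa using (hasDerivWithinAt_id s (Icc 0 (c - x))).const_sub c
        convert! ((hF m (c - s) (hmaps hs)).scomp s h1 hmaps).const_mul ((-1) ^ m) using 1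
        simp [pow_succ]
      · rw [abs_mul, abs_pow, abs_neg, abs_one, one_pow, one_mul]
        exact hb m _ (hmaps hs)
      · simp [ih m c hcm le_rfl]
  intro x hx
  refine step K 0 x hx ?_
  rw [hh, mul_one_div_cancel hK0.ne']
  exact hx.1

theorem eqOn_of_analytic_bound {F G : ℕ → ℝ → ℝ} {C D C' D' : ℝ} (hC : 0 ≤ C) (hD : 0 < D)
    (hC' : 0 ≤ C') (hD' : 0 < D')
    (hF : ∀ m, ∀ x ∈ Icc (-1 : ℝ) 0, HasDerivWithinAt (F m) (F (m + 1) x) (Icc (-1) 0) x)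
    (hG : ∀ m, ∀ x ∈ Icc (-1 : ℝ) 0, HasDerivWithinAt (G m) (G (m + 1) x) (Icc (-1) 0) x)
    (hb : ∀ m, ∀ x ∈ Icc (-1 : ℝ) 0, |F m x| ≤ C * D ^ m * m.factorial)
    (hb' : ∀ m, ∀ x ∈ Icc (-1 : ℝ) 0, |G m x| ≤ C' * D' ^ m * m.factorial)
    (h0 : ∀ m, F m 0 = G m 0) : ∀ x ∈ Icc (-1 : ℝ) 0, F 0 x = G 0 x := by
  intro x hx
  refine sub_eq_zero.1 (eq_zero_of_analytic_bound (F := fun m x => F m x - G m x)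
    (C := C + C') (D := max D D') (by positivity) (by positivity)
    (fun m x hx => (hF m x hx).sub (hG m x hx)) (fun m x hx => ?_) (fun m => by simp [h0]) x hx)
  calc |F m x - G m x| ≤ |F m x| + |G m x| := abs_sub _ _
    _ ≤ C * max D D' ^ m * m.factorial + C' * max D D' ^ m * m.factorial := by
      refine add_le_add ((hb m x hx).trans ?_) ((hb' m x hx).trans ?_)
      · gcongr; exact le_max_left _ _
      · gcongr; exact le_max_right _ _
    _ = _ := by ring

/-- Two families obeying the same recursion, with the same values for `m = 0, 1, 2`, agree. -/
theorem eq_of_recursion {a : ℝ} {f g : ℕ → ℕ → ℝ}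
    (hf : ∀ m n, f (m + 3) n + a * f (m + 1) n = f m (n + 1))
    (hg : ∀ m n, g (m + 3) n + a * g (m + 1) n = g m (n + 1))
    (h0 : ∀ n, f 0 n = g 0 n) (h1 : ∀ n, f 1 n = g 1 n) (h2 : ∀ n, f 2 n = g 2 n) (m : ℕ) :
    ∀ n, f m n = g m n := by
  induction m using Nat.strong_induction_on with
  | _ m ih =>
    match m with
    | 0 => exact h0
    | 1 => exact h1
    | 2 => exact h2
    | m + 3 =>
      intro n
      have e1 := hf m n
      have e2 := hg m n
      rw [ih m (by omega), ih (m + 1) (by omega)] at e1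
      linarith

end LinearKdV

namespace LinearKdV

open Filter Topology MeasureTheory

/-! ### Uniqueness of classical solutions -/

/-- A classical solution with homogeneous data vanishes (energy estimate). -/
theorem eq_zero_of_homogeneous {a T : ℝ} {d d₁ d₂ d₃ dₜ : ℝ → ℝ → ℝ}
    (h₁ : ∀ t ∈ Icc 0 T, ∀ x ∈ Icc (-1 : ℝ) 0,
      HasDerivWithinAt (fun x => d x t) (d₁ x t) (Icc (-1) 0) x)
    (h₂ : ∀ t ∈ Icc 0 T, ∀ x ∈ Icc (-1 : ℝ) 0,
      HasDerivWithinAt (fun x => d₁ x t) (d₂ x t) (Icc (-1) 0) x)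
    (h₃ : ∀ t ∈ Icc 0 T, ∀ x ∈ Icc (-1 : ℝ) 0,
      HasDerivWithinAt (fun x => d₂ x t) (d₃ x t) (Icc (-1) 0) x)
    (hₜ : ∀ t ∈ Icc 0 T, ∀ x ∈ Icc (-1 : ℝ) 0, HasDerivWithinAt (fun t => d x t) (dₜ x t) (Icc 0 T) t)
    (hc : ContinuousOn (fun p : ℝ × ℝ => d p.1 p.2) (Icc (-1) 0 ×ˢ Icc 0 T))
    (hc₃ : ContinuousOn (fun p : ℝ × ℝ => d₃ p.1 p.2) (Icc (-1) 0 ×ˢ Icc 0 T))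
    (hcₜ : ContinuousOn (fun p : ℝ × ℝ => dₜ p.1 p.2) (Icc (-1) 0 ×ˢ Icc 0 T))
    (heq : ∀ x ∈ Ioo (-1 : ℝ) 0, ∀ t ∈ Ioo 0 T, dₜ x t + d₃ x t + a * d₁ x t = 0)
    (hr : ∀ t ∈ Ioo 0 T, d 0 t = 0) (hr' : ∀ t ∈ Ioo 0 T, d₁ 0 t = 0)
    (hl : ∀ t ∈ Ioo 0 T, d (-1) t = 0) (hi : ∀ x ∈ Ioo (-1 : ℝ) 0, d x 0 = 0) :
    ∀ x ∈ Icc (-1 : ℝ) 0, ∀ t ∈ Icc 0 T, d x t = 0 := by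
  have hslice : ∀ {f : ℝ → ℝ → ℝ}, ContinuousOn (fun p : ℝ × ℝ => f p.1 p.2)
      (Icc (-1) 0 ×ˢ Icc 0 T) → ∀ t ∈ Icc 0 T, ContinuousOn (fun x => f x t) (Icc (-1) 0) :=
    fun hf t ht => hf.comp (f := fun x : ℝ => (x, t)) (by fun_prop) (fun x hx => ⟨hx, ht⟩)
  have hslice' : ∀ {f : ℝ → ℝ → ℝ}, ContinuousOn (fun p : ℝ × ℝ => f p.1 p.2)
      (Icc (-1) 0 ×ˢ Icc 0 T) → ∀ x ∈ Icc (-1 : ℝ) 0, ContinuousOn (fun t => f x t) (Icc 0 T) :=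
    fun hf x hx => hf.comp (f := fun t : ℝ => (x, t)) (by fun_prop) (fun t ht => ⟨hx, ht⟩)
  have hK : IsCompact (Icc (-1 : ℝ) 0 ×ˢ Icc 0 T) := isCompact_Icc.prod isCompact_Icc
  obtain ⟨M, hM⟩ := hK.exists_bound_of_continuousOn hc
  obtain ⟨N, hN⟩ := hK.exists_bound_of_continuousOn hcₜ
  simp only [Real.norm_eq_abs] at hM hN
  set E : ℝ → ℝ := fun t => ∫ x in (-1 : ℝ)..0, d x t ^ 2 with hE
  have hu : uIoc (-1 : ℝ) 0 = Ioc (-1) 0 := uIoc_of_le (by norm_num)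
  have hmeas : ∀ {f : ℝ → ℝ}, ContinuousOn f (Icc (-1) 0) →
      AEStronglyMeasurable f (volume.restrict (uIoc (-1 : ℝ) 0)) := fun hf => by
    rw [hu]
    exact (hf.mono Ioc_subset_Icc_self).aestronglyMeasurable measurableSet_Ioc
  have hEc : ContinuousOn E (Icc 0 T) := by
    intro t ht
    refine intervalIntegral.continuousWithinAt_of_dominated_interval (bound := fun _ => M ^ 2) ?_ ?_
      intervalIntegrable_const ?_
    · filter_upwards [self_mem_nhdsWithin] with s hs
      exact hmeas ((hslice hc s hs).pow 2)
    · filter_upwards [self_mem_nhdsWithin] with s hs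
      refine Eventually.of_forall fun x hx => ?_
      rw [hu] at hx
      rw [Real.norm_eq_abs, abs_pow]
      exact pow_le_pow_left₀ (abs_nonneg _) (hM (x, s) ⟨Ioc_subset_Icc_self hx, hs⟩) 2
    · refine Eventually.of_forall fun x hx => ?_
      rw [hu] at hx
      exact (hslice' hc x (Ioc_subset_Icc_self hx) t ht).pow 2
  have hEd : ∀ t ∈ Ioo 0 T, HasDerivAt E (-(d₁ (-1) t) ^ 2) t := by
    intro t ht
    have ht' := Ioo_subset_Icc_self ht
    have h0 := intervalIntegral.hasDerivAt_integral_of_dominated_loc_of_deriv_le (μ := volume)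
      (F := fun s x => d x s ^ 2) (F' := fun s x => 2 * d x s * dₜ x s) (x₀ := t) (a := -1) (b := 0)
      (bound := fun _ => 2 * M * N) (s := Ioo 0 T) (Ioo_mem_nhds ht.1 ht.2) ?_ ?_ ?_ ?_
      intervalIntegrable_const ?_
    · refine h0.2.congr_deriv ?_
      have hd1 : ContinuousOn (fun x => d₁ x t) (Icc (-1) 0) :=
        fun x hx => (h₂ t ht' x hx).continuousWithinAt
      have hd2 : ContinuousOn (fun x => d₂ x t) (Icc (-1) 0) :=
        fun x hx => (h₃ t ht' x hx).continuousWithinAt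
      have h5 : ∫ x in (-1 : ℝ)..0, 2 * d x t * dₜ x t
          = ∫ x in (-1 : ℝ)..0, -(2 * d x t * d₃ x t + a * (2 * d x t * d₁ x t)) := by
        rw [intervalIntegral.integral_of_le (by norm_num), intervalIntegral.integral_of_le
          (by norm_num), integral_Ioc_eq_integral_Ioo, integral_Ioc_eq_integral_Ioo]
        refine setIntegral_congr_fun measurableSet_Ioo fun x hx => ?_
        have := heq x hx t ht
        rw [show dₜ x t = -(d₃ x t + a * d₁ x t) by linarith]
        ring
      -- The integrand of `E'` is an exact derivative in `x`. The boundary conditions kill every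
      -- boundary term except `-(∂ₓd)²` at `x = -1`, so the energy decreases.
      have h6 := intervalIntegral.integral_eq_sub_of_hasDerivAt_of_le (a := (-1 : ℝ)) (b := 0)
        (f := fun x => -(2 * d x t * d₂ x t - d₁ x t ^ 2 + a * d x t ^ 2))
        (f' := fun x => -(2 * d x t * d₃ x t + a * (2 * d x t * d₁ x t))) (by norm_num) ?_ ?_ ?_
      · rw [h5, h6, hr t ht, hl t ht, hr' t ht]
        ring
      · have := hslice hc t ht'
        fun_prop
      · intro x hx
        have hx' := Ioo_subset_Icc_self hx
        have hn : Icc (-1 : ℝ) 0 ∈ 𝓝 x := Icc_mem_nhds hx.1 hx.2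
        have e0 := (h₁ t ht' x hx').hasDerivAt hn
        have e1 := (h₂ t ht' x hx').hasDerivAt hn
        have e2 := (h₃ t ht' x hx').hasDerivAt hn
        refine (((((e0.const_mul 2).mul e2).sub (e1.pow 2)).add
          ((e0.pow 2).const_mul a)).neg).congr_deriv ?_
        simp
      · apply ContinuousOn.intervalIntegrable_of_Icc (by norm_num)
        have := hslice hc t ht'
        have := hslice hc₃ t ht'
        fun_prop
    · filter_upwards [Ioo_mem_nhds ht.1 ht.2] with s hs
      exact hmeas ((hslice hc s (Ioo_subset_Icc_self hs)).pow 2)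
    · exact ContinuousOn.intervalIntegrable_of_Icc (by norm_num) ((hslice hc t ht').pow 2)
    · have := hslice hc t ht'
      have := hslice hcₜ t ht'
      exact hmeas (by fun_prop)
    · refine Eventually.of_forall fun x hx s hs => ?_
      rw [hu] at hx
      have hm : ((x, s) : ℝ × ℝ) ∈ Icc (-1 : ℝ) 0 ×ˢ Icc 0 T :=
        ⟨Ioc_subset_Icc_self hx, Ioo_subset_Icc_self hs⟩
      rw [Real.norm_eq_abs, abs_mul, abs_mul, abs_two]
      have h7 := hM _ hm
      have h8 := hN _ hm
      have := (abs_nonneg _).trans h7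
      gcongr
    · refine Eventually.of_forall fun x hx s hs => ?_
      rw [hu] at hx
      have := (hₜ s (Ioo_subset_Icc_self hs) x (Ioc_subset_Icc_self hx)).hasDerivAt
        (Icc_mem_nhds hs.1 hs.2)
      refine (this.pow 2).congr_deriv ?_
      simp
  have hanti : AntitoneOn E (Icc 0 T) := by
    refine antitoneOn_of_deriv_nonpos (convex_Icc _ _) hEc ?_ ?_
    · rw [interior_Icc]
      exact fun t ht => (hEd t ht).differentiableAt.differentiableWithinAt
    · rw [interior_Icc]
      intro t ht
      rw [(hEd t ht).deriv]
      nlinarith [sq_nonneg (d₁ (-1) t)]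
  have hE0 : E 0 = 0 := by
    rw [hE]
    simp only
    rw [intervalIntegral.integral_of_le (by norm_num), integral_Ioc_eq_integral_Ioo]
    refine (setIntegral_congr_fun measurableSet_Ioo (g := fun _ => 0) fun x hx => ?_).trans (by simp)
    simp [hi x hx]
  intro x hx t ht
  by_contra hne
  have hpos : 0 < E t := by
    refine intervalIntegral.integral_pos (by norm_num) ((hslice hc t ht).pow 2)
      (fun _ _ => sq_nonneg _) ⟨x, hx, by positivity⟩
  have := hanti ⟨le_rfl, ht.1.trans ht.2⟩ ht ht.1
  linarith

namespace IsSolution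

variable {a T : ℝ} {u y₀ : ℝ → ℝ} {y : ℝ → ℝ → ℝ}

theorem hasDerivWithinAt_x (hy : IsSolution a T u y₀ y) {m : ℕ} (hm : m < 3) {t : ℝ}
    (ht : t ∈ Icc 0 T) {x : ℝ} (hx : x ∈ Icc (-1 : ℝ) 0) :
    HasDerivWithinAt (fun x => partialDeriv (Icc (-1) 0) (Icc 0 T) m 0 y x t)
      (partialDeriv (Icc (-1) 0) (Icc 0 T) (m + 1) 0 y x t) (Icc (-1) 0) x := by
  simp only [partialDeriv, iteratedDerivWithin_zero]
  rw [iteratedDerivWithin_succ]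
  exact ((hy.contDiff_x t ht).differentiableOn_iteratedDerivWithin (by exact_mod_cast hm)
    (uniqueDiffOn_Icc (by norm_num)) x hx).hasDerivWithinAt

theorem hasDerivWithinAt_t (hy : IsSolution a T u y₀ y) {t : ℝ}
    (ht : t ∈ Icc 0 T) {x : ℝ} (hx : x ∈ Icc (-1 : ℝ) 0) :
    HasDerivWithinAt (fun t => y x t) (partialDeriv (Icc (-1) 0) (Icc 0 T) 0 1 y x t) (Icc 0 T) t := by
  simp only [partialDeriv, iteratedDerivWithin_zero, iteratedDerivWithin_one]
  exact ((hy.contDiff_t x hx).differentiableOn (by norm_num) t ht).hasDerivWithinAt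

theorem unique {v : ℝ → ℝ → ℝ} (hv : IsSolution a T u y₀ v) (hy : IsSolution a T u y₀ y) :
    ∀ x ∈ Icc (-1 : ℝ) 0, ∀ t ∈ Icc 0 T, v x t = y x t := by
  intro x hx t ht
  set Q : ℕ → ℕ → (ℝ → ℝ → ℝ) → ℝ → ℝ → ℝ := partialDeriv (Icc (-1) 0) (Icc 0 T) with hQ
  have hQ0 : ∀ f x t, Q 0 0 f x t = f x t := fun f x t => by simp [hQ, partialDeriv]
  refine sub_eq_zero.1 (eq_zero_of_homogeneous (a := a) (d := fun x t => v x t - y x t)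
    (d₁ := fun x t => Q 1 0 v x t - Q 1 0 y x t) (d₂ := fun x t => Q 2 0 v x t - Q 2 0 y x t)
    (d₃ := fun x t => Q 3 0 v x t - Q 3 0 y x t) (dₜ := fun x t => Q 0 1 v x t - Q 0 1 y x t)
    (fun t ht x hx => ?_) (fun t ht x hx => ?_) (fun t ht x hx => ?_) (fun t ht x hx => ?_) ?_ ?_ ?_
    (fun x hx t ht => ?_) (fun t ht => ?_) (fun t ht => ?_) (fun t ht => ?_) (fun x hx => ?_)
    x hx t ht)
  · have := (hv.hasDerivWithinAt_x (m := 0) (by norm_num) ht hx).sub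
      (hy.hasDerivWithinAt_x (m := 0) (by norm_num) ht hx)
    simpa only [← hQ, hQ0] using! this
  · exact (hv.hasDerivWithinAt_x (m := 1) (by norm_num) ht hx).sub
      (hy.hasDerivWithinAt_x (m := 1) (by norm_num) ht hx)
  · exact (hv.hasDerivWithinAt_x (m := 2) (by norm_num) ht hx).sub
      (hy.hasDerivWithinAt_x (m := 2) (by norm_num) ht hx)
  · exact (hv.hasDerivWithinAt_t ht hx).sub (hy.hasDerivWithinAt_t ht hx)
  · have := (hv.continuous_x 0 (by norm_num)).sub (hy.continuous_x 0 (by norm_num))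
    simpa only [← hQ, hQ0] using! this
  · exact (hv.continuous_x 3 le_rfl).sub (hy.continuous_x 3 le_rfl)
  · exact hv.continuous_t.sub hy.continuous_t
  · have h1 := hv.equation x hx t ht
    have h2 := hy.equation x hx t ht
    rw [← hQ] at h1 h2
    linarith
  · simp only [hv.boundary_right t ht, hy.boundary_right t ht, sub_zero]
  · simp only [hQ, hv.boundary_right_deriv t ht, hy.boundary_right_deriv t ht, sub_zero]
  · simp only [hv.boundary_left t ht, hy.boundary_left t ht, sub_self]
  · simp only [hv.initial x hx, hy.initial x hx, sub_self]

end IsSolution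

end LinearKdV

namespace LinearKdV

open Filter Topology

/-! ### Exponential generating series -/

section ExpSeries

variable {E : Type*} [NormedAddCommGroup E] [NormedSpace ℝ E]

/-- The exponential generating function `∑ₖ cₖ xᵏ / k!`. -/
noncomputable def expSeries (c : ℕ → E) (x : ℝ) : E := ∑' k : ℕ, (x ^ k / k.factorial) • c k

theorem expSeries_zero (c : ℕ → E) : expSeries c 0 = c 0 := by
  unfold expSeries
  rw [tsum_eq_single 0 (fun k hk => by simp [hk])]
  simp

theorem norm_expSeries_term_le (c : ℕ → E) {x r : ℝ} (hx : |x| ≤ r) (k : ℕ) :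
    ‖(x ^ k / k.factorial) • c k‖ ≤ r ^ k / k.factorial * ‖c k‖ := by
  rw [norm_smul, Real.norm_eq_abs, abs_div, abs_pow, Nat.abs_cast]
  gcongr

theorem norm_expSeries_le {c : ℕ → E} {r : ℝ}
    (hc : Summable fun k : ℕ => r ^ k / k.factorial * ‖c k‖) {x : ℝ} (hx : |x| ≤ r) :
    ‖expSeries c x‖ ≤ ∑' k : ℕ, r ^ k / k.factorial * ‖c k‖ :=
  tsum_of_norm_bounded hc.hasSum (norm_expSeries_term_le c hx)

variable [CompleteSpace E]

theorem summable_expSeries {c : ℕ → E} {r : ℝ}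
    (hc : Summable fun k : ℕ => r ^ k / k.factorial * ‖c k‖) {x : ℝ} (hx : |x| ≤ r) :
    Summable fun k : ℕ => (x ^ k / k.factorial) • c k :=
  Summable.of_norm_bounded hc (norm_expSeries_term_le c hx)

theorem hasDerivAt_expSeries {c : ℕ → E} {r : ℝ}
    (hc : Summable fun k : ℕ => r ^ k / k.factorial * ‖c k‖)
    (hc' : Summable fun k : ℕ => r ^ k / k.factorial * ‖c (k + 1)‖) {x : ℝ} (hx : |x| < r) :
    HasDerivAt (expSeries c) (expSeries (fun k => c (k + 1)) x) x := by
  have hr : 0 ≤ r := (abs_nonneg x).trans hx.le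
  have hd : ∀ k : ℕ, ∀ y : ℝ, HasDerivAt (fun y : ℝ => (y ^ (k + 1) / (k + 1).factorial) • c (k + 1))
      ((y ^ k / k.factorial) • c (k + 1)) y := fun k y => by
    have := ((hasDerivAt_pow (k + 1) y).div_const ((k + 1).factorial : ℝ)).smul_const (c (k + 1))
    refine this.congr_deriv ?_
    congr 1
    rw [Nat.factorial_succ]
    push_cast
    field_simp
  have hmem : ∀ y ∈ Metric.ball (0 : ℝ) r, |y| ≤ r := fun y hy => by
    rw [mem_ball_zero_iff] at hy; exact hy.le
  have h0 : Summable fun k : ℕ => ((0 : ℝ) ^ (k + 1) / (k + 1).factorial) • c (k + 1) := by simp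
  have key := hasDerivAt_tsum_of_isPreconnected (y₀ := (0 : ℝ)) (y := x) hc' 
    (Metric.isOpen_ball (x := (0 : ℝ)) (ε := r)) (convex_ball _ _).isPreconnected (fun k y _ => hd k y)
    (fun k y hy => norm_expSeries_term_le (fun k => c (k + 1)) (hmem y hy) k)
    (by simpa using lt_of_le_of_lt (abs_nonneg x) hx) h0 (by simpa using hx)
  have heq : expSeries c =ᶠ[𝓝 x]
      fun y => c 0 + ∑' k : ℕ, (y ^ (k + 1) / (k + 1).factorial) • c (k + 1) := by
    filter_upwards [Metric.isOpen_ball.mem_nhds (show x ∈ Metric.ball (0 : ℝ) r by simpa using hx)]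
      with y hy
    unfold expSeries
    rw [(summable_expSeries hc (hmem y hy)).tsum_eq_zero_add]
    simp
  exact (key.const_add (c 0)).congr_of_eventuallyEq heq

end ExpSeries

/-! ### Taylor coefficients in `x` of flows -/

section Coeff

variable {E : Type*} [NormedAddCommGroup E] [NormedSpace ℝ E]

/-- The values at `x = 0` of `∂ₓ^m ∂ₜ^n y`, where `∂ₜy = P y`, `y = ∂ₓy = 0` at `x = 0` and
`∂ₓ²∂ₜ^n y = wₙ` at `x = 0`. -/
def taylorCoeff (a : ℝ) (w : ℕ → E) : ℕ → ℕ → E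
  | 0, _ => 0
  | 1, _ => 0
  | 2, n => w n
  | m + 3, n => taylorCoeff a w m (n + 1) - a • taylorCoeff a w (m + 1) n

theorem taylorCoeff_add_three (a : ℝ) (w : ℕ → E) (m n : ℕ) : taylorCoeff a w (m + 3) n
    = taylorCoeff a w m (n + 1) - a • taylorCoeff a w (m + 1) n := rfl

/-- One step of the recursion trades three `x`-derivatives for one `t`-derivative, or two
`x`-derivatives for a factor `a`. Hence at most `m / 3` time derivatives are used, and the factors
are absorbed by `1 + a (1 + a) ≤ (1 + a)^3`. -/
theorem norm_taylorCoeff_le {a : ℝ} (ha : 0 ≤ a) {w : ℕ → E} {W : ℕ → ℝ} (hW : Monotone W)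
    (hw : ∀ n, ‖w n‖ ≤ W n) (m : ℕ) :
    ∀ n, ‖taylorCoeff a w m n‖ ≤ (1 + a) ^ m * W (n + m / 3) := by
  have hW0 : ∀ n, 0 ≤ W n := fun n => (norm_nonneg _).trans (hw n)
  induction m using Nat.strong_induction_on with
  | _ m ih =>
    intro n
    match m with
    | 0 => simpa [taylorCoeff] using hW0 n
    | 1 => simpa [taylorCoeff] using mul_nonneg (by linarith) (hW0 n)
    | 2 =>
      have := hW0 n
      simp only [taylorCoeff, Nat.reduceDiv, add_zero]
      exact (hw n).trans (le_mul_of_one_le_left this (one_le_pow₀ (by linarith)))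
    | m + 3 =>
      have h1 := ih m (by omega) (n + 1)
      have h2 := ih (m + 1) (by omega) n
      have e1 : n + 1 + m / 3 = n + (m + 3) / 3 := by omega
      have e2 : W (n + (m + 1) / 3) ≤ W (n + (m + 3) / 3) := hW (by omega)
      rw [e1] at h1
      have hp : 0 ≤ (1 + a) ^ m * W (n + (m + 3) / 3) := by have := hW0 (n + (m + 3) / 3); positivity
      calc ‖taylorCoeff a w (m + 3) n‖
          ≤ ‖taylorCoeff a w m (n + 1)‖ + ‖a • taylorCoeff a w (m + 1) n‖ := norm_sub_le _ _
        _ ≤ (1 + a) ^ m * W (n + (m + 3) / 3)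
            + a * ((1 + a) ^ (m + 1) * W (n + (m + 3) / 3)) := by
          rw [norm_smul, Real.norm_eq_abs, abs_of_nonneg ha]
          gcongr
          exact h2.trans (by gcongr)
        _ = (1 + a * (1 + a)) * ((1 + a) ^ m * W (n + (m + 3) / 3)) := by ring
        _ ≤ (1 + a) ^ 3 * ((1 + a) ^ m * W (n + (m + 3) / 3)) := by
          gcongr; nlinarith [sq_nonneg a, mul_nonneg ha (sq_nonneg a)]
        _ = _ := by ring

theorem taylorCoeff_eq_zero {a : ℝ} {w : ℕ → E} (hw : ∀ n, w n = 0) (m : ℕ) :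
    ∀ n, taylorCoeff a w m n = 0 := by
  induction m using Nat.strong_induction_on with
  | _ m ih =>
    intro n
    match m with
    | 0 => rfl
    | 1 => rfl
    | 2 => exact hw n
    | m + 3 => simp [taylorCoeff, ih m (by omega), ih (m + 1) (by omega)]

theorem hasDerivAt_taylorCoeff {a : ℝ} {w : ℕ → ℝ → ℝ}
    (hw : ∀ n t, HasDerivAt (w n) (w (n + 1) t) t) (m : ℕ) :
    ∀ n t, HasDerivAt (fun t => taylorCoeff a (fun n => w n t) m n)
      (taylorCoeff a (fun n => w n t) m (n + 1)) t := by
  induction m using Nat.strong_induction_on with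
  | _ m ih =>
    intro n t
    match m with
    | 0 => simpa [taylorCoeff] using hasDerivAt_const t (0 : ℝ)
    | 1 => simpa [taylorCoeff] using hasDerivAt_const t (0 : ℝ)
    | 2 => exact hw n t
    | m + 3 => exact (ih m (by omega) (n + 1) t).sub ((ih (m + 1) (by omega) n t).const_smul a)

end Coeff

/-! ### The flow with prescribed Gevrey second derivative at `x = 0` -/

/-- Grouping the terms in threes compares the series with three copies of the exponential series of
`D^3`. -/
theorem summable_pow_div_factorial_div_three (D : ℝ) (hD : 1 ≤ D) :
    Summable fun k : ℕ => D ^ k / (k / 3).factorial := by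
  have hD0 : 0 < D := by linarith
  have h1 : Summable fun q : ℕ => D ^ 2 * ((D ^ 3) ^ q / q.factorial) :=
    (Real.summable_pow_div_factorial (D ^ 3)).mul_left _
  have h2 : ∀ k : ℕ, D ^ k / (k / 3).factorial ≤ D ^ 2 * ((D ^ 3) ^ (k / 3) / (k / 3).factorial) := by
    intro k
    rw [← mul_div_assoc, ← pow_mul, ← pow_add]
    gcongr
    omega
  refine Summable.of_nonneg_of_le (fun k => by positivity) h2 ?_
  set f : ℕ → ℝ := fun q => D ^ 2 * ((D ^ 3) ^ q / q.factorial) with hf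
  have hf0 : ∀ q, 0 ≤ f q := fun q => by positivity
  have h3 : ∀ n, ∑ k ∈ Finset.range (3 * n), f (k / 3) = 3 * ∑ q ∈ Finset.range n, f q := by
    intro n
    induction n with
    | zero => simp
    | succ n ih =>
      rw [show 3 * (n + 1) = 3 * n + 1 + 1 + 1 by ring, Finset.sum_range_succ, Finset.sum_range_succ,
        Finset.sum_range_succ, ih, Finset.sum_range_succ, show 3 * n / 3 = n by omega,
        show (3 * n + 1) / 3 = n by omega, show (3 * n + 1 + 1) / 3 = n by omega]
      ring
  refine summable_of_sum_range_le (c := 3 * ∑' q, f q) (fun k => hf0 _) fun n => ?_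
  calc ∑ k ∈ Finset.range n, f (k / 3) ≤ ∑ k ∈ Finset.range (3 * n), f (k / 3) :=
        Finset.sum_le_sum_of_subset_of_nonneg (Finset.range_mono (by omega)) fun _ _ _ => hf0 _
    _ = 3 * ∑ q ∈ Finset.range n, f q := h3 n
    _ ≤ 3 * ∑' q, f q := by gcongr; exact h1.sum_le_tsum _ fun _ _ => hf0 _

/-- The flow `∑ₘ Γₘ(t) x^m / m!` with second derivative `w₀` at `x = 0`. -/
noncomputable def cauchyFlow (a : ℝ) (w : ℕ → ℝ → ℝ) (m n : ℕ) (x t : ℝ) : ℝ :=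
  expSeries (fun k => taylorCoeff a (fun n => w n t) (k + m) n) x

section CauchyFlow

variable {a K L : ℝ} {w : ℕ → ℝ → ℝ}

/-- With `j = (k + m) / 3`, the Gevrey bound contributes `j!²` while `j!³ ≤ (k + m)!`; dividing by
`k!` leaves a spare factorial `(k / 3)!` in the denominator. This is where order 2, smaller than 3,
makes the series converge for every `x`. The weight `2^k` is the radius 2, which keeps `[-1, 0]`
inside the open interval of convergence. -/
theorem taylorCoeff_term_le (ha : 0 ≤ a) (hK : 0 ≤ K) (hL : 1 ≤ L)
    (hb : ∀ n t, |w n t| ≤ K * L ^ n * (n.factorial : ℝ) ^ 2) (m n k : ℕ) (t : ℝ) :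
    2 ^ k / k.factorial * ‖taylorCoeff a (fun n => w n t) (k + m) n‖
      ≤ K * (16 * L * (1 + a)) ^ (m + n) * (m.factorial * (n.factorial : ℝ) ^ 2)
        * ((16 * L * (1 + a)) ^ k / (k / 3).factorial) := by
  have hL0 : 0 < L := by linarith
  have hW : Monotone fun n : ℕ => K * L ^ n * (n.factorial : ℝ) ^ 2 := by
    intro i j hij
    simp only
    gcongr
  have h1 := norm_taylorCoeff_le (w := fun n => w n t) ha hW (fun n => hb n t) (k + m) n
  set j := (k + m) / 3 with hj
  have h2 : ((n + j).factorial : ℝ) ≤ 2 ^ (n + j) * (n.factorial * j.factorial) :=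
    factorial_add_le n j
  have h3 : (j.factorial : ℝ) ^ 3 ≤ 2 ^ (k + m) * (k.factorial * m.factorial) := by
    refine (factorial_pow_three_le j).trans (le_trans ?_ (factorial_add_le k m))
    exact_mod_cast Nat.factorial_le (by omega)
  have h4 : (j.factorial : ℝ) ^ 2 / k.factorial
      ≤ 2 ^ (k + m) * m.factorial / (k / 3).factorial := by
    have h5 : ((k / 3).factorial : ℝ) ≤ j.factorial := by
      exact_mod_cast Nat.factorial_le (by omega)
    rw [div_le_div_iff₀ (by positivity) (by positivity)]
    calc (j.factorial : ℝ) ^ 2 * (k / 3).factorial ≤ (j.factorial : ℝ) ^ 2 * j.factorial := by gcongr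
      _ = (j.factorial : ℝ) ^ 3 := by ring
      _ ≤ _ := h3
      _ = _ := by ring
  calc 2 ^ k / k.factorial * ‖taylorCoeff a (fun n => w n t) (k + m) n‖
      ≤ 2 ^ k / k.factorial * ((1 + a) ^ (k + m) * (K * L ^ (n + j)
        * (2 ^ (n + j) * (n.factorial * j.factorial)) ^ 2)) := by
        gcongr
        exact h1.trans (by gcongr)
    _ = K * (1 + a) ^ (k + m) * (4 * L) ^ (n + j) * 2 ^ k * (n.factorial : ℝ) ^ 2
        * ((j.factorial : ℝ) ^ 2 / k.factorial) := by
        rw [mul_pow, mul_pow, ← pow_mul, mul_comm (n + j) 2, pow_mul, mul_pow]; ring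
    _ ≤ K * (1 + a) ^ (k + m) * (4 * L) ^ (n + (k + m)) * 2 ^ (k + m) * (n.factorial : ℝ) ^ 2
        * (2 ^ (k + m) * m.factorial / (k / 3).factorial) := by
        gcongr
        · linarith
        · omega
        · norm_num
        · omega
    _ = K * (16 * L * (1 + a)) ^ (k + m) * (4 * L) ^ n
        * (m.factorial * (n.factorial : ℝ) ^ 2) / (k / 3).factorial := by
        rw [pow_add (4 * L), show 16 * L * (1 + a) = (1 + a) * (4 * L) * 2 * 2 by ring,
          mul_pow _ (2 : ℝ), mul_pow _ (2 : ℝ), mul_pow (1 + a)]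
        ring
    _ ≤ K * (16 * L * (1 + a)) ^ (k + m) * (16 * L * (1 + a)) ^ n
        * (m.factorial * (n.factorial : ℝ) ^ 2) / (k / 3).factorial := by
        gcongr _ * ?_ ^ n * _ / _
        nlinarith
    _ = _ := by rw [pow_add, pow_add]; ring

theorem isFlow_cauchyFlow (ha : 0 ≤ a) (hw : ∀ n t, HasDerivAt (w n) (w (n + 1) t) t)
    (hK : 0 < K) (hL : 1 ≤ L) (hb : ∀ n t, |w n t| ≤ K * L ^ n * (n.factorial : ℝ) ^ 2)
    (S : Set ℝ) : IsFlow a S (cauchyFlow a w) := by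
  set D : ℝ := 16 * L * (1 + a) with hD
  have hD1 : 1 ≤ D := by rw [hD]; nlinarith
  have hD0 : 0 < D := by linarith
  have hs := summable_pow_div_factorial_div_three D hD1
  have hterm := fun m n k t => taylorCoeff_term_le ha hK.le hL hb m n k t
  rw [← hD] at hterm
  have hsum : ∀ m n t, Summable fun k : ℕ =>
      2 ^ k / k.factorial * ‖taylorCoeff a (fun n => w n t) (k + m) n‖ := fun m n t =>
    Summable.of_nonneg_of_le (fun k => by positivity) (fun k => hterm m n k t) (hs.mul_left _)
  have hx2 : ∀ x ∈ Icc (-1 : ℝ) 0, |x| < 2 := fun x hx => by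
    rw [abs_lt]; constructor <;> linarith [hx.1, hx.2]
  refine ⟨fun m n x hx t _ => ?_, fun m n x hx t _ => ?_, fun m n x hx t _ => ?_, fun n t _ => ?_,
    fun n t _ => ?_, ?_⟩
  · have h' : (fun k : ℕ => taylorCoeff a (fun n => w n t) (k + 1 + m) n)
        = fun k => taylorCoeff a (fun n => w n t) (k + (m + 1)) n := by
      ext k; rw [show k + 1 + m = k + (m + 1) by ring]
    have := hasDerivAt_expSeries (c := fun k => taylorCoeff a (fun n => w n t) (k + m) n)
      (hsum m n t) (by have := hsum (m + 1) n t; simp only [congrFun h']; exact this) (hx2 x hx)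
    rw [h'] at this
    exact this.hasDerivWithinAt
  · refine (hasDerivAt_tsum
      (u := fun k => K * D ^ (m + (n + 1)) * (m.factorial * ((n + 1).factorial : ℝ) ^ 2)
        * (D ^ k / (k / 3).factorial)) (hs.mul_left _)
      (g := fun k t => (x ^ k / k.factorial) • taylorCoeff a (fun n => w n t) (k + m) n)
      (g' := fun k t => (x ^ k / k.factorial) • taylorCoeff a (fun n => w n t) (k + m) (n + 1))
      (fun k t => (hasDerivAt_taylorCoeff hw (k + m) n t).fun_const_smul _)
      (fun k t => (norm_expSeries_term_le
        (fun k => taylorCoeff a (fun n => w n t) (k + m) (n + 1)) (hx2 x hx).le k).trans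
        (hterm m (n + 1) k t))
      (y₀ := t) (summable_expSeries (hsum m n t) (hx2 x hx).le) t).hasDerivWithinAt
  · have s1 := summable_expSeries (hsum (m + 3) n t) (hx2 x hx).le
    have s2 := summable_expSeries (hsum (m + 1) n t) (hx2 x hx).le
    unfold cauchyFlow expSeries
    rw [← tsum_mul_left, ← s1.tsum_add (s2.mul_left a)]
    congr 1
    ext k
    rw [← add_assoc k m 3, taylorCoeff_add_three, ← add_assoc k m 1]
    simp only [smul_eq_mul]
    ring
  · unfold cauchyFlow
    rw [expSeries_zero]
    simp [taylorCoeff]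
  · unfold cauchyFlow
    rw [expSeries_zero]
    simp [taylorCoeff]
  · have hpos : 0 < ∑' k : ℕ, D ^ k / (k / 3).factorial :=
      hs.tsum_pos (fun k => by positivity) 0 (by positivity)
    refine ⟨K * ∑' k : ℕ, D ^ k / (k / 3).factorial, D, by positivity, hD0, fun m n x hx t _ => ?_⟩
    calc |cauchyFlow a w m n x t|
        ≤ ∑' k : ℕ, 2 ^ k / k.factorial * ‖taylorCoeff a (fun n => w n t) (k + m) n‖ :=
          norm_expSeries_le (hsum m n t) (hx2 x hx).le
      _ ≤ ∑' k : ℕ, K * D ^ (m + n) * (m.factorial * (n.factorial : ℝ) ^ 2)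
          * (D ^ k / (k / 3).factorial) :=
          (hsum m n t).tsum_le_tsum (fun k => hterm m n k t) (hs.mul_left _)
      _ = K * (∑' k : ℕ, D ^ k / (k / 3).factorial) * D ^ (m + n)
          * (m.factorial * (n.factorial : ℝ) ^ 2) := by rw [tsum_mul_left]; ring
      -- The flow has order 2 in time; `n!²` is weakened to `n!³`, the order of the superposition
      -- from which it will be subtracted.
      _ ≤ _ := by
        gcongr
        · exact_mod_cast Nat.one_le_iff_ne_zero.2 (Nat.factorial_ne_zero n)
        · norm_num

theorem cauchyFlow_two_zero (n : ℕ) (t : ℝ) : cauchyFlow a w 2 n 0 t = w n t := by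
  unfold cauchyFlow
  rw [expSeries_zero]
  simp [taylorCoeff]

theorem cauchyFlow_eq_zero {t : ℝ} (hw : ∀ n, w n t = 0) (m n : ℕ) (x : ℝ) :
    cauchyFlow a w m n x t = 0 := by
  unfold cauchyFlow expSeries
  simp [taylorCoeff_eq_zero (w := fun n => w n t) hw]

end CauchyFlow

/-! ### Eigenfunctions of `P` -/

/-- The derivatives `∂ₓ^m G(x, l)` of the solution of `P G = l G`, `G = ∂ₓG = 0` and `∂ₓ²G = 1` at
`x = 0`. -/
noncomputable def eigenfun (a : ℝ) (l : ℂ) (m : ℕ) (x : ℝ) : ℂ :=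
  expSeries (fun k => taylorCoeff a (fun n => l ^ n) (k + m) 0) x

section Eigenfun

variable {a : ℝ} {l : ℂ}

/-- The trace derivatives `lⁿ` are those of `e^{lt}` at `t = 0`, for which a time derivative is
multiplication by `l`. This makes `G` an eigenfunction of `P`. -/
theorem taylorCoeff_pow_one (m : ℕ) :
    ∀ n, taylorCoeff a (fun n => l ^ n) m (n + 1) = l * taylorCoeff a (fun n => l ^ n) m n := by
  induction m using Nat.strong_induction_on with
  | _ m ih =>
    intro n
    match m with
    | 0 => simp [taylorCoeff]
    | 1 => simp [taylorCoeff]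
    | 2 => simp [taylorCoeff, pow_succ, mul_comm]
    | m + 3 =>
      simp only [taylorCoeff]
      rw [ih m (by omega), ih m (by omega), ih (m + 1) (by omega)]
      simp only [Complex.real_smul]
      ring

theorem norm_taylorCoeff_pow_le (ha : 0 ≤ a) (m : ℕ) :
    ‖taylorCoeff a (fun n => l ^ n) m 0‖ ≤ ((1 + a) * (1 + ‖l‖)) ^ m := by
  have hl : 1 ≤ 1 + ‖l‖ := by linarith [norm_nonneg l]
  have h := norm_taylorCoeff_le ha (w := fun n => l ^ n) (W := fun n => (1 + ‖l‖) ^ n)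
    (pow_right_mono₀ hl) (fun n => by
      rw [norm_pow]; exact pow_le_pow_left₀ (norm_nonneg _) (by linarith) n) m 0
  refine h.trans ?_
  rw [mul_pow]
  gcongr
  omega

theorem eigenfun_summable (ha : 0 ≤ a) (r : ℝ) (hr : 0 ≤ r) (m : ℕ) : Summable fun k : ℕ =>
    r ^ k / k.factorial * ‖taylorCoeff a (fun n => l ^ n) (k + m) 0‖ := by
  have hs := (Real.summable_pow_div_factorial (r * ((1 + a) * (1 + ‖l‖)))).mul_left
    (((1 + a) * (1 + ‖l‖)) ^ m)
  refine Summable.of_nonneg_of_le (fun k => by positivity) (fun k => ?_) hs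
  calc r ^ k / k.factorial * ‖taylorCoeff a (fun n => l ^ n) (k + m) 0‖
      ≤ r ^ k / k.factorial * ((1 + a) * (1 + ‖l‖)) ^ (k + m) := by
        gcongr; exact norm_taylorCoeff_pow_le ha (k + m)
    _ = _ := by rw [pow_add, mul_pow r]; ring

theorem hasDerivAt_eigenfun (ha : 0 ≤ a) (m : ℕ) (x : ℝ) :
    HasDerivAt (eigenfun a l m) (eigenfun a l (m + 1) x) x := by
  have h' : (fun k : ℕ => taylorCoeff a (fun n => l ^ n) (k + 1 + m) 0)
      = fun k => taylorCoeff a (fun n => l ^ n) (k + (m + 1)) 0 := by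
    ext k; rw [show k + 1 + m = k + (m + 1) by ring]
  have := hasDerivAt_expSeries (c := fun k => taylorCoeff a (fun n => l ^ n) (k + m) 0)
    (eigenfun_summable ha (|x| + 1) (by positivity) m)
    (by have := eigenfun_summable (l := l) ha (|x| + 1) (by positivity) (m + 1)
        simp only [congrFun h']; exact this) (lt_add_one |x|)
  rwa [h'] at this

theorem eigenfun_equation (ha : 0 ≤ a) (m : ℕ) (x : ℝ) :
    eigenfun a l (m + 3) x = l * eigenfun a l m x - a * eigenfun a l (m + 1) x := by
  have s := fun m => summable_expSeries (x := x)
    (eigenfun_summable (a := a) (l := l) ha |x| (abs_nonneg _) m) le_rfl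
  unfold eigenfun expSeries
  rw [← tsum_mul_left, ← tsum_mul_left, ← ((s m).mul_left l).tsum_sub ((s (m + 1)).mul_left _)]
  congr 1
  ext k
  beta_reduce
  rw [← add_assoc k m 3, taylorCoeff_add_three, taylorCoeff_pow_one, ← add_assoc k m 1]
  simp only [Complex.real_smul]
  ring

theorem eigenfun_zero_zero : eigenfun a l 0 0 = 0 := by
  unfold eigenfun
  rw [expSeries_zero]
  simp [taylorCoeff]

theorem eigenfun_one_zero : eigenfun a l 1 0 = 0 := by
  unfold eigenfun
  rw [expSeries_zero]
  simp [taylorCoeff]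

theorem eigenfun_two_zero : eigenfun a l 2 0 = 1 := by
  unfold eigenfun
  rw [expSeries_zero]
  simp [taylorCoeff]

/-- A crude estimate of the power series, for the small `l` that the estimate through cube roots of
`l` does not reach. -/
theorem norm_eigenfun_le_of_norm_le_one (ha : 0 ≤ a) (hl : ‖l‖ ≤ 1) (m : ℕ) {x : ℝ}
    (hx : |x| ≤ 1) : ‖eigenfun a l m x‖ ≤ (2 * (1 + a)) ^ m * Real.exp (2 * (1 + a)) := by
  refine (norm_expSeries_le (eigenfun_summable ha 1 zero_le_one m) hx).trans ?_
  have hs := (Real.summable_pow_div_factorial (2 * (1 + a))).mul_left ((2 * (1 + a)) ^ m)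
  rw [Real.exp_eq_exp_ℝ, NormedSpace.exp_eq_tsum_div]
  simp only
  rw [← tsum_mul_left]
  refine (eigenfun_summable ha 1 zero_le_one m).tsum_le_tsum (fun k => ?_) hs
  calc (1 : ℝ) ^ k / k.factorial * ‖taylorCoeff a (fun n => l ^ n) (k + m) 0‖
      ≤ 1 ^ k / k.factorial * (2 * (1 + a)) ^ (k + m) := by
        gcongr
        refine (norm_taylorCoeff_pow_le ha (k + m)).trans ?_
        gcongr ?_ ^ _
        nlinarith
    _ = _ := by rw [pow_add, one_pow]; ring

theorem measurable_taylorCoeff_pow (m : ℕ) :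
    ∀ n, Measurable fun l : ℂ => taylorCoeff a (fun n => l ^ n) m n := by
  induction m using Nat.strong_induction_on with
  | _ m ih =>
    intro n
    match m with
    | 0 => exact measurable_const
    | 1 => exact measurable_const
    | 2 => simp only [taylorCoeff]; fun_prop
    | m + 3 => exact (ih m (by omega) (n + 1)).sub ((ih (m + 1) (by omega) n).const_smul a)

/-- The partial sums of the series are polynomials in `l`. -/
theorem measurable_eigenfun (ha : 0 ≤ a) (m : ℕ) (x : ℝ) : Measurable fun l => eigenfun a l m x := by
  have h : ∀ l, HasSum (fun k : ℕ => (x ^ k / k.factorial)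
      • taylorCoeff a (fun n => l ^ n) (k + m) 0) (eigenfun a l m x) := fun l =>
    (summable_expSeries (eigenfun_summable ha |x| (abs_nonneg _) m) le_rfl).hasSum
  refine measurable_of_tendsto_metrizable (f := fun N l => ∑ k ∈ Finset.range N,
    (x ^ k / k.factorial) • taylorCoeff a (fun n => l ^ n) (k + m) 0) (fun N => ?_) ?_
  · exact Finset.measurable_fun_sum _ fun k _ => 
      (measurable_taylorCoeff_pow (a := a) (k + m) 0).const_smul (x ^ k / k.factorial : ℝ)
  · rw [tendsto_pi_nhds]
    exact fun l => (h l).tendsto_sum_nat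

end Eigenfun

end LinearKdV

namespace LinearKdV

open Filter Topology

/-! ### Growth of the eigenfunctions -/

theorem inner_mul_add_le {r u g : ℂ} {a b : ℝ} (ha : 0 ≤ a) (hb : (-r).re ≤ b) :
    inner ℝ u (-(r * u - a * g)) ≤ b * ‖u‖ ^ 2 + a * (‖u‖ * ‖g‖) := by
  have h1 : inner ℝ u (-(r * u - a * g)) = (-r).re * ‖u‖ ^ 2 + a * inner ℝ u g := by
    rw [Complex.inner, Complex.inner, ← Complex.normSq_eq_norm_sq, Complex.normSq_apply]
    simp
    ring
  rw [h1]
  gcongr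
  exact real_inner_le_norm u g

/-- Fourier inversion over the three cube roots: since the sums of the roots and of their squares
vanish, the combinations `∑ rᵢ^j uᵢ` with `j = 1, 2, 0` isolate `3r³g₀`, `3r³g₁` and `3g₂`. The
powers of the modulus that remain are at least `1` and are dropped. -/
theorem norm_le_of_cube_roots {r₁ r₂ r₃ g₀ g₁ g₂ : ℂ} {ϱ : ℝ} (hϱ : 1 ≤ ϱ) (h₁ : ‖r₁‖ = ϱ)
    (h₂ : ‖r₂‖ = ϱ) (h₃ : ‖r₃‖ = ϱ) (hc₂ : r₂ ^ 3 = r₁ ^ 3) (hc₃ : r₃ ^ 3 = r₁ ^ 3)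
    (hs : r₁ + r₂ + r₃ = 0) (hq : r₁ ^ 2 + r₂ ^ 2 + r₃ ^ 2 = 0) {k : ℕ} (hk : k ≤ 2) :
    3 * ‖(![g₀, g₁, g₂] : Fin 3 → ℂ) (Fin.ofNat 3 k)‖ ≤ ‖g₂ + r₁ * g₁ + r₁ ^ 2 * g₀‖
      + ‖g₂ + r₂ * g₁ + r₂ ^ 2 * g₀‖ + ‖g₂ + r₃ * g₁ + r₃ ^ 2 * g₀‖ := by
  set u₁ := g₂ + r₁ * g₁ + r₁ ^ 2 * g₀ with hu₁
  set u₂ := g₂ + r₂ * g₁ + r₂ ^ 2 * g₀ with hu₂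
  set u₃ := g₂ + r₃ * g₁ + r₃ ^ 2 * g₀ with hu₃
  have hϱ0 : 0 < ϱ := by linarith
  have hn : ∀ j : ℕ, ‖r₁ ^ j * u₁ + r₂ ^ j * u₂ + r₃ ^ j * u₃‖ ≤ ϱ ^ j * (‖u₁‖ + ‖u₂‖ + ‖u₃‖) := by
    intro j
    calc _ ≤ ‖r₁ ^ j * u₁‖ + ‖r₂ ^ j * u₂‖ + ‖r₃ ^ j * u₃‖ := norm_add₃_le
      _ = _ := by simp only [norm_mul, norm_pow, h₁, h₂, h₃]; ring
  have hS : 0 ≤ ‖u₁‖ + ‖u₂‖ + ‖u₃‖ := by positivity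
  interval_cases k
  · have e : r₁ ^ 1 * u₁ + r₂ ^ 1 * u₂ + r₃ ^ 1 * u₃ = 3 * r₁ ^ 3 * g₀ := by
      linear_combination g₂ * hs + g₁ * hq + g₀ * hc₂ + g₀ * hc₃
    have := hn 1
    rw [e, norm_mul, norm_mul, norm_pow, h₁] at this
    simp only [RCLike.norm_ofNat, pow_one] at this
    change 3 * ‖g₀‖ ≤ _
    have h4 : ϱ * (ϱ ^ 2 * (3 * ‖g₀‖)) ≤ ϱ * (‖u₁‖ + ‖u₂‖ + ‖u₃‖) := by linarith
    have h5 := le_of_mul_le_mul_left h4 hϱ0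
    refine le_trans ?_ h5
    exact le_mul_of_one_le_left (by positivity) (one_le_pow₀ hϱ)
  · have e : r₁ ^ 2 * u₁ + r₂ ^ 2 * u₂ + r₃ ^ 2 * u₃ = 3 * r₁ ^ 3 * g₁ := by
      linear_combination g₂ * hq + g₁ * hc₂ + g₁ * hc₃ + g₀ * r₂ * hc₂ + g₀ * r₃ * hc₃
        + g₀ * r₁ ^ 3 * hs
    have := hn 2
    rw [e, norm_mul, norm_mul, norm_pow, h₁] at this
    simp only [RCLike.norm_ofNat] at this
    change 3 * ‖g₁‖ ≤ _
    have h4 : ϱ ^ 2 * (ϱ * (3 * ‖g₁‖)) ≤ ϱ ^ 2 * (‖u₁‖ + ‖u₂‖ + ‖u₃‖) := by linarith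
    have h5 := le_of_mul_le_mul_left h4 (by positivity)
    refine le_trans ?_ h5
    exact le_mul_of_one_le_left (by positivity) hϱ
  · have e : r₁ ^ 0 * u₁ + r₂ ^ 0 * u₂ + r₃ ^ 0 * u₃ = 3 * g₂ := by
      linear_combination g₁ * hs + g₀ * hq
    have := hn 0
    rw [e, norm_mul] at this
    simpa using this

theorem exists_cube_roots (l : ℂ) : ∃ r₁ r₂ r₃ : ℂ, r₁ ^ 3 = l ∧ r₂ ^ 3 = l ∧ r₃ ^ 3 = l ∧
    ‖r₂‖ = ‖r₁‖ ∧ ‖r₃‖ = ‖r₁‖ ∧ r₁ + r₂ + r₃ = 0 ∧ r₁ ^ 2 + r₂ ^ 2 + r₃ ^ 2 = 0 := by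
  obtain ⟨r, hr⟩ := IsAlgClosed.exists_pow_nat_eq l (n := 3) (by norm_num)
  have hp : IsPrimitiveRoot (Complex.exp (2 * Real.pi * Complex.I / (3 : ℕ))) 3 :=
    Complex.isPrimitiveRoot_exp 3 (by norm_num)
  set ζ := Complex.exp (2 * Real.pi * Complex.I / (3 : ℕ))
  have h3 : ζ ^ 3 = 1 := hp.pow_eq_one
  have hsum : 1 + ζ + ζ ^ 2 = 0 := by
    have := hp.geom_sum_eq_zero (by norm_num)
    simpa [Finset.sum_range_succ] using this
  have hn : ‖ζ‖ = 1 := hp.norm'_eq_one (by norm_num)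
  refine ⟨r, ζ * r, ζ ^ 2 * r, hr, ?_, ?_, ?_, ?_, ?_, ?_⟩
  · rw [mul_pow, h3, one_mul, hr]
  · rw [mul_pow, ← pow_mul, mul_comm 2 3, pow_mul, h3, one_pow, one_mul, hr]
  · rw [norm_mul, hn, one_mul]
  · rw [norm_mul, norm_pow, hn, one_pow, one_mul]
  · linear_combination r * hsum
  · linear_combination r ^ 2 * hsum + r ^ 2 * ζ * h3

/-- For a root `r³ = l`, the combination `u = G'' + rG' + r²G` satisfies `u' = ru - aG'`. Going left
from `0` it grows at the rate `Re(-r)`, and `-r` is a cube root of `-l`. The term `aG'` is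
controlled by the three combinations themselves, so Gronwall's argument loses only the additive rate
`a`. -/
theorem norm_eigenfun_le_of_cube_roots {a b : ℝ} (ha : 0 ≤ a) (hb0 : 0 ≤ b) {l : ℂ} (hl : 1 ≤ ‖l‖)
    (hb : ∀ w : ℂ, w ^ 3 = -l → w.re ≤ b) {k : ℕ} (hk : k ≤ 2) {x : ℝ} (hx : x ∈ Icc (-1 : ℝ) 0) :
    ‖eigenfun a l k x‖ ≤ Real.exp (a + b) := by
  obtain ⟨r₁, r₂, r₃, hc₁, hc₂, hc₃, hn₂, hn₃, hs, hq⟩ := exists_cube_roots l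
  have hϱ : 1 ≤ ‖r₁‖ := by
    rw [← hc₁, norm_pow] at hl
    by_contra h
    push Not at h
    exact absurd hl (not_le.2 (pow_lt_one₀ (norm_nonneg _) h (by norm_num)))
  set g : ℕ → ℝ → ℂ := fun k s => eigenfun a l k (-s) with hg
  set u : ℂ → ℝ → ℂ := fun r s => g 2 s + r * g 1 s + r ^ 2 * g 0 s with hu
  have hgd : ∀ k s, HasDerivAt (g k) (-g (k + 1) s) s := fun k s => by
    have := (hasDerivAt_eigenfun (l := l) ha k (-s)).scomp s (hasDerivAt_neg s)
    simpa [hg, Function.comp_def] using! this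
  have hud : ∀ r, r ^ 3 = l → ∀ s, HasDerivAt (u r) (-(r * u r s - a * g 1 s)) s := fun r hr s => by
    refine (((hgd 2 s).add ((hgd 1 s).const_mul r)).add ((hgd 0 s).const_mul (r ^ 2))).congr_deriv ?_
    have h3 := eigenfun_equation (l := l) ha 0 (-s)
    simp only [hu, hg, zero_add] at h3 ⊢
    rw [show 2 + 1 = 3 from rfl, show 1 + 1 = 2 from rfl, h3]
    linear_combination eigenfun a l 0 (-s) * hr
  have hre : ∀ r, r ^ 3 = l → (-r).re ≤ b := fun r hr => hb (-r) (by rw [Odd.neg_pow (by decide), hr])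
  have hG1 : ∀ k ≤ 2, ∀ s, 3 * ‖g k s‖ ≤ ‖u r₁ s‖ + ‖u r₂ s‖ + ‖u r₃ s‖ := fun k hk s => by
    have := norm_le_of_cube_roots (g₀ := g 0 s) (g₁ := g 1 s) (g₂ := g 2 s) hϱ rfl hn₂ hn₃
      (hc₂.trans hc₁.symm) (hc₃.trans hc₁.symm) hs hq hk
    refine le_trans (le_of_eq ?_) this
    interval_cases k <;> rfl
  -- In the variable `s = -x`, the estimate `3‖g₁‖ ≤ ∑‖uᵢ‖` and the Cauchy–Schwarz inequality give
  -- `N' ≤ 2(a + b)N`, with `N = 3` at `s = 0`.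
  set N : ℝ → ℝ := fun s => ‖u r₁ s‖ ^ 2 + ‖u r₂ s‖ ^ 2 + ‖u r₃ s‖ ^ 2 with hN
  have hNd : ∀ s, HasDerivAt N (2 * inner ℝ (u r₁ s) (-(r₁ * u r₁ s - a * g 1 s))
      + 2 * inner ℝ (u r₂ s) (-(r₂ * u r₂ s - a * g 1 s))
      + 2 * inner ℝ (u r₃ s) (-(r₃ * u r₃ s - a * g 1 s))) s := fun s =>
    ((hud r₁ hc₁ s).norm_sq.add (hud r₂ hc₂ s).norm_sq).add (hud r₃ hc₃ s).norm_sq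
  have hNle : ∀ s, 2 * inner ℝ (u r₁ s) (-(r₁ * u r₁ s - a * g 1 s))
      + 2 * inner ℝ (u r₂ s) (-(r₂ * u r₂ s - a * g 1 s))
      + 2 * inner ℝ (u r₃ s) (-(r₃ * u r₃ s - a * g 1 s)) ≤ 2 * (a + b) * N s := fun s => by
    have e1 := inner_mul_add_le (u := u r₁ s) (g := g 1 s) ha (hre r₁ hc₁)
    have e2 := inner_mul_add_le (u := u r₂ s) (g := g 1 s) ha (hre r₂ hc₂)
    have e3 := inner_mul_add_le (u := u r₃ s) (g := g 1 s) ha (hre r₃ hc₃)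
    have e4 := hG1 1 (by norm_num) s
    have e5 : (‖u r₁ s‖ + ‖u r₂ s‖ + ‖u r₃ s‖) * ‖g 1 s‖ ≤ N s := by
      have hS : 0 ≤ ‖u r₁ s‖ + ‖u r₂ s‖ + ‖u r₃ s‖ := by positivity
      have := mul_le_mul_of_nonneg_left e4 hS
      simp only [hN]
      nlinarith [sq_nonneg (‖u r₁ s‖ - ‖u r₂ s‖), sq_nonneg (‖u r₁ s‖ - ‖u r₃ s‖),
        sq_nonneg (‖u r₂ s‖ - ‖u r₃ s‖)]
    have e6 := mul_le_mul_of_nonneg_left e5 ha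
    simp only [hN] at e6 ⊢
    nlinarith
  have hanti : Antitone fun s => N s * Real.exp (-(2 * (a + b)) * s) := by
    have hd : ∀ s, HasDerivAt (fun s => N s * Real.exp (-(2 * (a + b)) * s)) _ s := fun s =>
      (hNd s).mul (((hasDerivAt_id s).const_mul (-(2 * (a + b)))).exp)
    refine antitone_of_deriv_nonpos (fun s => (hd s).differentiableAt) fun s => ?_
    rw [(hd s).deriv]
    have := mul_le_mul_of_nonneg_right (hNle s) (Real.exp_pos (-(2 * (a + b)) * s)).le
    simp only [id]
    linarith
  have hu0 : ∀ r, u r 0 = 1 := fun r => by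
    simp [hu, hg, eigenfun_two_zero, eigenfun_one_zero, eigenfun_zero_zero]
  have hs0 : 0 ≤ -x := by linarith [hx.2]
  have hs1 : -x ≤ 1 := by linarith [hx.1]
  have h1 : N (-x) ≤ 3 * Real.exp (a + b) ^ 2 := by
    have h2 := hanti hs0
    simp only [mul_zero, Real.exp_zero, mul_one] at h2
    have h3 : N 0 = 3 := by simp only [hN, hu0]; norm_num
    rw [h3, neg_mul, Real.exp_neg, ← div_eq_mul_inv, div_le_iff₀ (Real.exp_pos _)] at h2
    refine h2.trans ?_
    rw [← Real.exp_nat_mul]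
    refine mul_le_mul_of_nonneg_left (Real.exp_le_exp.2 ?_) (by norm_num)
    push_cast
    nlinarith
  have h2 := hG1 k hk (-x)
  have h3 : (‖u r₁ (-x)‖ + ‖u r₂ (-x)‖ + ‖u r₃ (-x)‖) ^ 2 ≤ (3 * Real.exp (a + b)) ^ 2 := by
    simp only [hN] at h1
    nlinarith [sq_nonneg (‖u r₁ (-x)‖ - ‖u r₂ (-x)‖), sq_nonneg (‖u r₁ (-x)‖ - ‖u r₃ (-x)‖),
        sq_nonneg (‖u r₂ (-x)‖ - ‖u r₃ (-x)‖)]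
  have h4 := (abs_le_of_sq_le_sq' h3 (by positivity)).2
  simp only [hg, neg_neg] at h2
  linarith

/-- The equation `G''' = lG - aG'` propagates the bound to higher derivatives as soon as `q³`
dominates `‖l‖ + aq`. -/
theorem norm_eigenfun_le_pow {a q Q x : ℝ} (ha : 0 ≤ a) {l : ℂ} (hq : 1 ≤ q)
    (hq3 : ‖l‖ + a * q ≤ q ^ 3) (hQ : ∀ k ≤ 2, ‖eigenfun a l k x‖ ≤ Q) (m : ℕ) :
    ‖eigenfun a l m x‖ ≤ q ^ m * Q := by
  have hQ0 : 0 ≤ Q := (norm_nonneg _).trans (hQ 0 (by norm_num))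
  have hq0 : 0 ≤ q := by linarith
  induction m using Nat.strong_induction_on with
  | _ m ih =>
    by_cases hm : m ≤ 2
    · exact (hQ m hm).trans (le_mul_of_one_le_left hQ0 (one_le_pow₀ hq))
    obtain ⟨m, rfl⟩ : ∃ j, m = j + 3 := ⟨m - 3, by omega⟩
    rw [eigenfun_equation ha]
    calc ‖l * eigenfun a l m x - a * eigenfun a l (m + 1) x‖
        ≤ ‖l‖ * ‖eigenfun a l m x‖ + a * ‖eigenfun a l (m + 1) x‖ := by
          refine (norm_sub_le _ _).trans (le_of_eq ?_)
          rw [norm_mul, norm_mul, Complex.norm_real, Real.norm_eq_abs, abs_of_nonneg ha]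
      _ ≤ ‖l‖ * (q ^ m * Q) + a * (q ^ (m + 1) * Q) := by
          gcongr
          · exact ih m (by omega)
          · exact ih (m + 1) (by omega)
      _ = (‖l‖ + a * q) * (q ^ m * Q) := by ring
      _ ≤ q ^ 3 * (q ^ m * Q) := by gcongr
      _ = _ := by ring

theorem norm_eigenfun_le {a b s x : ℝ} (ha : 0 ≤ a) (hb0 : 0 ≤ b) (hs : 0 ≤ s) {l : ℂ}
    (hl : ‖l‖ ≤ 1000 * s ^ 3) (hb : ∀ w : ℂ, w ^ 3 = -l → w.re ≤ b) (hx : x ∈ Icc (-1 : ℝ) 0)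
    (m : ℕ) : ‖eigenfun a l m x‖ ≤
      ((10 + 2 * (1 + a)) * (1 + s)) ^ m * (Real.exp (2 * (1 + a)) * Real.exp b) := by
  have hs1 : 1 ≤ 1 + s := by linarith
  have hx1 : |x| ≤ 1 := by rw [abs_le]; constructor <;> linarith [hx.1, hx.2]
  rcases le_total ‖l‖ 1 with h | h
  · refine (norm_eigenfun_le_of_norm_le_one ha h m hx1).trans ?_
    have h1 : 2 * (1 + a) ≤ (10 + 2 * (1 + a)) * (1 + s) := by nlinarith
    gcongr
    exact le_mul_of_one_le_right (Real.exp_pos _).le (Real.one_le_exp hb0)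
  -- `10 s` is the cube root of the bound `1000 s³` for `‖l‖`; the additional `2 (1 + a)` absorbs `a
  -- q`.
  · set q := (10 + 2 * (1 + a)) * (1 + s) with hq
    have hq1 : 10 * s + 2 * (1 + a) ≤ q := by rw [hq]; nlinarith
    have hq2 : 100 * s ^ 2 + a ≤ q ^ 2 := by
      have := pow_le_pow_left₀ (by positivity) hq1 2
      nlinarith [mul_nonneg hs ha, sq_nonneg a]
    have hq3 : 10 * s ≤ q := by linarith
    have hq0 : 0 ≤ q := by positivity
    refine norm_eigenfun_le_pow ha (by linarith) ?_ (fun k hk => ?_) m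
    · have : 100 * s ^ 2 * (10 * s) ≤ (q ^ 2 - a) * q :=
        mul_le_mul (by linarith) hq3 (by positivity) (by nlinarith [sq_nonneg s])
      nlinarith
    · refine (norm_eigenfun_le_of_cube_roots ha hb0 h hb hk hx).trans ?_
      rw [← Real.exp_add]
      gcongr
      linarith

end LinearKdV

namespace LinearKdV

open Filter Topology

/-! ### Gevrey functions of order 2 -/

/-- A sequence of functions, each the derivative of the preceding one, with Gevrey bounds of
order `2` on the whole line. -/
structure IsGevreyTwo (f : ℕ → ℝ → ℝ) : Prop where
  hasDerivAt : ∀ n t, HasDerivAt (f n) (f (n + 1) t) t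
  bound : ∃ K L : ℝ, 0 < K ∧ 1 ≤ L ∧ ∀ n t, |f n t| ≤ K * L ^ n * (n.factorial : ℝ) ^ 2

/-- The `n`-th derivative of a product by Leibniz' rule. -/
def leibniz (f g : ℕ → ℝ → ℝ) (n : ℕ) (t : ℝ) : ℝ :=
  ∑ ij ∈ Finset.HasAntidiagonal.antidiagonal n, (n.choose ij.1 : ℝ) * (f ij.1 t * g ij.2 t)

theorem hasDerivAt_leibniz {f g : ℕ → ℝ → ℝ} {t : ℝ} (hf : ∀ n, HasDerivAt (f n) (f (n + 1) t) t)
    (hg : ∀ n, HasDerivAt (g n) (g (n + 1) t) t) (n : ℕ) :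
    HasDerivAt (leibniz f g n) (leibniz f g (n + 1) t) t := by
  have h : HasDerivAt (leibniz f g n) (∑ ij ∈ Finset.HasAntidiagonal.antidiagonal n, (n.choose ij.1 : ℝ) *
      (f (ij.1 + 1) t * g ij.2 t + f ij.1 t * g (ij.2 + 1) t)) t :=
    HasDerivAt.fun_sum fun ij _ => ((hf ij.1).mul (hg ij.2)).const_mul _
  refine h.congr_deriv ?_
  unfold leibniz
  rw [Finset.sum_antidiagonal_choose_succ_mul (fun i j => f i t * g j t), ← Finset.sum_add_distrib]
  refine Finset.sum_congr rfl fun ij hij => ?_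
  rw [← Finset.HasAntidiagonal.mem_antidiagonal.1 hij, Nat.choose_symm_add]
  ring

/-- `i! j! ≤ n!` for `i + j = n` pulls the factorials out, and the binomial theorem sums the
remaining powers. -/
theorem abs_leibniz_le {f g : ℕ → ℝ → ℝ} {t K L K' L' : ℝ} (hK : 0 ≤ K) (hL : 0 ≤ L) (hL' : 0 ≤ L')
    (hf : ∀ n, |f n t| ≤ K * L ^ n * (n.factorial : ℝ) ^ 2)
    (hg : ∀ n, |g n t| ≤ K' * L' ^ n * (n.factorial : ℝ) ^ 2) (n : ℕ) :
    |leibniz f g n t| ≤ K * K' * (L + L') ^ n * (n.factorial : ℝ) ^ 2 := by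
  have hK' : 0 ≤ K' := by have := (abs_nonneg _).trans (hg 0); simpa using this
  unfold leibniz
  calc _ ≤ ∑ ij ∈ Finset.HasAntidiagonal.antidiagonal n, |(n.choose ij.1 : ℝ) * (f ij.1 t * g ij.2 t)| :=
        Finset.abs_sum_le_sum_abs _ _
    _ ≤ ∑ ij ∈ Finset.HasAntidiagonal.antidiagonal n,
          K * K' * (n.factorial : ℝ) ^ 2 * (n.choose ij.1 • (L ^ ij.1 * L' ^ ij.2)) := by
        refine Finset.sum_le_sum fun ij hij => ?_
        have hfac : (ij.1.factorial * ij.2.factorial : ℝ) ≤ n.factorial := by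
          rw [← Finset.HasAntidiagonal.mem_antidiagonal.1 hij]
          exact_mod_cast Nat.le_of_dvd (Nat.factorial_pos _)
            (Nat.factorial_mul_factorial_dvd_factorial_add _ _)
        rw [abs_mul, abs_mul, Nat.abs_cast, nsmul_eq_mul]
        calc (n.choose ij.1 : ℝ) * (|f ij.1 t| * |g ij.2 t|)
            ≤ n.choose ij.1 * ((K * L ^ ij.1 * (ij.1.factorial : ℝ) ^ 2)
              * (K' * L' ^ ij.2 * (ij.2.factorial : ℝ) ^ 2)) := by
              gcongr
              · exact hf _
              · exact hg _
          _ = n.choose ij.1 * (K * L ^ ij.1 * (K' * L' ^ ij.2))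
              * (ij.1.factorial * ij.2.factorial : ℝ) ^ 2 := by ring
          _ ≤ n.choose ij.1 * (K * L ^ ij.1 * (K' * L' ^ ij.2)) * (n.factorial : ℝ) ^ 2 := by gcongr
          _ = _ := by ring
    _ = _ := by rw [← Finset.mul_sum, (Commute.all L L').add_pow' n]; ring

namespace IsGevreyTwo

theorem leibniz {f g : ℕ → ℝ → ℝ} (hf : IsGevreyTwo f) (hg : IsGevreyTwo g) :
    IsGevreyTwo (leibniz f g) where
  hasDerivAt n t := hasDerivAt_leibniz (fun n => hf.hasDerivAt n t) (fun n => hg.hasDerivAt n t) n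
  bound := by
    obtain ⟨K, L, hK, hL, hb⟩ := hf.bound
    obtain ⟨K', L', hK', hL', hb'⟩ := hg.bound
    exact ⟨K * K', L + L', by positivity, by linarith, fun n t => abs_leibniz_le hK.le (by linarith)
      (by linarith) (fun n => hb n t) (fun n => hb' n t) n⟩

theorem comp_affine {f : ℕ → ℝ → ℝ} (hf : IsGevreyTwo f) (c d : ℝ) :
    IsGevreyTwo (fun n t => c ^ n * f n (c * t + d)) where
  hasDerivAt n t := by
    have h1 : HasDerivAt (fun t : ℝ => c * t + d) c t := by
      simpa using ((hasDerivAt_id t).const_mul c).add_const d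
    refine (((hf.hasDerivAt n (c * t + d)).comp t h1).const_mul (c ^ n)).congr_deriv ?_
    ring
  bound := by
    obtain ⟨K, L, hK, hL, hb⟩ := hf.bound
    refine ⟨K, (1 + |c|) * L, hK, by nlinarith [abs_nonneg c], fun n t => ?_⟩
    rw [abs_mul, abs_pow]
    calc |c| ^ n * |f n (c * t + d)| ≤ (1 + |c|) ^ n * (K * L ^ n * (n.factorial : ℝ) ^ 2) := by
          gcongr
          · linarith
          · exact hb n _
      _ = _ := by rw [mul_pow]; ring

end IsGevreyTwo

/-- The derivatives of `e^{-1/t}`, extended by zero to `t ≤ 0`. -/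
noncomputable def flatExp (n : ℕ) (t : ℝ) : ℝ :=
  if 0 < t then (iteratedDeriv n (fun z : ℂ => Complex.exp (-z⁻¹)) (t : ℂ)).re else 0

theorem differentiableAt_cexp_neg_inv {z : ℂ} (hz : z ≠ 0) :
    DifferentiableAt ℂ (fun z : ℂ => Complex.exp (-z⁻¹)) z :=
  (differentiableAt_inv hz).neg.cexp

/-- Cauchy's estimate on the circle of radius `t/2` about `t`, where `Re(1/z) = Re z/|z|² ≥
(t/2)/(3t/2)² = 2/(9t)`. -/
theorem abs_flatExp_le (n : ℕ) {t : ℝ} (ht : 0 < t) :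
    |flatExp n t| ≤ n.factorial * Real.exp (-(2 / (9 * t))) / (t / 2) ^ n := by
  unfold flatExp
  rw [if_pos ht]
  refine (Complex.abs_re_le_norm _).trans
    (Complex.norm_iteratedDeriv_le_of_forall_mem_sphere_norm_le n (by positivity) ?_ ?_)
  · have hne : ∀ z ∈ closure (Metric.ball (t : ℂ) (t / 2)), z ≠ 0 := by
      intro z hz h0
      have := Metric.closure_ball_subset_closedBall hz
      rw [h0, Metric.mem_closedBall, dist_comm, dist_zero_right, Complex.norm_real, Real.norm_eq_abs,
        abs_of_pos ht] at this
      linarith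
    exact DifferentiableOn.diffContOnCl fun z hz =>
      (differentiableAt_cexp_neg_inv (hne z hz)).differentiableWithinAt
  · intro z hz
    rw [mem_sphere_iff_norm] at hz
    rw [Complex.norm_exp]
    have hre : t / 2 ≤ z.re := by
      have := (Complex.abs_re_le_norm (z - t)).trans hz.le
      rw [Complex.sub_re, Complex.ofReal_re, abs_le] at this
      linarith
    have hn : ‖z‖ ≤ 3 * t / 2 := by
      calc ‖z‖ = ‖(z - t) + t‖ := by ring_nf
        _ ≤ ‖z - t‖ + ‖(t : ℂ)‖ := norm_add_le _ _
        _ = _ := by rw [hz, Complex.norm_real, Real.norm_eq_abs, abs_of_pos ht]; ring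
    have hz0 : 0 < Complex.normSq z := by
      rw [Complex.normSq_pos]
      rintro rfl
      simp at hre
      linarith
    gcongr
    rw [Complex.neg_re, Complex.inv_re, neg_le_neg_iff, div_le_div_iff₀ (by positivity) hz0,
      Complex.normSq_eq_norm_sq]
    have := pow_le_pow_left₀ (norm_nonneg _) hn 2
    nlinarith

/-- The exponential absorbs `t⁻ⁿ` at the price of a second factorial, by `yⁿ/n! ≤ e^y` with `y =
2/(9t)`. -/
theorem abs_flatExp_le_gevrey (n : ℕ) (t : ℝ) :
    |flatExp n t| ≤ 1 * 9 ^ n * (n.factorial : ℝ) ^ 2 := by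
  by_cases ht : 0 < t
  · refine (abs_flatExp_le n ht).trans ?_
    have h1 := Real.pow_div_factorial_le_exp (2 / (9 * t)) (by positivity) n
    rw [div_le_iff₀ (by positivity)] at h1
    rw [Real.exp_neg, div_le_iff₀ (by positivity), ← div_eq_mul_inv, div_le_iff₀ (Real.exp_pos _)]
    calc (n.factorial : ℝ) = n.factorial * (9 ^ n * (t / 2) ^ n * (2 / (9 * t)) ^ n) := by
          rw [← mul_pow, ← mul_pow, show 9 * (t / 2) * (2 / (9 * t)) = 1 by field_simp, one_pow,
            mul_one]
      _ ≤ n.factorial * (9 ^ n * (t / 2) ^ n * (Real.exp (2 / (9 * t)) * n.factorial)) := by gcongr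
      _ = _ := by ring
  · unfold flatExp
    rw [if_neg ht, abs_zero]
    positivity

/-- Quadratic flatness at `0` is what gives each derivative the derivative zero there. -/
theorem exists_abs_flatExp_le_sq (n : ℕ) : ∃ c, ∀ t, |flatExp n t| ≤ c * t ^ 2 := by
  refine ⟨n.factorial * (n + 2).factorial * (9 / 2) ^ 2 * 9 ^ n, fun t => ?_⟩
  by_cases ht : 0 < t
  · refine (abs_flatExp_le n ht).trans ?_
    have h1 := Real.pow_div_factorial_le_exp (2 / (9 * t)) (by positivity) (n + 2)
    rw [div_le_iff₀ (by positivity)] at h1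
    rw [Real.exp_neg, div_le_iff₀ (by positivity), ← div_eq_mul_inv, div_le_iff₀ (Real.exp_pos _)]
    calc (n.factorial : ℝ) = n.factorial * ((9 / 2 * t) ^ 2 * (9 * (t / 2)) ^ n
          * (2 / (9 * t)) ^ (n + 2)) := by
          rw [show 9 * (t / 2) = 9 / 2 * t by ring, ← pow_add, add_comm n 2, ← mul_pow,
            show 9 / 2 * t * (2 / (9 * t)) = 1 by field_simp, one_pow, mul_one]
      _ ≤ n.factorial * ((9 / 2 * t) ^ 2 * (9 * (t / 2)) ^ n
          * (Real.exp (2 / (9 * t)) * (n + 2).factorial)) := by gcongr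
      _ = _ := by rw [mul_pow, mul_pow]; ring
  · unfold flatExp
    rw [if_neg ht, abs_zero]
    positivity

theorem flatExp_of_nonpos (n : ℕ) {t : ℝ} (ht : t ≤ 0) : flatExp n t = 0 := if_neg (not_lt.2 ht)

theorem flatExp_zero_pos {t : ℝ} (ht : 0 < t) : 0 < flatExp 0 t := by
  unfold flatExp
  rw [if_pos ht, iteratedDeriv_zero, ← Complex.ofReal_inv, ← Complex.ofReal_neg,
    Complex.exp_ofReal_re]
  exact Real.exp_pos _

theorem isGevreyTwo_flatExp : IsGevreyTwo flatExp where
  bound := ⟨1, 9, one_pos, by norm_num, abs_flatExp_le_gevrey⟩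
  hasDerivAt n t := by
    rcases lt_trichotomy t 0 with ht | rfl | ht
    · rw [flatExp_of_nonpos (n + 1) ht.le]
      refine (hasDerivAt_const t (0 : ℝ)).congr_of_eventuallyEq ?_
      filter_upwards [Iio_mem_nhds ht] with s hs
      exact flatExp_of_nonpos n (mem_Iio.1 hs).le
    · obtain ⟨c, hc⟩ := exists_abs_flatExp_le_sq n
      rw [flatExp_of_nonpos (n + 1) le_rfl, hasDerivAt_iff_isLittleO]
      simp only [flatExp_of_nonpos n le_rfl, sub_zero, smul_zero]
      refine (Asymptotics.IsBigO.of_bound c ?_).trans_isLittleO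
        (Asymptotics.isLittleO_pow_id one_lt_two)
      exact Eventually.of_forall fun s => by
        rw [Real.norm_eq_abs, Real.norm_eq_abs, abs_of_nonneg (sq_nonneg s)]
        exact hc s
    · set f : ℂ → ℂ := fun z => Complex.exp (-z⁻¹) with hf
      have ht0 : (t : ℂ) ≠ 0 := by exact_mod_cast ht.ne'
      have han : AnalyticAt ℂ f t := by
        refine DifferentiableOn.analyticAt (s := {0}ᶜ) (fun z hz =>
          (differentiableAt_cexp_neg_inv hz).differentiableWithinAt) ?_
        exact isOpen_compl_singleton.mem_nhds ht0
      have hd : HasDerivAt (iteratedDeriv n f) (iteratedDeriv (n + 1) f t) t := by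
        rw [iteratedDeriv_succ, iteratedDeriv_eq_iterate]
        exact (han.iterated_deriv n).differentiableAt.hasDerivAt
      have := hd.real_of_complex
      have h1 : flatExp (n + 1) t = (iteratedDeriv (n + 1) f t).re := by
        unfold flatExp
        rw [if_pos ht]
      rw [h1]
      refine this.congr_of_eventuallyEq ?_
      filter_upwards [Ioi_mem_nhds ht] with s hs
      unfold flatExp
      rw [if_pos (mem_Ioi.1 hs)]

/-- Gevrey cutoff functions of order `2`. -/
theorem exists_cutoff {t₁ t₂ : ℝ} (h : t₁ < t₂) : ∃ χ : ℕ → ℝ → ℝ, IsGevreyTwo χ ∧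
    (∀ n, ∀ t ≤ t₁, χ n t = 0) ∧ (∀ t, t₂ ≤ t → χ 0 t = 1) ∧ ∀ n t, t₂ ≤ t → χ (n + 1) t = 0 := by
  -- The bump `e^{-1/t} e^{-1/(1-t)}` on `(0, 1)`, with all its derivatives. The cutoff is its
  -- normalised primitive, rescaled to `[t₁, t₂]`.
  set p : ℕ → ℝ → ℝ := leibniz flatExp (fun n t => (-1) ^ n * flatExp n (-1 * t + 1)) with hp
  have hpG : IsGevreyTwo p := isGevreyTwo_flatExp.leibniz (isGevreyTwo_flatExp.comp_affine (-1) 1)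
  have hp0 : ∀ n, ∀ t ≤ 0, p n t = 0 := fun n t ht =>
    Finset.sum_eq_zero fun ij _ => by rw [flatExp_of_nonpos _ ht]; ring
  have hp1 : ∀ n t, 1 ≤ t → p n t = 0 := fun n t ht =>
    Finset.sum_eq_zero fun ij _ => by simp only [flatExp_of_nonpos _ (by linarith : -1 * t + 1 ≤ 0)]; ring
  have hppos : ∀ t ∈ Ioo (0 : ℝ) 1, 0 < p 0 t := fun t ht => by
    have h1 := flatExp_zero_pos ht.1
    have h2 := flatExp_zero_pos (by linarith [ht.2] : 0 < -1 * t + 1)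
    simp only [hp, leibniz, Finset.Nat.antidiagonal_zero, Finset.sum_singleton, Nat.choose_self]
    simp only [Nat.cast_one, one_mul, pow_zero]
    positivity
  have hpc : Continuous (p 0) := continuous_iff_continuousAt.2 fun t => (hpG.hasDerivAt 0 t).continuousAt
  set c := ∫ s in (0 : ℝ)..1, p 0 s with hc
  have hcpos : 0 < c := intervalIntegral.intervalIntegral_pos_of_pos_on
    (hpc.intervalIntegrable _ _) hppos one_pos
  obtain ⟨K, L, hK, hL, hb⟩ := hpG.bound
  set q : ℕ → ℝ → ℝ := fun n t => Nat.casesOn n ((∫ s in (0 : ℝ)..t, p 0 s) / c) fun n => p n t / c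
    with hq
  have hq0 : ∀ n, ∀ t ≤ 0, q n t = 0 := by
    intro n t ht
    cases n with
    | zero =>
      simp only [hq]
      rw [intervalIntegral.integral_congr (g := fun _ => 0) (fun s hs => ?_)]
      · simp
      · rw [uIcc_of_ge ht] at hs
        exact hp0 0 s hs.2
    | succ n => simp [hq, hp0 n t ht]
  have hq1 : ∀ t, 1 ≤ t → q 0 t = 1 := fun t ht => by
    simp only [hq]
    rw [← intervalIntegral.integral_add_adjacent_intervals (hpc.intervalIntegrable 0 1)
      (hpc.intervalIntegrable 1 t), intervalIntegral.integral_congr (a := 1) (g := fun _ => 0)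
      (fun s hs => ?_)]
    · simp [← hc, hcpos.ne']
    · rw [uIcc_of_le ht] at hs
      exact hp1 0 s hs.1
  have hqG : IsGevreyTwo q := by
    refine ⟨fun n t => ?_, 1 + K / c, L, by positivity, hL, fun n t => ?_⟩
    · cases n with
      | zero => exact (hpc.integral_hasStrictDerivAt 0 t).hasDerivAt.div_const c
      | succ n => exact (hpG.hasDerivAt n t).div_const c
    · cases n with
      | zero =>
        simp only [pow_zero, Nat.factorial_zero, Nat.cast_one, one_pow, mul_one]
        have hKc : 0 < K / c := by positivity
        rcases le_total t 0 with ht | ht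
        · rw [hq0 0 t ht, abs_zero]; linarith
        rcases le_total 1 t with ht1 | ht1
        · rw [hq1 t ht1, abs_one]; linarith
        have : |∫ s in (0 : ℝ)..t, p 0 s| ≤ K * |t - 0| := by
          refine intervalIntegral.norm_integral_le_of_norm_le_const (f := p 0) fun s _ => ?_
          simpa using hb 0 s
        rw [sub_zero, abs_of_nonneg ht] at this
        rw [show q 0 t = (∫ s in (0 : ℝ)..t, p 0 s) / c from rfl, abs_div, abs_of_pos hcpos]
        have h3 : |∫ s in (0 : ℝ)..t, p 0 s| / c ≤ K / c := by
          gcongr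
          exact this.trans (mul_le_of_le_one_right hK.le ht1)
        linarith
      | succ n =>
        rw [show q (n + 1) t = p n t / c from rfl, abs_div, abs_of_pos hcpos]
        calc |p n t| / c ≤ (K * L ^ n * (n.factorial : ℝ) ^ 2) / c := by gcongr; exact hb n t
          _ = K / c * (L ^ n * (n.factorial : ℝ) ^ 2) := by ring
          _ ≤ (1 + K / c) * (L ^ (n + 1) * ((n + 1).factorial : ℝ) ^ 2) := by
            gcongr
            · linarith
            · omega
            · omega
          _ = _ := by ring
  have hd : 0 < t₂ - t₁ := by linarith
  have e : ∀ t, (t₂ - t₁)⁻¹ * t + -(t₁ / (t₂ - t₁)) = (t - t₁) / (t₂ - t₁) := fun t => by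
    field_simp
    ring
  refine ⟨_, hqG.comp_affine (t₂ - t₁)⁻¹ (-(t₁ / (t₂ - t₁))), fun n t ht => ?_, fun t ht => ?_,
    fun n t ht => ?_⟩
  · rw [hq0, mul_zero]
    rw [e]
    exact div_nonpos_of_nonpos_of_nonneg (by linarith) hd.le
  · rw [hq1, pow_zero, one_mul]
    rw [e, le_div_iff₀ hd]
    linarith
  · simp only [hq]
    rw [hp1, zero_div, mul_zero]
    rw [e, le_div_iff₀ hd]
    linarith

/-- Cutting off a function that is analytic for `t ≥ t₁`. -/
theorem isGevreyTwo_leibniz_cutoff {χ z : ℕ → ℝ → ℝ} {t₁ K L : ℝ} (ht₁ : 0 < t₁)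
    (hχ : IsGevreyTwo χ) (hχ0 : ∀ n, ∀ t ≤ t₁, χ n t = 0) (hK : 0 ≤ K) (hL : 0 ≤ L)
    (hz : ∀ n, ∀ t > 0, HasDerivAt (z n) (z (n + 1) t) t)
    (hb : ∀ n t, t₁ ≤ t → |z n t| ≤ K * L ^ n * (n.factorial : ℝ) ^ 2) :
    IsGevreyTwo (leibniz χ z) where
  hasDerivAt n t := by
    rcases lt_or_ge 0 t with ht | ht
    · exact hasDerivAt_leibniz (fun n => hχ.hasDerivAt n t) (fun n => hz n t ht) n
    -- For `t ≤ 0 < t₁` the product vanishes in a neighbourhood of `t`, so nothing is asked of `z`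
    -- there.
    · have h0 : ∀ n, ∀ s ≤ t₁, leibniz χ z n s = 0 := fun n s hs =>
        Finset.sum_eq_zero fun ij _ => by rw [hχ0 _ s hs]; ring
      rw [h0 (n + 1) t (by linarith)]
      refine (hasDerivAt_const t (0 : ℝ)).congr_of_eventuallyEq ?_
      filter_upwards [Iio_mem_nhds (show t < t₁ by linarith)] with s hs
      exact h0 n s (mem_Iio.1 hs).le
  bound := by
    obtain ⟨K', L', hK', hL', hb'⟩ := hχ.bound
    refine ⟨K' * K + 1, L' + L, by positivity, by linarith, fun n t => ?_⟩
    have hle : K' * K * (L' + L) ^ n * (n.factorial : ℝ) ^ 2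
        ≤ (K' * K + 1) * (L' + L) ^ n * (n.factorial : ℝ) ^ 2 := by
      gcongr; linarith
    refine le_trans ?_ hle
    rcases le_total t₁ t with ht | ht
    · exact abs_leibniz_le hK'.le (by linarith) hL (fun n => hb' n t) (fun n => hb n t ht) n
    · have : leibniz χ z n t = 0 := Finset.sum_eq_zero fun ij _ => by rw [hχ0 _ t ht]; ring
      rw [this, abs_zero]
      positivity

theorem leibniz_of_eq_one {χ z : ℕ → ℝ → ℝ} {t : ℝ} (h0 : χ 0 t = 1) (h1 : ∀ n, χ (n + 1) t = 0)
    (n : ℕ) : leibniz χ z n t = z n t := by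
  unfold leibniz
  rw [Finset.sum_eq_single (0, n)]
  · simp [h0]
  · rintro ⟨i, j⟩ hij hne
    cases i with
    | zero => simp at hij; simp [hij] at hne
    | succ i => simp [h1]
  · simp

end LinearKdV

namespace LinearKdV

open Filter Topology MeasureTheory

/-! ### Superpositions of exponential flows -/

/-- Dominated convergence for the slopes, which the mean value inequality on the convex set bounds
by `g`. The one-sided form is needed at `t = 0` and at the ends of `[-1, 0]`. -/
theorem hasDerivWithinAt_integral {Ω : Type*} [MeasurableSpace Ω] {μ : Measure Ω} {S : Set ℝ}
    (hS : Convex ℝ S) {f f' : ℝ → Ω → ℂ} {g : Ω → ℝ} (hg : Integrable g μ)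
    (hf : ∀ t ∈ S, Integrable (f t) μ)
    (hd : ∀ t ∈ S, ∀ p, HasDerivWithinAt (fun t => f t p) (f' t p) S t)
    (hb : ∀ t ∈ S, ∀ p, ‖f' t p‖ ≤ g p) {t₀ : ℝ} (ht₀ : t₀ ∈ S) :
    HasDerivWithinAt (fun t => ∫ p, f t p ∂μ) (∫ p, f' t₀ p ∂μ) S t₀ := by
  rw [hasDerivWithinAt_iff_tendsto_slope]
  have heq : (fun t => ∫ p, slope (fun t => f t p) t₀ t ∂μ) =ᶠ[𝓝[S \ {t₀}] t₀]
      slope (fun t => ∫ p, f t p ∂μ) t₀ := by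
    filter_upwards [self_mem_nhdsWithin] with t ht
    simp only [slope_def_module]
    rw [integral_smul, integral_sub (hf t ht.1) (hf t₀ ht₀)]
  refine Tendsto.congr' heq ?_
  refine tendsto_integral_filter_of_dominated_convergence g ?_ ?_ hg ?_
  · filter_upwards [self_mem_nhdsWithin] with t ht
    simp only [slope_def_module]
    exact (((hf t ht.1).sub (hf t₀ ht₀)).smul _).aestronglyMeasurable
  · filter_upwards [self_mem_nhdsWithin] with t ht
    refine Eventually.of_forall fun p => ?_
    have h1 := hS.norm_image_sub_le_of_norm_hasDerivWithin_le (fun t ht => hd t ht p)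
      (fun t ht => hb t ht p) ht₀ ht.1
    have hne : t - t₀ ≠ 0 := sub_ne_zero.2 ht.2
    rw [slope_def_module, norm_smul, norm_inv, inv_mul_le_iff₀ (norm_pos_iff.2 hne), mul_comm]
    exact h1
  · exact Eventually.of_forall fun p => hasDerivWithinAt_iff_tendsto_slope.1 (hd t₀ ht₀ p)

/-- Bounds making the superposition with weight `M` of the flows `e^{l t} G(x, l)` converge. -/
structure IsKernel {Ω : Type*} [MeasurableSpace Ω] (a : ℝ) (μ : Measure Ω) (M l : Ω → ℂ)
    (s : Ω → ℝ) (Q D η c : ℝ) : Prop where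
  measurable_weight : Measurable M
  measurable_exponent : Measurable l
  nonneg : ∀ p, 0 ≤ s p
  one_le : 1 ≤ D
  eta_pos : 0 < η
  eta_le : η ≤ 2
  c_pos : 0 < c
  weight_le : ∀ p m, ∀ x ∈ Icc (-1 : ℝ) 0,
    ‖M p‖ * ‖eigenfun a (l p) m x‖ ≤ (D * (1 + s p)) ^ m * (Q * Real.exp (-(η * s p)))
  exponent_le : ∀ p, ‖l p‖ ≤ 1000 * s p ^ 3
  re_le : ∀ p, (l p).re ≤ -(c * s p ^ 3)
  integrable : Integrable (fun p => Real.exp (-(η / 2 * s p))) μ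

/-- The integrand of `superposition`. -/
noncomputable def kernelTerm {Ω : Type*} (a : ℝ) (M l : Ω → ℂ) (m n : ℕ) (x t : ℝ) (p : Ω) : ℂ :=
  M p * l p ^ n * Complex.exp (l p * t) * eigenfun a (l p) m x

/-- The superposition with weight `M` of the flows `e^{l t} G(x, l)`. -/
noncomputable def superposition {Ω : Type*} [MeasurableSpace Ω] (a : ℝ) (μ : Measure Ω)
    (M l : Ω → ℂ) (m n : ℕ) (x t : ℝ) : ℝ :=
  (∫ p, kernelTerm a M l m n x t p ∂μ).re

/-- Half of the exponential decay pays for the power, at the price of a factorial; the other half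
remains for integrability. -/
theorem pow_mul_exp_neg_le {η s : ℝ} (hη : 0 < η) (hs : 0 ≤ s) (k : ℕ) :
    (1 + s) ^ k * Real.exp (-(η * s))
      ≤ Real.exp (η / 2) * (2 / η) ^ k * k.factorial * Real.exp (-(η / 2 * s)) := by
  have h1 := Real.pow_div_factorial_le_exp (η / 2 * (1 + s)) (by positivity) k
  rw [div_le_iff₀ (by positivity)] at h1
  calc (1 + s) ^ k * Real.exp (-(η * s))
      = (2 / η) ^ k * (η / 2 * (1 + s)) ^ k * Real.exp (-(η * s)) := by
        rw [← mul_pow]; congr 2; field_simp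
    _ ≤ (2 / η) ^ k * (Real.exp (η / 2 * (1 + s)) * k.factorial) * Real.exp (-(η * s)) := by gcongr
    _ = (2 / η) ^ k * k.factorial * (Real.exp (η / 2 * (1 + s)) * Real.exp (-(η * s))) := by ring
    _ = (2 / η) ^ k * k.factorial * (Real.exp (η / 2) * Real.exp (-(η / 2 * s))) := by
        rw [← Real.exp_add, ← Real.exp_add]; congr 2; ring
    _ = _ := by ring

namespace IsKernel

variable {Ω : Type*} [MeasurableSpace Ω] {a : ℝ} {μ : Measure Ω} {M l : Ω → ℂ} {s : Ω → ℝ}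
  {Q D η c : ℝ}

theorem Q_nonneg [Nonempty Ω] (h : IsKernel a μ M l s Q D η c) : 0 ≤ Q := by
  obtain ⟨p⟩ := ‹Nonempty Ω›
  have h1 := (by positivity : 0 ≤ ‖M p‖ * ‖eigenfun a (l p) 0 0‖).trans
    (h.weight_le p 0 0 (by norm_num))
  rw [pow_zero, one_mul] at h1
  exact nonneg_of_mul_nonneg_left h1 (Real.exp_pos _)

/-- The growth constant of `superposition`. -/
noncomputable def growth (D η : ℝ) : ℝ := 256000 * D * (2 / η) ^ 3

theorem norm_kernelTerm_le [Nonempty Ω] (h : IsKernel a μ M l s Q D η c) (m n : ℕ) {x : ℝ}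
    (hx : x ∈ Icc (-1 : ℝ) 0) {t : ℝ} (ht : 0 ≤ t) (p : Ω) : ‖kernelTerm a M l m n x t p‖ ≤
      Q * Real.exp (η / 2) * growth D η ^ (m + n) * (m.factorial * (n.factorial : ℝ) ^ 3)
        * Real.exp (-(η / 2 * s p)) := by
  have hs := h.nonneg p
  have hQ := h.Q_nonneg
  have hη := h.eta_pos
  have hD := h.one_le
  have hηr : 1 ≤ 2 / η := by rw [le_div_iff₀ hη]; linarith [h.eta_le]
  have hexp : ‖Complex.exp (l p * t)‖ ≤ 1 := by
    rw [Complex.norm_exp, Complex.re_mul_ofReal]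
    refine Real.exp_le_one_iff.2 (mul_nonpos_of_nonpos_of_nonneg ((h.re_le p).trans ?_) ht)
    have := h.c_pos
    have : 0 ≤ c * s p ^ 3 := by positivity
    linarith
  have hl : ‖l p‖ ≤ 1000 * (1 + s p) ^ 3 := by
    refine (h.exponent_le p).trans ?_
    gcongr
    linarith
  unfold kernelTerm
  rw [norm_mul, norm_mul, norm_mul, norm_pow]
  calc ‖M p‖ * ‖l p‖ ^ n * ‖Complex.exp (l p * t)‖ * ‖eigenfun a (l p) m x‖
      = (‖M p‖ * ‖eigenfun a (l p) m x‖) * ‖l p‖ ^ n * ‖Complex.exp (l p * t)‖ := by ring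
    _ ≤ ((D * (1 + s p)) ^ m * (Q * Real.exp (-(η * s p)))) * (1000 * (1 + s p) ^ 3) ^ n * 1 := by
        gcongr ?_ * ?_ ^ n * ?_
        exact h.weight_le p m x hx
    _ = Q * D ^ m * 1000 ^ n * ((1 + s p) ^ (m + 3 * n) * Real.exp (-(η * s p))) := by
        rw [mul_pow, mul_pow, pow_add, pow_mul]; ring
    _ ≤ Q * D ^ m * 1000 ^ n * (Real.exp (η / 2) * (2 / η) ^ (m + 3 * n)
          * (2 ^ (m + 3 * n) * (m.factorial * (32 ^ n * (n.factorial : ℝ) ^ 3)))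
          * Real.exp (-(η / 2 * s p))) := by
        gcongr ?_ * ?_
        refine (pow_mul_exp_neg_le hη hs _).trans ?_
        gcongr
        refine (factorial_add_le m (3 * n)).trans ?_
        gcongr
        exact factorial_three_mul_le n
    _ = Q * Real.exp (η / 2) * ((D * 2 * (2 / η)) ^ m * (256000 * (2 / η) ^ 3) ^ n)
          * (m.factorial * (n.factorial : ℝ) ^ 3) * Real.exp (-(η / 2 * s p)) := by
        -- `1000` comes from `‖l‖ ≤ 1000 s³`, `2³` from splitting `(m + 3n)!`, and `32` from `(3n)!
        -- ≤ 32ⁿ n!³`.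
        rw [show (256000 : ℝ) = 1000 * 2 ^ 3 * 32 by norm_num, pow_add, pow_add, pow_mul, pow_mul]
        simp only [mul_pow]
        ring
    _ ≤ Q * Real.exp (η / 2) * (growth D η ^ m * growth D η ^ n)
          * (m.factorial * (n.factorial : ℝ) ^ 3) * Real.exp (-(η / 2 * s p)) := by
        have h3 : 2 / η ≤ (2 / η) ^ 3 := le_self_pow₀ hηr (by norm_num)
        have hp : 0 < (2 / η) ^ 3 := by positivity
        have hg : 0 ≤ growth D η := by unfold growth; positivity
        have h4 : D * 2 * (2 / η) ≤ growth D η := by unfold growth; nlinarith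
        have h5 : 256000 * (2 / η) ^ 3 ≤ growth D η := by unfold growth; nlinarith
        gcongr _ * (?_ ^ m * ?_ ^ n) * _ * _
    _ = _ := by rw [pow_add]

theorem measurable_kernelTerm (h : IsKernel a μ M l s Q D η c) (ha : 0 ≤ a) (m n : ℕ) (x t : ℝ) :
    Measurable (kernelTerm a M l m n x t) := by
  have h1 := h.measurable_weight
  have h2 := h.measurable_exponent
  have h3 : Measurable fun p => eigenfun a (l p) m x := (measurable_eigenfun ha m x).comp h2
  unfold kernelTerm
  fun_prop

variable [Nonempty Ω]

theorem integrable_kernelTerm (h : IsKernel a μ M l s Q D η c) (ha : 0 ≤ a) (m n : ℕ) {x : ℝ}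
    (hx : x ∈ Icc (-1 : ℝ) 0) {t : ℝ} (ht : 0 ≤ t) : Integrable (kernelTerm a M l m n x t) μ :=
  (h.integrable.const_mul _).mono' (h.measurable_kernelTerm ha m n x t).aestronglyMeasurable
    (Eventually.of_forall fun p => h.norm_kernelTerm_le m n hx ht p)

/-- Each `e^{lt}G(x,l)` is a flow because `PG = lG`. For `t ≥ 0` the time factor is bounded by `1`,
and the decay in `s` alone pays for `lⁿ`, of size `s^{3n}`: hence order 3 in time, valid down to `t
= 0`. -/
theorem isFlow_superposition (h : IsKernel a μ M l s Q D η c) (ha : 0 ≤ a) :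
    IsFlow a (Ici 0) (superposition a μ M l) where
  hasDeriv_x m n x hx t ht := by
    have h1 := hasDerivWithinAt_integral (convex_Icc (-1 : ℝ) 0) (h.integrable.const_mul
      (Q * Real.exp (η / 2) * growth D η ^ (m + 1 + n) * ((m + 1).factorial * (n.factorial : ℝ) ^ 3)))
      (f := fun x => kernelTerm a M l m n x t) (f' := fun x => kernelTerm a M l (m + 1) n x t)
      (fun x hx => h.integrable_kernelTerm ha m n hx ht)
      (fun x hx p => ((hasDerivAt_eigenfun ha m x).const_mul _).hasDerivWithinAt)
      (fun x hx p => h.norm_kernelTerm_le (m + 1) n hx ht p) hx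
    exact Complex.reCLM.hasFDerivAt.comp_hasDerivWithinAt x h1
  hasDeriv_t m n x hx t ht := by
    have h1 := hasDerivWithinAt_integral (convex_Ici (0 : ℝ)) (h.integrable.const_mul
      (Q * Real.exp (η / 2) * growth D η ^ (m + (n + 1)) * (m.factorial * ((n + 1).factorial : ℝ) ^ 3)))
      (f := fun t => kernelTerm a M l m n x t) (f' := fun t => kernelTerm a M l m (n + 1) x t)
      (fun t ht => h.integrable_kernelTerm ha m n hx ht)
      (fun t ht p => ?_)
      (fun t ht p => h.norm_kernelTerm_le m (n + 1) hx ht p) ht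
    · exact Complex.reCLM.hasFDerivAt.comp_hasDerivWithinAt t h1
    · have h2 : HasDerivAt (fun t : ℝ => l p * t) (l p) t := by
        simpa using (Complex.ofRealCLM.hasDerivAt (x := t)).const_mul (l p)
      refine ((h2.cexp.const_mul (M p * l p ^ n)).mul_const _).hasDerivWithinAt.congr_deriv ?_
      unfold kernelTerm
      rw [pow_succ]
      ring
  equation m n x hx t ht := by
    have i3 := h.integrable_kernelTerm ha (m + 3) n hx ht
    have i1 := h.integrable_kernelTerm ha (m + 1) n hx ht
    have : (∫ p, kernelTerm a M l m (n + 1) x t p ∂μ)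
        = (∫ p, kernelTerm a M l (m + 3) n x t p ∂μ)
          + a * ∫ p, kernelTerm a M l (m + 1) n x t p ∂μ := by
      rw [← integral_const_mul, ← integral_add i3 (i1.const_mul _)]
      congr 1
      ext p
      unfold kernelTerm
      rw [eigenfun_equation ha]
      ring
    unfold superposition
    rw [this, Complex.add_re, Complex.re_ofReal_mul]
  zero_right n t _ := by simp [superposition, kernelTerm, eigenfun_zero_zero]
  zero_right_deriv n t _ := by simp [superposition, kernelTerm, eigenfun_one_zero]
  bound := by
    have hI : 0 ≤ ∫ p, Real.exp (-(η / 2 * s p)) ∂μ := integral_nonneg fun p => (Real.exp_pos _).le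
    have hQ := h.Q_nonneg
    have hη := h.eta_pos
    have hD := h.one_le
    have hg : 0 < growth D η := by unfold growth; positivity
    refine ⟨Q * Real.exp (η / 2) * (∫ p, Real.exp (-(η / 2 * s p)) ∂μ) + 1, growth D η,
      by positivity, hg, fun m n x hx t ht => ?_⟩
    calc |superposition a μ M l m n x t| ≤ ‖∫ p, kernelTerm a M l m n x t p ∂μ‖ :=
          Complex.abs_re_le_norm _
      _ ≤ ∫ p, Q * Real.exp (η / 2) * growth D η ^ (m + n) * (m.factorial * (n.factorial : ℝ) ^ 3)
            * Real.exp (-(η / 2 * s p)) ∂μ := norm_integral_le_of_norm_le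
          (h.integrable.const_mul _)
          (Eventually.of_forall fun p => h.norm_kernelTerm_le m n hx ht p)
      _ = (Q * Real.exp (η / 2) * (∫ p, Real.exp (-(η / 2 * s p)) ∂μ)) * growth D η ^ (m + n)
            * (m.factorial * (n.factorial : ℝ) ^ 3) := by rw [integral_const_mul]; ring
      _ ≤ _ := by gcongr; linarith

/-- For positive times, the second derivative at `x = 0` is analytic. -/
theorem exists_analytic_bound (h : IsKernel a μ M l s Q D η c) {t₁ : ℝ} (ht₁ : 0 < t₁) :
    ∃ K L : ℝ, 0 ≤ K ∧ 0 ≤ L ∧ ∀ n t, t₁ ≤ t →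
      |superposition a μ M l 2 n 0 t| ≤ K * L ^ n * (n.factorial : ℝ) ^ 2 := by
  have hI : 0 ≤ ∫ p, Real.exp (-(η / 2 * s p)) ∂μ := integral_nonneg fun p => (Real.exp_pos _).le
  have hQ := h.Q_nonneg
  have hη := h.eta_pos
  have hD := h.one_le
  have hc := h.c_pos
  have hg : 0 < growth D η := by unfold growth; positivity
  set K₀ := Q * Real.exp (η / 2) * growth D η ^ 2 * 2 with hK₀
  refine ⟨K₀ * ∫ p, Real.exp (-(η / 2 * s p)) ∂μ, 1000 / (c * t₁), by positivity, by positivity,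
    fun n t ht => ?_⟩
  have hterm : ∀ p, ‖kernelTerm a M l 2 n 0 t p‖
      ≤ (1000 / (c * t₁)) ^ n * n.factorial * K₀ * Real.exp (-(η / 2 * s p)) := by
    intro p
    have hs := h.nonneg p
    have h0 := h.norm_kernelTerm_le 2 0 (x := 0) (by norm_num) le_rfl p
    simp only [kernelTerm, pow_zero, mul_one, Complex.ofReal_zero, mul_zero, Complex.exp_zero,
      eigenfun_two_zero, add_zero, Nat.factorial_zero, Nat.cast_one, one_pow] at h0
    have h1 := Real.pow_div_factorial_le_exp (c * s p ^ 3 * t₁) (by positivity) n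
    rw [div_le_iff₀ (by positivity)] at h1
    unfold kernelTerm
    rw [eigenfun_two_zero, mul_one, norm_mul, norm_mul, norm_pow, Complex.norm_exp,
      Complex.re_mul_ofReal]
    have h2 : (l p).re * t ≤ -(c * s p ^ 3 * t₁) := by
      have h3 : 0 ≤ c * s p ^ 3 := by positivity
      nlinarith [h.re_le p]
    -- Away from `t = 0` the factor `e^{-c s³ t₁}` itself absorbs `‖l‖ⁿ` and costs a single `n!`.
    have h4 : ‖l p‖ ^ n * Real.exp ((l p).re * t) ≤ (1000 / (c * t₁)) ^ n * n.factorial := by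
      calc ‖l p‖ ^ n * Real.exp ((l p).re * t)
          ≤ (1000 * s p ^ 3) ^ n * Real.exp (-(c * s p ^ 3 * t₁)) := by
            gcongr
            exact h.exponent_le p
        _ = (1000 / (c * t₁)) ^ n * (c * s p ^ 3 * t₁) ^ n * Real.exp (-(c * s p ^ 3 * t₁)) := by
            rw [← mul_pow]; congr 2; field_simp
        _ ≤ (1000 / (c * t₁)) ^ n * (Real.exp (c * s p ^ 3 * t₁) * n.factorial)
            * Real.exp (-(c * s p ^ 3 * t₁)) := by gcongr
        _ = (1000 / (c * t₁)) ^ n * n.factorial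
            * (Real.exp (c * s p ^ 3 * t₁) * Real.exp (-(c * s p ^ 3 * t₁))) := by ring
        _ = _ := by rw [← Real.exp_add, add_neg_cancel, Real.exp_zero, mul_one]
    calc ‖M p‖ * ‖l p‖ ^ n * Real.exp ((l p).re * t)
        = (‖l p‖ ^ n * Real.exp ((l p).re * t)) * ‖M p‖ := by ring
      _ ≤ ((1000 / (c * t₁)) ^ n * n.factorial) * (K₀ * Real.exp (-(η / 2 * s p))) := by
          gcongr
          refine h0.trans (le_of_eq ?_)
          norm_num [hK₀, Nat.factorial]
      _ = _ := by ring
  calc |superposition a μ M l 2 n 0 t| ≤ ‖∫ p, kernelTerm a M l 2 n 0 t p ∂μ‖ :=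
        Complex.abs_re_le_norm _
    _ ≤ ∫ p, (1000 / (c * t₁)) ^ n * n.factorial * K₀ * Real.exp (-(η / 2 * s p)) ∂μ :=
        norm_integral_le_of_norm_le (h.integrable.const_mul _) (Eventually.of_forall hterm)
    _ = K₀ * (∫ p, Real.exp (-(η / 2 * s p)) ∂μ) * (1000 / (c * t₁)) ^ n * (n.factorial : ℝ) ^ 1 := by
        rw [integral_const_mul]; ring
    _ ≤ _ := by
        gcongr
        · exact_mod_cast Nat.one_le_iff_ne_zero.2 (Nat.factorial_ne_zero n)
        · norm_num

end IsKernel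

end LinearKdV

namespace LinearKdV

open Filter Topology MeasureTheory

/-! ### The contour -/

/-- The direction of the ray of integration belonging to the angle `θ`. -/
noncomputable def rayDir (θ : ℝ) : ℂ :=
  if 12 / 13 ≤ Real.cos θ then
    if 0 ≤ Real.sin θ then ⟨8, 5⟩ else ⟨8, -5⟩
  else if 0 ≤ Real.sin θ then ⟨2, 1⟩ else ⟨2, -1⟩

/-- The coefficient of `σ³` in the exponents on the ray belonging to the angle `θ`. -/
noncomputable def raySymbol (θ : ℝ) : ℂ := Complex.exp (θ * Complex.I) * rayDir θ ^ 3

theorem measurable_rayDir : Measurable rayDir := by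
  unfold rayDir
  refine Measurable.ite (measurableSet_le measurable_const Real.measurable_cos)
    (Measurable.ite (measurableSet_le measurable_const Real.measurable_sin) measurable_const
      measurable_const)
    (Measurable.ite (measurableSet_le measurable_const Real.measurable_sin) measurable_const
      measurable_const)

theorem measurable_raySymbol : Measurable raySymbol := by
  unfold raySymbol
  have := measurable_rayDir
  fun_prop

/-- `Re w³ = 4x³ - 3|w|²x` with `x = Re w`, and for fixed `|w|` this cubic increases beyond `|w|/2`,
hence beyond `g`. -/
theorem re_le_of_cube {w v : ℂ} {g k : ℝ} (hg : 0 ≤ g) (hw : w ^ 3 = v) (hk : ‖w‖ ^ 2 = k)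
    (hkg : k ≤ 4 * g ^ 2) (hv : v.re ≤ 4 * g ^ 3 - 3 * k * g) : w.re ≤ g := by
  by_contra h
  push Not at h
  have h1 : v.re = 4 * w.re ^ 3 - 3 * k * w.re := by
    rw [← hw, ← hk, ← Complex.normSq_eq_norm_sq, Complex.normSq_apply, pow_succ, pow_two]
    simp only [Complex.mul_re, Complex.mul_im]
    ring
  have h2 : 0 < (w.re - g) * (4 * (w.re ^ 2 + w.re * g + g ^ 2) - 3 * k) := by
    apply mul_pos (by linarith)
    nlinarith
  nlinarith

theorem norm_sq_of_cube {w v : ℂ} {k : ℝ} (hk : 0 ≤ k) (hw : w ^ 3 = v)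
    (hv : ‖v‖ ^ 2 = k ^ 3) : ‖w‖ ^ 2 = k := by
  have h : (‖w‖ ^ 2) ^ 3 = k ^ 3 := by rw [← hv, ← hw, norm_pow]; ring
  exact (pow_left_inj₀ (by positivity) hk (by norm_num)).1 h

/-- `(8 ± 5i)³ = -88 ± 835i` and `(2 ± i)³ = 2 ± 11i`. The direction `2 ± i` is good except near `θ
= 0`, where the real part of its symbol is positive; there `8 ± 5i`, of argument beyond `π/6` in
modulus, takes over. -/
theorem rayDir_cube_cases (θ : ℝ) :
    (12 / 13 ≤ Real.cos θ ∧ (rayDir θ).re = 8 ∧ ‖rayDir θ‖ ^ 2 = 89 ∧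
      (raySymbol θ).re = -(88 * Real.cos θ + 835 * |Real.sin θ|)) ∨
    (Real.cos θ ≤ 12 / 13 ∧ (rayDir θ).re = 2 ∧ ‖rayDir θ‖ ^ 2 = 5 ∧
      (raySymbol θ).re = 2 * Real.cos θ - 11 * |Real.sin θ|) := by
  have key : ∀ x y : ℝ, rayDir θ = ⟨x, y⟩ → ‖rayDir θ‖ ^ 2 = x ^ 2 + y ^ 2 ∧
      (raySymbol θ).re = Real.cos θ * (x ^ 3 - 3 * x * y ^ 2)
        - Real.sin θ * (3 * x ^ 2 * y - y ^ 3) := fun x y h => by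
    unfold raySymbol
    rw [h, ← Complex.normSq_eq_norm_sq, Complex.normSq_apply, Complex.exp_mul_I,
      ← Complex.ofReal_cos, ← Complex.ofReal_sin, pow_succ, pow_two]
    constructor
    · ring
    · simp only [Complex.mul_re, Complex.mul_im, Complex.add_re, Complex.add_im, Complex.ofReal_re,
        Complex.ofReal_im, Complex.I_re, Complex.I_im, pow_succ, pow_zero, one_mul]
      ring
  by_cases hc : 12 / 13 ≤ Real.cos θ <;> by_cases hs : 0 ≤ Real.sin θ
  · left
    have h : rayDir θ = ⟨8, 5⟩ := by unfold rayDir; rw [if_pos hc, if_pos hs]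
    obtain ⟨h1, h2⟩ := key _ _ h
    refine ⟨hc, by rw [h], by rw [h1]; norm_num, ?_⟩
    rw [h2, abs_of_nonneg hs]; ring
  · left
    have h : rayDir θ = ⟨8, -5⟩ := by unfold rayDir; rw [if_pos hc, if_neg hs]
    obtain ⟨h1, h2⟩ := key _ _ h
    refine ⟨hc, by rw [h], by rw [h1]; norm_num, ?_⟩
    rw [h2, abs_of_neg (not_le.1 hs)]; ring
  · right
    have h : rayDir θ = ⟨2, 1⟩ := by unfold rayDir; rw [if_neg hc, if_pos hs]
    obtain ⟨h1, h2⟩ := key _ _ h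
    refine ⟨(not_le.1 hc).le, by rw [h], by rw [h1]; norm_num, ?_⟩
    rw [h2, abs_of_nonneg hs]; ring
  · right
    have h : rayDir θ = ⟨2, -1⟩ := by unfold rayDir; rw [if_neg hc, if_neg hs]
    obtain ⟨h1, h2⟩ := key _ _ h
    refine ⟨(not_le.1 hc).le, by rw [h], by rw [h1]; norm_num, ?_⟩
    rw [h2, abs_of_neg (not_le.1 hs)]; ring

theorem rayDir_re_ge (θ : ℝ) : 2 ≤ (rayDir θ).re := by
  rcases rayDir_cube_cases θ with ⟨-, h, -⟩ | ⟨-, h, -⟩ <;> rw [h]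
  norm_num

theorem norm_rayDir_le (θ : ℝ) : ‖rayDir θ‖ ≤ 10 := by
  refine abs_le_of_sq_le_sq' ?_ (by norm_num) |>.2
  rcases rayDir_cube_cases θ with ⟨-, -, h, -⟩ | ⟨-, -, h, -⟩ <;> rw [h] <;> norm_num

theorem norm_raySymbol (θ : ℝ) : ‖raySymbol θ‖ = ‖rayDir θ‖ ^ 3 := by
  unfold raySymbol
  rw [norm_mul, Complex.norm_exp_ofReal_mul_I, one_mul, norm_pow]

theorem norm_raySymbol_le (θ : ℝ) : ‖raySymbol θ‖ ≤ 1000 := by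
  rw [norm_raySymbol]
  calc ‖rayDir θ‖ ^ 3 ≤ 10 ^ 3 := by gcongr; exact norm_rayDir_le θ
    _ = 1000 := by norm_num

/-- For the direction `2 ± i` and `0 ≤ cos θ ≤ 12/13` one has `|sin θ| ≥ 5/13`; for `cos θ ≤ 0` one
has `|sin θ| - cos θ ≥ 1`. -/
theorem raySymbol_re_le (θ : ℝ) : (raySymbol θ).re ≤ -1 := by
  have hsq := Real.sin_sq_add_cos_sq θ
  have hs0 := abs_nonneg (Real.sin θ)
  rw [← sq_abs (Real.sin θ)] at hsq
  rcases rayDir_cube_cases θ with ⟨hc, -, -, h⟩ | ⟨hc, -, -, h⟩ <;> rw [h]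
  · linarith
  · rcases le_total 0 (Real.cos θ) with h0 | h0
    · have : 5 / 13 ≤ |Real.sin θ| := by
        by_contra hlt
        push Not at hlt
        nlinarith
      linarith
    · have : 1 ≤ |Real.sin θ| - Real.cos θ := by
        by_contra hlt
        push Not at hlt
        nlinarith [mul_nonneg hs0 (neg_nonneg.2 h0)]
      linarith

/-- The growth of `G` along the ray stays below the decay `Re r` of the weight, with margin
`1/1000`. For `2 ± i` the trivial bound `Re w ≤ |w| = √5` suffices, because `25/28 < 2/√5`. For `8 ±
5i` it does not, since `25√89/28 > 8`, and the real part of `w³` has to be used. -/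
theorem re_cube_root_raySymbol_le (θ : ℝ) {w : ℂ} (hw : w ^ 3 = -raySymbol θ) :
    25 / 28 * w.re ≤ (rayDir θ).re - 1 / 1000 := by
  have hsq := Real.sin_sq_add_cos_sq θ
  have hs0 := abs_nonneg (Real.sin θ)
  rw [← sq_abs (Real.sin θ)] at hsq
  have hn : ‖-raySymbol θ‖ ^ 2 = (‖rayDir θ‖ ^ 2) ^ 3 := by rw [norm_neg, norm_raySymbol]; ring
  have hwn := norm_sq_of_cube (by positivity) hw hn
  rcases rayDir_cube_cases θ with ⟨hc, hr, hk, h⟩ | ⟨hc, hr, hk, h⟩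
  · rw [hk] at hwn
    have hs : |Real.sin θ| ≤ 5 / 13 := by
      by_contra hlt
      push Not at hlt
      nlinarith
    -- Here `Re w³ ≤ 88 + 835 · 5/13 < 410`, while `4g³ - 267g > 443` at `g = 8.9`, and `25/28 · 8.9
    -- < 7.95`.
    have hw2 := re_le_of_cube (g := 8.9) (by norm_num) hw hwn (by norm_num) (by
      rw [Complex.neg_re, h]
      have := Real.cos_le_one θ
      norm_num
      linarith)
    rw [hr]
    norm_num at hw2 ⊢
    linarith
  · rw [hk] at hwn
    have h1 : w.re ≤ 2.2365 := by
      refine (Complex.re_le_norm w).trans (abs_le_of_sq_le_sq' ?_ (by norm_num)).2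
      rw [hwn]
      norm_num
    rw [hr]
    norm_num at h1 ⊢
    linarith

/-! ### Prescribing the derivatives at time zero -/

theorem norm_pow_mul_cexp_neg_le (k : ℕ) {r : ℂ} (hr : 0 < r.re) {t : ℝ} (ht : 0 ≤ t) :
    ‖(t : ℂ) ^ k * Complex.exp (-(r * t))‖
      ≤ Real.exp (r.re / 2) * (2 / r.re) ^ k * k.factorial * Real.exp (-(r.re / 2) * t) := by
  rw [norm_mul, norm_pow, Complex.norm_real, Real.norm_eq_abs, abs_of_nonneg ht, Complex.norm_exp,
    Complex.neg_re, Complex.re_mul_ofReal, neg_mul]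
  refine le_trans ?_ (pow_mul_exp_neg_le hr ht k)
  gcongr
  linarith

theorem integrableOn_pow_mul_cexp_neg (k : ℕ) {r : ℂ} (hr : 0 < r.re) :
    IntegrableOn (fun t : ℝ => (t : ℂ) ^ k * Complex.exp (-(r * t))) (Ioi 0) := by
  refine ((integrableOn_exp_mul_Ioi (a := -(r.re / 2)) (by linarith) 0).const_mul
    (Real.exp (r.re / 2) * (2 / r.re) ^ k * k.factorial)).mono' (by fun_prop) ?_
  exact (ae_restrict_iff' measurableSet_Ioi).2
    (Eventually.of_forall fun t ht => norm_pow_mul_cexp_neg_le k hr (mem_Ioi.1 ht).le)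

/-- Integration by parts and induction on `k`, directly for complex `r` with `Re r > 0`; no rotation
of contours is needed. -/
theorem integral_pow_mul_cexp_neg (k : ℕ) {r : ℂ} (hr : 0 < r.re) :
    ∫ t : ℝ in Ioi 0, (t : ℂ) ^ k * Complex.exp (-(r * t)) = k.factorial / r ^ (k + 1) := by
  have hne : r ≠ 0 := fun h => by rw [h] at hr; simp at hr
  have hlin : ∀ t : ℝ, HasDerivAt (fun t : ℝ => Complex.exp (-(r * t)))
      (Complex.exp (-(r * t)) * -r) t := fun t => by
    have : HasDerivAt (fun t : ℝ => -(r * (t : ℂ))) (-r) t := by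
      simpa using! ((Complex.ofRealCLM.hasDerivAt (x := t)).const_mul r).neg
    exact this.cexp
  have hlim : ∀ k, Tendsto (fun t : ℝ => (t : ℂ) ^ k * Complex.exp (-(r * t))) atTop (𝓝 0) := by
    intro k
    refine squeeze_zero_norm' ((eventually_ge_atTop 0).mono
      fun t ht => norm_pow_mul_cexp_neg_le k hr ht) ?_
    have : Tendsto (fun t : ℝ => Real.exp (-(r.re / 2) * t)) atTop (𝓝 0) :=
      Real.tendsto_exp_atBot.comp (tendsto_id.const_mul_atTop_of_neg (by linarith))
    simpa using this.const_mul (Real.exp (r.re / 2) * (2 / r.re) ^ k * k.factorial)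
  induction k with
  | zero =>
    have i0 : IntegrableOn (fun t : ℝ => Complex.exp (-(r * t))) (Ioi 0) := by
      simpa using integrableOn_pow_mul_cexp_neg 0 hr
    have h := integral_Ioi_of_hasDerivAt_of_tendsto' (a := (0 : ℝ)) (fun t _ => hlin t)
      (i0.mul_const (-r)) (by simpa using hlim 0)
    rw [integral_mul_const] at h
    simp only [Complex.ofReal_zero, mul_zero, neg_zero, Complex.exp_zero] at h
    simp only [pow_zero, one_mul, Nat.factorial_zero, Nat.cast_one, zero_add, pow_one]
    field_simp
    linear_combination -h
  | succ k ih =>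
    have i0 := integrableOn_pow_mul_cexp_neg k hr
    have i1 := integrableOn_pow_mul_cexp_neg (k + 1) hr
    have hd : ∀ t : ℝ, HasDerivAt (fun t : ℝ => (t : ℂ) ^ (k + 1) * Complex.exp (-(r * t)))
        ((k + 1) * ((t : ℂ) ^ k * Complex.exp (-(r * t)))
          - r * ((t : ℂ) ^ (k + 1) * Complex.exp (-(r * t)))) t := fun t => by
      have h1 : HasDerivAt (fun t : ℝ => (t : ℂ) ^ (k + 1)) ((k + 1) * (t : ℂ) ^ k) t := by
        have := (hasDerivAt_pow (k + 1) (t : ℂ)).comp_ofReal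
        simpa using this
      refine (h1.mul (hlin t)).congr_deriv ?_
      ring
    have h := integral_Ioi_of_hasDerivAt_of_tendsto' (a := (0 : ℝ)) (fun t _ => hd t)
      ((i0.const_mul _).sub (i1.const_mul _)) (hlim (k + 1))
    rw [integral_sub (i0.const_mul _) (i1.const_mul _), integral_const_mul, integral_const_mul, ih]
      at h
    simp only [Complex.ofReal_zero, ne_eq, Nat.add_eq_zero_iff, one_ne_zero, and_false,
      not_false_eq_true, zero_pow, zero_mul, sub_zero] at h
    rw [Nat.factorial_succ]
    push_cast
    rw [pow_succ r (k + 1)]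
    field_simp at h ⊢
    linear_combination -h

theorem integral_cexp_int (j : ℤ) :
    ∫ θ in (0 : ℝ)..2 * Real.pi, Complex.exp (j * θ * Complex.I) = if j = 0 then 2 * Real.pi else 0 := by
  split_ifs with hj
  · simp [hj]
  · have hc : (j : ℂ) * Complex.I ≠ 0 := mul_ne_zero (by exact_mod_cast hj) Complex.I_ne_zero
    have h := integral_exp_mul_complex (a := 0) (b := 2 * Real.pi) hc
    rw [show (fun θ : ℝ => Complex.exp (j * θ * Complex.I))
      = fun θ : ℝ => Complex.exp (j * Complex.I * θ) from funext fun θ => by ring_nf, h]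
    have : (j : ℂ) * Complex.I * ((2 * Real.pi : ℝ) : ℂ) = j * (2 * Real.pi * Complex.I) := by
      push_cast; ring
    rw [this, Complex.exp_int_mul_two_pi_mul_I]
    simp

/-- The function on the circle with Fourier coefficients `bₖ` at `-k`. -/
noncomputable def circleSeries (b : ℕ → ℝ) (θ : ℝ) : ℂ :=
  ∑' k : ℕ, (b k : ℂ) * Complex.exp (-(k * θ * Complex.I))

section CircleSeries

variable {b : ℕ → ℝ}

theorem norm_circleSeries_term (k : ℕ) (θ : ℝ) :
    ‖(b k : ℂ) * Complex.exp (-(k * θ * Complex.I))‖ = |b k| := by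
  rw [norm_mul, Complex.norm_real, Real.norm_eq_abs,
    show -((k : ℂ) * θ * Complex.I) = ((-(k * θ) : ℝ) : ℂ) * Complex.I by push_cast; ring,
    Complex.norm_exp_ofReal_mul_I, mul_one]

theorem continuous_circleSeries (hb : Summable fun k => |b k|) : Continuous (circleSeries b) :=
  continuous_tsum (fun k => by fun_prop) hb fun k θ => (norm_circleSeries_term k θ).le

theorem norm_circleSeries_le (hb : Summable fun k => |b k|) (θ : ℝ) :
    ‖circleSeries b θ‖ ≤ ∑' k, |b k| :=
  tsum_of_norm_bounded hb.hasSum fun k => (norm_circleSeries_term k θ).le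

/-- Absolute summability permits termwise integration, and orthogonality of the exponentials leaves
the term `k = n`. -/
theorem integral_circleSeries (hb : Summable fun k => |b k|) (n : ℕ) :
    ∫ θ in (0 : ℝ)..2 * Real.pi, circleSeries b θ * Complex.exp (n * θ * Complex.I)
      = 2 * Real.pi * b n := by
  have h := intervalIntegral.hasSum_integral_of_dominated_convergence (μ := volume)
    (a := 0) (b := 2 * Real.pi)
    (F := fun (k : ℕ) (θ : ℝ) => (b k : ℂ) * Complex.exp (-(k * θ * Complex.I))
      * Complex.exp (n * θ * Complex.I))
    (f := fun θ => circleSeries b θ * Complex.exp (n * θ * Complex.I))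
    (fun k _ => |b k|) (fun k => by fun_prop) (fun k => ?_) ?_ ?_ ?_
  · rw [← h.tsum_eq, tsum_eq_single n]
    · have : ∀ θ : ℝ, (b n : ℂ) * Complex.exp (-(n * θ * Complex.I))
          * Complex.exp (n * θ * Complex.I) = b n := fun θ => by
        rw [mul_assoc, ← Complex.exp_add, neg_add_cancel, Complex.exp_zero, mul_one]
      simp [this]
    · intro k hk
      have : ∀ θ : ℝ, (b k : ℂ) * Complex.exp (-(k * θ * Complex.I))
          * Complex.exp (n * θ * Complex.I)
          = b k * Complex.exp (((n - k : ℤ) : ℂ) * θ * Complex.I) := fun θ => by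
        rw [mul_assoc, ← Complex.exp_add]
        push_cast
        ring_nf
      simp only [this]
      rw [intervalIntegral.integral_const_mul, integral_cexp_int, if_neg (by omega), Complex.ofReal_zero, mul_zero]
  · refine Eventually.of_forall fun θ _ => ?_
    rw [norm_mul, norm_circleSeries_term,
      show (n : ℂ) * θ * Complex.I = ((n * θ : ℝ) : ℂ) * Complex.I by push_cast; ring,
      Complex.norm_exp_ofReal_mul_I, mul_one]
  · exact Eventually.of_forall fun θ _ => hb
  · exact intervalIntegrable_const
  · refine Eventually.of_forall fun θ _ => ?_
    have hs : Summable fun k : ℕ => (b k : ℂ) * Complex.exp (-(k * θ * Complex.I)) :=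
      Summable.of_norm_bounded hb fun k => (norm_circleSeries_term k θ).le
    exact hs.hasSum.mul_right _

end CircleSeries

/-- The parameter space: an angle and a position on the ray belonging to it. -/
noncomputable def rayMeasure : Measure (ℝ × ℝ) :=
  (volume.restrict (Ioc 0 (2 * Real.pi))).prod (volume.restrict (Ioi 0))

/-- The weight of the superposition with moments `bₙ ρⁿ (3n + N)!`. -/
noncomputable def rayWeight (b : ℕ → ℝ) (N : ℕ) (p : ℝ × ℝ) : ℂ :=
  (2 * Real.pi : ℂ)⁻¹ * circleSeries b p.1 * rayDir p.1 ^ (N + 1) * (|p.2| : ℝ) ^ N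
    * Complex.exp (-(rayDir p.1 * (|p.2| : ℝ)))

/-- The exponents of the superposition. -/
noncomputable def rayExponent (p : ℝ × ℝ) : ℂ := (25 / 28) ^ 3 * raySymbol p.1 * (|p.2| : ℝ) ^ 3

theorem integrable_exp_rayMeasure {c : ℝ} (hc : 0 < c) :
    Integrable (fun p : ℝ × ℝ => Real.exp (-(c * |p.2|))) rayMeasure := by
  have h : IntegrableOn (fun σ : ℝ => Real.exp (-(c * |σ|))) (Ioi 0) := by
    refine (integrableOn_exp_mul_Ioi (a := -c) (by linarith) 0).congr_fun (fun σ hσ => ?_)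
      measurableSet_Ioi
    simp only
    rw [abs_of_pos (mem_Ioi.1 hσ), neg_mul]
  unfold rayMeasure
  exact h.comp_snd _

theorem re_cube_root_rayExponent_le (p : ℝ × ℝ) {w : ℂ} (hw : w ^ 3 = -rayExponent p) :
    w.re ≤ ((rayDir p.1).re - 1 / 1000) * |p.2| := by
  rcases (abs_nonneg p.2).eq_or_lt with h0 | hpos
  · have : w = 0 := by
      unfold rayExponent at hw
      rw [← h0] at hw
      simpa using hw
    rw [this, ← h0]
    simp
  · have hne : ((|p.2| : ℝ) : ℂ) ≠ 0 := by exact_mod_cast hpos.ne'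
    have hw' : (w / ((25 / 28 * |p.2| : ℝ) : ℂ)) ^ 3 = -raySymbol p.1 := by
      rw [div_pow, hw]
      unfold rayExponent
      push_cast
      field_simp
    have h := re_cube_root_raySymbol_le p.1 hw'
    rw [Complex.div_ofReal_re, show 25 / 28 * (w.re / (25 / 28 * |p.2|)) = w.re / |p.2| by
      field_simp, div_le_iff₀ hpos] at h
    exact h

/-- The weight decays like `σ^N e^{-Re(r)σ}` and the eigenfunction grows at most like `e^{(Re r -
1/1000)σ}`, up to polynomial factors. Half of the net decay `e^{-σ/1000}` absorbs `σ^N`; the other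
half is the rate `1/2000`. The absolute value of the second coordinate lets the bounds hold at every
parameter, also off the support of the measure. -/
theorem isKernel_ray {a : ℝ} (ha : 0 ≤ a) {b : ℕ → ℝ} (hb : Summable fun k => |b k|) (N : ℕ) :
    IsKernel a rayMeasure (rayWeight b N) rayExponent (fun p => |p.2|)
      ((∑' k, |b k|) * 10 ^ (N + 1) * (N.factorial * 2000 ^ N) * Real.exp (2 * (1 + a)))
      (10 + 2 * (1 + a)) (1 / 2000) ((25 / 28) ^ 3) where
  measurable_weight := by
    have h1 := (continuous_circleSeries hb).measurable
    have h2 := measurable_rayDir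
    unfold rayWeight
    fun_prop
  measurable_exponent := by
    have h1 := measurable_raySymbol
    unfold rayExponent
    fun_prop
  nonneg p := abs_nonneg _
  one_le := by linarith
  eta_pos := by norm_num
  eta_le := by norm_num
  c_pos := by norm_num
  exponent_le p := by
    unfold rayExponent
    rw [norm_mul, norm_mul, norm_pow, norm_pow, Complex.norm_real, Real.norm_eq_abs, abs_abs]
    gcongr
    have := norm_raySymbol_le p.1
    calc _ ≤ (1 : ℝ) * 1000 := by
          gcongr
          norm_num
      _ = 1000 := by norm_num
  re_le p := by
    have h : rayExponent p = (((25 / 28) ^ 3 * |p.2| ^ 3 : ℝ) : ℂ) * raySymbol p.1 := by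
      unfold rayExponent
      push_cast
      ring
    rw [h, Complex.re_ofReal_mul]
    have := mul_le_mul_of_nonneg_left (raySymbol_re_le p.1)
      (by positivity : 0 ≤ (25 / 28 : ℝ) ^ 3 * |p.2| ^ 3)
    linarith
  integrable := by
    have := integrable_exp_rayMeasure (c := 1 / 2000 / 2) (by norm_num)
    exact this
  weight_le p m x hx := by
    set σ := |p.2| with hσ
    have hσ0 : 0 ≤ σ := abs_nonneg _
    have hb0 : 0 ≤ ((rayDir p.1).re - 1 / 1000) * σ := by
      have := rayDir_re_ge p.1
      exact mul_nonneg (by linarith) hσ0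
    have hl : ‖rayExponent p‖ ≤ 1000 * σ ^ 3 := by
      unfold rayExponent
      rw [norm_mul, norm_mul, norm_pow, norm_pow, Complex.norm_real, Real.norm_eq_abs, abs_abs]
      gcongr
      have := norm_raySymbol_le p.1
      calc _ ≤ (1 : ℝ) * 1000 := by
            gcongr
            norm_num
        _ = 1000 := by norm_num
    have hG := norm_eigenfun_le ha hb0 hσ0 hl (fun w hw => re_cube_root_rayExponent_le p hw) hx m
    have hM : ‖rayWeight b N p‖ ≤ (∑' k, |b k|) * 10 ^ (N + 1) * σ ^ N
        * Real.exp (-((rayDir p.1).re * σ)) := by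
      unfold rayWeight
      rw [norm_mul, norm_mul, norm_mul, norm_mul, norm_pow, norm_pow, Complex.norm_real,
        Real.norm_eq_abs, abs_abs, Complex.norm_exp, Complex.neg_re, Complex.re_mul_ofReal]
      have h1 : ‖(2 * Real.pi : ℂ)⁻¹‖ ≤ 1 := by
        rw [norm_inv]
        refine inv_le_one_of_one_le₀ ?_
        rw [norm_mul, Complex.norm_real, Real.norm_eq_abs, abs_of_pos Real.pi_pos]
        simp only [Complex.norm_ofNat]
        linarith [Real.pi_gt_three]
      have h2 := norm_circleSeries_le hb p.1
      have h3 := norm_rayDir_le p.1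
      have h4 : ‖(2 * Real.pi : ℂ)⁻¹‖ * ‖circleSeries b p.1‖ ≤ ∑' k, |b k| := by
        nlinarith [norm_nonneg (circleSeries b p.1), norm_nonneg (2 * Real.pi : ℂ)⁻¹]
      gcongr
    have hB : 0 ≤ ∑' k, |b k| := tsum_nonneg fun _ => abs_nonneg _
    have hσN : σ ^ N * Real.exp (-(1 / 1000 * σ)) ≤ N.factorial * 2000 ^ N
        * Real.exp (-(1 / 2000 * σ)) := by
      have h1 := Real.pow_div_factorial_le_exp (1 / 2000 * σ) (by positivity) N
      rw [div_le_iff₀ (by positivity)] at h1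
      calc σ ^ N * Real.exp (-(1 / 1000 * σ))
          = 2000 ^ N * (1 / 2000 * σ) ^ N * Real.exp (-(1 / 1000 * σ)) := by
            rw [← mul_pow]; congr 2; ring
        _ ≤ 2000 ^ N * (Real.exp (1 / 2000 * σ) * N.factorial) * Real.exp (-(1 / 1000 * σ)) := by
            gcongr
        _ = N.factorial * 2000 ^ N * (Real.exp (1 / 2000 * σ) * Real.exp (-(1 / 1000 * σ))) := by ring
        _ = _ := by rw [← Real.exp_add]; congr 2; ring
    calc ‖rayWeight b N p‖ * ‖eigenfun a (rayExponent p) m x‖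
        ≤ ((∑' k, |b k|) * 10 ^ (N + 1) * σ ^ N * Real.exp (-((rayDir p.1).re * σ)))
          * (((10 + 2 * (1 + a)) * (1 + σ)) ^ m
            * (Real.exp (2 * (1 + a)) * Real.exp (((rayDir p.1).re - 1 / 1000) * σ))) := by
          gcongr
      _ = ((10 + 2 * (1 + a)) * (1 + σ)) ^ m * ((∑' k, |b k|) * 10 ^ (N + 1)
          * Real.exp (2 * (1 + a)) * (σ ^ N * (Real.exp (-((rayDir p.1).re * σ))
            * Real.exp (((rayDir p.1).re - 1 / 1000) * σ)))) := by ring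
      _ = ((10 + 2 * (1 + a)) * (1 + σ)) ^ m * ((∑' k, |b k|) * 10 ^ (N + 1)
          * Real.exp (2 * (1 + a)) * (σ ^ N * Real.exp (-(1 / 1000 * σ)))) := by
          rw [← Real.exp_add]; congr 4; ring_nf
      _ ≤ ((10 + 2 * (1 + a)) * (1 + σ)) ^ m * ((∑' k, |b k|) * 10 ^ (N + 1)
          * Real.exp (2 * (1 + a)) * (N.factorial * 2000 ^ N * Real.exp (-(1 / 2000 * σ)))) := by
          gcongr
      _ = _ := by ring

/-- By Fubini's theorem, the integral along each ray gives `(3n + N)!` times `circleSeries b θ ·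
e^{inθ}` up to a constant: the powers of the direction cancel. The integral over `θ` then extracts
`b n`. -/
theorem integral_ray_moment {a : ℝ} (ha : 0 ≤ a) {b : ℕ → ℝ} (hb : Summable fun k => |b k|)
    (N n : ℕ) : ∫ p, kernelTerm a (rayWeight b N) rayExponent 2 n 0 0 p ∂rayMeasure
      = ((b n * ((25 / 28) ^ 3) ^ n * (3 * n + N).factorial : ℝ) : ℂ) := by
  have hint := (isKernel_ray ha hb N).integrable_kernelTerm ha 2 n (x := 0) (by norm_num)
    (t := 0) le_rfl
  unfold rayMeasure at hint ⊢
  rw [integral_prod _ hint]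
  have hinner : ∀ θ : ℝ, ∫ σ in Ioi (0 : ℝ), kernelTerm a (rayWeight b N) rayExponent 2 n 0 0 (θ, σ)
      = ((2 * Real.pi : ℂ)⁻¹ * ((25 / 28) ^ 3) ^ n * (3 * n + N).factorial)
        * (circleSeries b θ * Complex.exp (n * θ * Complex.I)) := by
    intro θ
    have hre : 0 < (rayDir θ).re := by linarith [rayDir_re_ge θ]
    have hne : rayDir θ ≠ 0 := fun h => by rw [h] at hre; simp at hre
    have h1 : ∀ σ ∈ Ioi (0 : ℝ), kernelTerm a (rayWeight b N) rayExponent 2 n 0 0 (θ, σ)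
        = ((2 * Real.pi : ℂ)⁻¹ * ((25 / 28) ^ 3) ^ n * circleSeries b θ
          * Complex.exp (n * θ * Complex.I) * rayDir θ ^ (3 * n + N + 1))
          * ((σ : ℂ) ^ (3 * n + N) * Complex.exp (-(rayDir θ * σ))) := by
      intro σ hσ
      simp only [kernelTerm, rayWeight, rayExponent, raySymbol, eigenfun_two_zero,
        Complex.ofReal_zero, mul_zero, Complex.exp_zero, mul_one, abs_of_pos (mem_Ioi.1 hσ)]
      rw [mul_assoc (n : ℂ), Complex.exp_nat_mul, mul_pow, mul_pow, mul_pow]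
      ring
    rw [setIntegral_congr_fun measurableSet_Ioi h1, integral_const_mul,
      integral_pow_mul_cexp_neg _ hre]
    field_simp
  simp only [hinner]
  rw [integral_const_mul, ← intervalIntegral.integral_of_le (by positivity),
    integral_circleSeries hb]
  push_cast
  have : (Real.pi : ℂ) ≠ 0 := by exact_mod_cast Real.pi_ne_zero
  field_simp

/-- A flow with prescribed derivatives `∂ₓ²∂ₜⁿ Y = dₙ` at `x = 0`, `t = 0`. -/
theorem exists_flow_of_coeff {a : ℝ} (ha : 0 ≤ a) {d : ℕ → ℝ} {C q : ℝ} (N : ℕ) (hq0 : 0 ≤ q)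
    (hq : q < (25 / 28) ^ 3) (hd : ∀ n, |d n| ≤ C * q ^ n * (3 * n + N).factorial) :
    ∃ Y, IsFlow a (Ici 0) Y ∧ (∀ n, Y 2 n 0 0 = d n) ∧ ∀ t₁ > 0, ∃ K L : ℝ, 0 ≤ K ∧ 0 ≤ L ∧
      ∀ n t, t₁ ≤ t → |Y 2 n 0 t| ≤ K * L ^ n * (n.factorial : ℝ) ^ 2 := by
  set ρ : ℝ := (25 / 28) ^ 3 with hρ
  have hρ0 : 0 < ρ := by positivity
  -- The Fourier coefficients are forced by the moment formula; `q < ρ` makes them summable.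
  set b : ℕ → ℝ := fun n => d n / (ρ ^ n * (3 * n + N).factorial) with hbdef
  have hb : Summable fun k => |b k| := by
    refine Summable.of_nonneg_of_le (fun _ => abs_nonneg _) (fun n => ?_)
      ((summable_geometric_of_lt_one (by positivity) ((div_lt_one hρ0).2 hq)).mul_left C)
    simp only [hbdef]
    rw [abs_div, abs_of_pos (by positivity : 0 < ρ ^ n * ((3 * n + N).factorial : ℝ)),
      div_le_iff₀ (by positivity), div_pow]
    refine (hd n).trans (le_of_eq ?_)
    field_simp
  have hker := isKernel_ray ha hb N
  refine ⟨_, hker.isFlow_superposition ha, fun n => ?_, fun t₁ ht₁ => hker.exists_analytic_bound ht₁⟩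
  unfold superposition
  rw [integral_ray_moment ha hb, Complex.ofReal_re]
  simp only [hbdef, ← hρ]
  field_simp

end LinearKdV

namespace LinearKdV

open Filter Topology

/-! ### Iterates of `P` on analytic functions -/

/-- Cauchy's estimates with two radii: `r - 1 > 0` uniformly on `[-1, 0]`, for real analyticity, and
the full radius `r` at `0`, for the sharp growth of the Taylor coefficients. -/
theorem exists_derivative_family_of_holomorphic {z : ℂ → ℂ} {r R : ℝ} (hr : 1 < r) (hrR : r < R)
    (hz : DifferentiableOn ℂ z (Metric.ball 0 R)) :
    ∃ f : ℕ → ℝ → ℝ, (∀ x, f 0 x = (z x).re) ∧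
      (∀ m, ∀ x ∈ Icc (-1 : ℝ) 0, HasDerivWithinAt (f m) (f (m + 1) x) (Icc (-1) 0) x) ∧
      (∃ C D : ℝ, 0 ≤ C ∧ 0 < D ∧ ∀ m, ∀ x ∈ Icc (-1 : ℝ) 0,
        |f m x| ≤ C * D ^ m * m.factorial) ∧
      ∃ C : ℝ, 0 ≤ C ∧ ∀ m, |f m 0| ≤ C * (m.factorial / r ^ m) := by
  have hball : Metric.closedBall (0 : ℂ) r ⊆ Metric.ball 0 R := Metric.closedBall_subset_ball hrR
  obtain ⟨M, hM⟩ := (isCompact_closedBall (0 : ℂ) r).exists_bound_of_continuousOn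
    (hz.continuousOn.mono hball)
  have hM0 : 0 ≤ M := (norm_nonneg _).trans (hM 0 (by simp; linarith))
  have cauchy : ∀ (m : ℕ) (c : ℂ) (δ : ℝ), 0 < δ → ‖c‖ + δ ≤ r →
      ‖iteratedDeriv m z c‖ ≤ m.factorial * M / δ ^ m := by
    intro m c δ hδ hc
    have hsub : Metric.closedBall c δ ⊆ Metric.closedBall 0 r := by
      apply Metric.closedBall_subset_closedBall'
      rw [dist_zero_right]; linarith
    refine Complex.norm_iteratedDeriv_le_of_forall_mem_sphere_norm_le m hδ ?_
      fun w hw => hM w (hsub (Metric.sphere_subset_closedBall hw))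
    refine (hz.mono ?_).diffContOnCl
    rw [closure_ball _ hδ.ne']
    exact hsub.trans hball
  have hnorm : ∀ x ∈ Icc (-1 : ℝ) 0, ‖(x : ℂ)‖ ≤ 1 := fun x hx => by
    rw [Complex.norm_real, Real.norm_eq_abs, abs_le]
    exact ⟨hx.1, hx.2.trans zero_le_one⟩
  refine ⟨fun m x => (iteratedDeriv m z x).re, fun x => by simp, fun m x hx => ?_,
    ⟨M, (r - 1)⁻¹, hM0, by rw [inv_pos]; linarith, fun m x hx => ?_⟩, M, hM0, fun m => ?_⟩
  · have han : AnalyticAt ℂ z x := hz.analyticAt (Metric.isOpen_ball.mem_nhds (by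
      rw [mem_ball_zero_iff]; linarith [hnorm x hx]))
    have hd : HasDerivAt (iteratedDeriv m z) (iteratedDeriv (m + 1) z x) x := by
      rw [iteratedDeriv_succ, iteratedDeriv_eq_iterate]
      exact (han.iterated_deriv m).differentiableAt.hasDerivAt
    exact hd.real_of_complex.hasDerivWithinAt
  · refine (Complex.abs_re_le_norm _).trans
      ((cauchy m x (r - 1) (by linarith) (by linarith [hnorm x hx])).trans (le_of_eq ?_))
    rw [inv_pow, div_eq_mul_inv]; ring
  · refine (Complex.abs_re_le_norm _).trans
      ((cauchy m _ r (by linarith) (by simp)).trans (le_of_eq ?_))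
    ring

/-- `∂ₓ^m Pⁿ f`, in terms of the family `f m = ∂ₓ^m f`. -/
def iterP (a : ℝ) (f : ℕ → ℝ → ℝ) : ℕ → ℕ → ℝ → ℝ
  | 0, m => f m
  | n + 1, m => fun x => iterP a f n (m + 3) x + a * iterP a f n (m + 1) x

theorem hasDerivWithinAt_iterP {a : ℝ} {f : ℕ → ℝ → ℝ} {s : Set ℝ}
    (hf : ∀ m, ∀ x ∈ s, HasDerivWithinAt (f m) (f (m + 1) x) s x) (n : ℕ) :
    ∀ m, ∀ x ∈ s, HasDerivWithinAt (iterP a f n m) (iterP a f n (m + 1) x) s x := by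
  induction n with
  | zero => exact hf
  | succ n ih =>
    intro m x hx
    exact (ih (m + 3) x hx).add ((ih (m + 1) x hx).const_mul a)

theorem iterate_P_eq {a : ℝ} {f : ℕ → ℝ → ℝ} {y : ℝ → ℝ}
    (hf : ∀ m, ∀ x ∈ Icc (-1 : ℝ) 0, HasDerivWithinAt (f m) (f (m + 1) x) (Icc (-1) 0) x)
    (hy : ∀ x ∈ Icc (-1 : ℝ) 0, y x = f 0 x) (n : ℕ) :
    ∀ x ∈ Icc (-1 : ℝ) 0, (P a)^[n] y x = iterP a f n 0 x := by
  have hs : UniqueDiffOn ℝ (Icc (-1 : ℝ) 0) := uniqueDiffOn_Icc (by norm_num)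
  induction n with
  | zero => exact hy
  | succ n ih =>
    intro x hx
    have hd := iteratedDerivWithin_eq_of_family hs (hasDerivWithinAt_iterP (a := a) hf n)
    rw [Function.iterate_succ_apply', P, iteratedDerivWithin_congr ih hx,
      ← iteratedDerivWithin_one, iteratedDerivWithin_congr ih hx, hd 3 0 x hx, hd 1 0 x hx]
    rfl

/-- If the bound does not decrease from order `m + 1` to order `m + 3`, each application of `P`
costs three derivatives and a factor `1 + a`. -/
theorem abs_iterP_le {a : ℝ} (ha : 0 ≤ a) {f : ℕ → ℝ → ℝ} {x C : ℝ} {b : ℕ → ℝ}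
    (hC : 0 ≤ C) (hb : ∀ m, b (m + 1) ≤ b (m + 3)) (hf : ∀ m, |f m x| ≤ C * b m) (n : ℕ) :
    ∀ m, |iterP a f n m x| ≤ C * (1 + a) ^ n * b (m + 3 * n) := by
  induction n with
  | zero => intro m; simpa [iterP] using hf m
  | succ n ih =>
    intro m
    have h1 := ih (m + 3)
    have h2 := ih (m + 1)
    have h3 := hb (m + 3 * n)
    have e3 : m + 3 + 3 * n = m + 3 * (n + 1) := by ring
    have e1 : m + 1 + 3 * n = m + 3 * n + 1 := by ring
    have e2 : m + 3 * n + 3 = m + 3 * (n + 1) := by ring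
    rw [e3] at h1
    rw [e1] at h2
    rw [e2] at h3
    calc |iterP a f n (m + 3) x + a * iterP a f n (m + 1) x|
        ≤ |iterP a f n (m + 3) x| + a * |iterP a f n (m + 1) x| := by
          refine (abs_add_le _ _).trans_eq ?_
          rw [abs_mul, abs_of_nonneg ha]
      _ ≤ C * (1 + a) ^ n * b (m + 3 * (n + 1))
          + a * (C * (1 + a) ^ n * b (m + 3 * (n + 1))) := by
          gcongr
          exact h2.trans (by gcongr)
      _ = _ := by ring

theorem R₀_pow_three {a : ℝ} (ha : 0 ≤ a) :
    R₀ a ^ 3 = Real.exp (Real.exp 1)⁻¹ * (1 + a) := by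
  unfold R₀
  rw [mul_pow, ← Real.exp_nat_mul, ← Real.rpow_natCast ((1 + a) ^ ((1 : ℝ) / 3)),
    ← Real.rpow_mul (by linarith)]
  have := Real.exp_pos 1
  congr 1
  · congr 1; push_cast; field_simp
  · norm_num

/-- The left side is `e^{-1/e}`, about `0.692`, against about `0.712` on the right; the quadratic
Taylor bound of the exponential at `1/e` already separates them. -/
theorem ratio_lt {a : ℝ} (ha : 0 ≤ a) : (1 + a) / R₀ a ^ 3 < (25 / 28) ^ 3 := by
  rw [R₀_pow_three ha, div_lt_iff₀ (by positivity)]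
  have h1 : (2.7182818286 : ℝ)⁻¹ ≤ (Real.exp 1)⁻¹ :=
    inv_anti₀ (Real.exp_pos 1) Real.exp_one_lt_d9.le
  have h2 : (0.36787 : ℝ) ≤ (Real.exp 1)⁻¹ := le_trans (by norm_num) h1
  have h3 := Real.quadratic_le_exp_of_nonneg (x := (Real.exp 1)⁻¹) (by positivity)
  have h4 : 1.43 ≤ Real.exp (Real.exp 1)⁻¹ := by nlinarith
  nlinarith [mul_le_mul_of_nonneg_right h4 (by linarith : 0 ≤ 1 + a)]

/-- The numbers `∂ₓ² Pⁿ f (0)` of a function that is holomorphic on a disk of radius greater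
than `R₀`. -/
theorem exists_abs_iterP_two_le {a : ℝ} (ha : 0 ≤ a) {f : ℕ → ℝ → ℝ} {C : ℝ} (hC : 0 ≤ C)
    (hf : ∀ m, |f m 0| ≤ C * (m.factorial / R₀ a ^ m)) :
    ∃ (C' : ℝ) (N : ℕ), ∀ n,
      |iterP a f n 2 0| ≤ C' * ((1 + a) / R₀ a ^ 3) ^ n * (3 * n + N).factorial := by
  -- `m!/R₀^m` decreases at first. The shift to `(m + K)!` with `K ≥ R₀` restores the monotonicity
  -- needed, without changing the geometric rate; it is the source of `N`.
  obtain ⟨K, hK⟩ := exists_nat_ge (R₀ a)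
  have hR := one_lt_R₀ ha
  have hR0 : 0 < R₀ a := by linarith
  refine ⟨C / R₀ a ^ 2, 2 + K, fun n => ?_⟩
  have key := abs_iterP_le ha (b := fun m => (m + K).factorial / R₀ a ^ m) hC (fun m => ?_)
    (fun m => (hf m).trans ?_) n 2
  · refine key.trans (le_of_eq ?_)
    rw [show 2 + 3 * n + K = 3 * n + (2 + K) by ring, pow_add, pow_mul, div_pow]
    field_simp
  · rw [div_le_div_iff₀ (by positivity) (by positivity),
      show m + 3 + K = (m + 1 + K) + 1 + 1 by ring, Nat.factorial_succ, Nat.factorial_succ]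
    push_cast
    have h1 : R₀ a ≤ m + 1 + K + 1 + 1 := by linarith [(m.cast_nonneg : (0 : ℝ) ≤ m)]
    have h2 : R₀ a ≤ m + 1 + K + 1 := by linarith [(m.cast_nonneg : (0 : ℝ) ≤ m)]
    calc ((m + 1 + K).factorial : ℝ) * R₀ a ^ (m + 3)
        = R₀ a * (R₀ a * (m + 1 + K).factorial) * R₀ a ^ (m + 1) := by ring
      _ ≤ _ := by gcongr
  · have : m.factorial ≤ (m + K).factorial := Nat.factorial_le (Nat.le_add_right _ _)
    gcongr

/-! ### Reachability -/

/-- The zero conditions and the derivatives of the trace at time `t` fix, through the equation, all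
`x`-derivatives at `x = 0`; the analytic bounds do the rest. -/
theorem IsFlow.eqOn_of_eq_two {a t : ℝ} {S : Set ℝ} {Y Z : ℕ → ℕ → ℝ → ℝ → ℝ}
    (hY : IsFlow a S Y) (hZ : IsFlow a S Z) (ht : t ∈ S) (h : ∀ n, Y 2 n 0 t = Z 2 n 0 t) :
    ∀ x ∈ Icc (-1 : ℝ) 0, Y 0 0 x t = Z 0 0 x t := by
  have hz : (0 : ℝ) ∈ Icc (-1 : ℝ) 0 := by norm_num
  obtain ⟨C, D, hC, hD, hb⟩ := hY.bound
  obtain ⟨C', D', hC', hD', hb'⟩ := hZ.bound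
  refine eqOn_of_analytic_bound (F := fun m x => Y m 0 x t) (G := fun m x => Z m 0 x t)
    hC.le hD hC'.le hD' (fun m x hx => hY.hasDeriv_x m 0 x hx t ht)
    (fun m x hx => hZ.hasDeriv_x m 0 x hx t ht) (fun m x hx => ?_) (fun m x hx => ?_)
    fun m => ?_
  · simpa using hb m 0 x hx t ht
  · simpa using hb' m 0 x hx t ht
  · exact eq_of_recursion (f := fun m n => Y m n 0 t) (g := fun m n => Z m n 0 t)
      (fun m n => hY.equation m n 0 hz t ht) (fun m n => hZ.equation m n 0 hz t ht)
      (fun n => (hY.zero_right n t ht).trans (hZ.zero_right n t ht).symm)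
      (fun n => (hY.zero_right_deriv n t ht).trans (hZ.zero_right_deriv n t ht).symm) h m 0

/-- Every element of the reachable class is the value at time `0` of a flow on `[0, ∞)` whose
trace `∂ₓ² Y (0, t)` is Gevrey of order `2` away from `t = 0`. -/
theorem exists_flow_of_mem_reachClass {a R : ℝ} (ha : 0 ≤ a) (hR : R₀ a < R) {y₁ : ℝ → ℝ}
    (hy₁ : y₁ ∈ reachClass a R) :
    ∃ Y, IsFlow a (Ici 0) Y ∧ (∀ x ∈ Icc (-1 : ℝ) 0, Y 0 0 x 0 = y₁ x) ∧
      ∀ t₁ > 0, ∃ K L : ℝ, 0 ≤ K ∧ 0 ≤ L ∧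
        ∀ n t, t₁ ≤ t → |Y 2 n 0 t| ≤ K * L ^ n * (n.factorial : ℝ) ^ 2 := by
  obtain ⟨-, ⟨z, hz, hzy⟩, hP⟩ := hy₁
  have hs : UniqueDiffOn ℝ (Icc (-1 : ℝ) 0) := uniqueDiffOn_Icc (by norm_num)
  have h0 : (0 : ℝ) ∈ Icc (-1 : ℝ) 0 := by norm_num
  obtain ⟨f, hf0, hf, ⟨C, D, hC, hD, hb⟩, C', hC', hb'⟩ :=
    exists_derivative_family_of_holomorphic (one_lt_R₀ ha) hR hz
  have hy : ∀ x ∈ Icc (-1 : ℝ) 0, y₁ x = f 0 x := fun x hx => by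
    rw [hf0, ← hzy x hx, Complex.ofReal_re]
  have hiter := iterate_P_eq (a := a) hf hy
  have hq0 : ∀ n, iterP a f n 0 0 = 0 := fun n => by rw [← hiter n 0 h0, (hP n).1]
  have hq1 : ∀ n, iterP a f n 1 0 = 0 := fun n => by
    have h := (hP n).2
    rwa [derivWithin_congr (hiter n) (hiter n 0 h0),
      (hasDerivWithinAt_iterP hf n 0 0 h0).derivWithin (hs 0 h0)] at h
  obtain ⟨C₂, N, hd⟩ := exists_abs_iterP_two_le ha hC' hb'
  obtain ⟨Y, hY, hY2, hYK⟩ := exists_flow_of_coeff ha N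
    (div_nonneg (by linarith) (by have := one_lt_R₀ ha; positivity)) (ratio_lt ha) hd
  refine ⟨Y, hY, fun x hx => ?_, hYK⟩
  have ht : (0 : ℝ) ∈ Ici (0 : ℝ) := self_mem_Ici
  obtain ⟨C₁, D₁, hC₁, hD₁, hb₁⟩ := hY.bound
  rw [hy x hx]
  refine eqOn_of_analytic_bound (F := fun m x => Y m 0 x 0) (G := f)
    hC₁.le hD₁ hC hD (fun m x hx => hY.hasDeriv_x m 0 x hx 0 ht) hf (fun m x hx => ?_) hb
    (fun m => ?_) x hx
  · simpa using hb₁ m 0 x hx 0 ht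
  -- The families `∂ₓ^m∂ₜⁿY` and `∂ₓ^m Pⁿf` at `(0, 0)` obey the same recursion. The conditions at
  -- `0` in `reachClass` supply `m = 0, 1`, and the moments supply `m = 2`.
  · exact eq_of_recursion (f := fun m n => Y m n 0 0) (g := fun m n => iterP a f n m 0)
      (fun m n => hY.equation m n 0 h0 0 ht) (fun _ _ => rfl)
      (fun n => (hY.zero_right n 0 ht).trans (hq0 n).symm)
      (fun n => (hY.zero_right_deriv n 0 ht).trans (hq1 n).symm) hY2 m 0

theorem exists_flow_connecting_zero {a T R : ℝ} (ha : 0 ≤ a) (hT : 0 < T) (hR : R₀ a < R)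
    {y₁ : ℝ → ℝ} (hy₁ : y₁ ∈ reachClass a R) :
    ∃ Y, IsFlow a (Icc 0 T) Y ∧ (∀ x ∈ Icc (-1 : ℝ) 0, Y 0 0 x 0 = y₁ x) ∧
      ∀ x ∈ Icc (-1 : ℝ) 0, Y 0 0 x T = 0 := by
  obtain ⟨A, hA, hA0, hAK⟩ := exists_flow_of_mem_reachClass ha hR hy₁
  have h0 : (0 : ℝ) ∈ Icc (-1 : ℝ) 0 := by norm_num
  have hTm : T ∈ Icc 0 T := ⟨hT.le, le_rfl⟩
  obtain ⟨K, L, hK, hL, hb⟩ := hAK (T / 4) (by linarith)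
  obtain ⟨χ, hχ, hχ0, hχ1, hχ1'⟩ := exists_cutoff (t₁ := T / 4) (t₂ := 3 * T / 4) (by linarith)
  have hz : ∀ n, ∀ t > 0, HasDerivAt (fun s => A 2 n 0 s) (A 2 (n + 1) 0 t) t := fun n t ht =>
    (hA.hasDeriv_t 2 n 0 h0 t (mem_Ici.2 ht.le)).hasDerivAt (Ici_mem_nhds ht)
  -- The trace of `A` may be only of order 3 at `t = 0`; the cutoff vanishes up to `T/4` and removes
  -- that region.
  have hw := isGevreyTwo_leibniz_cutoff (z := fun n t => A 2 n 0 t) (by linarith) hχ hχ0 hK hL hz hb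
  obtain ⟨K', L', hK', hL', hb'⟩ := hw.bound
  have hC := isFlow_cauchyFlow ha hw.hasDerivAt hK' hL' hb' (Icc 0 T)
  have hA' : IsFlow a (Icc 0 T) A := hA.mono Icc_subset_Ici_self
  refine ⟨_, hA'.sub hC, fun x hx => ?_, fun x hx => ?_⟩
  · have : cauchyFlow a (leibniz χ fun n t => A 2 n 0 t) 0 0 x 0 = 0 := by
      refine cauchyFlow_eq_zero (fun n => ?_) 0 0 x
      exact Finset.sum_eq_zero fun ij _ => by rw [hχ0 _ 0 (by linarith)]; ring
    simp only [this, sub_zero, hA0 x hx]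
  -- From `3T/4` on the cutoff is `1` with vanishing derivatives, so both flows have the same trace
  -- derivatives at `T`.
  · refine sub_eq_zero.2 (hA'.eqOn_of_eq_two hC hTm (fun n => ?_) x hx)
    rw [cauchyFlow_two_zero, leibniz_of_eq_one (hχ1 T (by linarith))
      fun n => hχ1' n T (by linarith)]

end LinearKdV

theorem theorem2 (a T R : ℝ) (ha : 0 ≤ a) (hT : 0 < T) (hR : LinearKdV.R₀ a < R)
    (y₁ : ℝ → ℝ) (hy₁ : y₁ ∈ LinearKdV.reachClass a R) :
    ∃ u : ℝ → ℝ, LinearKdV.Gevrey 3 0 T u ∧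
      ∃ y : ℝ → ℝ → ℝ,
        LinearKdV.IsSolution a T u (fun _ => 0) y ∧
        (∀ v : ℝ → ℝ → ℝ, LinearKdV.IsSolution a T u (fun _ => 0) v →
          ∀ x ∈ Set.Icc (-1 : ℝ) 0, ∀ t ∈ Set.Icc 0 T, v x t = y x t) ∧
        (∀ x ∈ Set.Icc (-1 : ℝ) 0, y x T = y₁ x) ∧
        LinearKdV.GevreyRect 1 3 (-1) 0 0 T y := by
  obtain ⟨Y, hY, hY0, hYT⟩ := LinearKdV.exists_flow_connecting_zero ha hT hR hy₁
  have hsol := hY.isSolution hT hYT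
  refine ⟨_, hY.gevrey_left hT, _, hsol, fun v hv => hv.unique hsol, fun x hx => ?_,
    hY.gevreyRect hT⟩
  simp only [sub_self, hY0 x hx]
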